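/- Let $k$ be a field of characteristic zero. A dg Lie algebra is a $\mathbb Z$-graded (cohomological, possibly unbounded) dg Lie algebra over $k$; it is nilpotent if its lower central series reaches $0$. Put $\mathrm{MC}(\mathfrak g)=\{x\in\mathfrak g^1 : dx+\tfrac12[x,x]=0\}$. Let $\Omega_n=k[t_0,\dots,t_n,dt_0,\dots,dt_n]/(\sum t_i-1,\sum dt_i)$ be the commutative dg algebra of polynomial differential forms on the standard $n$-simplex; the $\Omega_n$ form a simplicial commutative dg algebra. If $\mathfrak g$ is nilpotent, so is the dg Lie algebra $\Omega_n\otimes\mathfrak g$. For nilpotent $\mathfrak g$ let $\Sigma(\mathfrak g)$ be the simplicial set $n\mapsto \mathrm{MC}(\Omega_n\otimes\mathfrak g)$. For $n\ge 0$ let $G_n=\exp\big((\Omega_n\otimes\mathfrak g)^0\big)$ be the group with underlying set $(\Omega_n\otimes\mathfrak g)^0$ and the Baker–Campbell–Hausdorff multiplication; it acts on $\mathrm{MC}(\Omega_n\otimes\mathfrak g)$ by the gauge action $$\exp(a)(x)=e^{\mathrm{ad}\,a}x-\frac{e^{\mathrm{ad}\,a}-1}{\mathrm{ad}\,a}(da).$$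 Let $\Gamma(\mathfrak g)$ be the simplicial groupoid (simplicial Deligne groupoid) with set of objects $\mathrm{MC}(\mathfrak g)$ and with $n$-morphisms $$\mathrm{Hom}_{\Gamma(\mathfrak g)}(x,y)_n=\{g\in G_n : g(1\otimes x)=1\otimes y\},$$ composed by multiplication in $G_n$. Its nerve $\mathcal N(\Gamma(\mathfrak g))$ is the diagonal of the bisimplicial set formed by the nerves of the groupoids $\Gamma_n(\mathfrak g)$; so its $n$-simplices are the $n$-simplices of the nerve of $\Gamma_n(\mathfrak g)$. Then $\Sigma(\mathfrak g)$ and $\mathcal N(\Gamma(\mathfrak g))$ are naturally homotopy equivalent: as functors from the category of nilpotent dg Lie algebras over $k$ to simplicial sets, $\mathfrak g\mapsto\Sigma(\mathfrak g)$ and $\mathfrak g\mapsto\mathcal N(\Gamma(\mathfrak g))$ are connected by a finite zigzag of natural transformations, each of whose components is a homotopy equivalence of simplicial sets. -/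

import Mathlib

open CategoryTheory Opposite
open scoped TensorProduct

universe u

noncomputable section

/-! ### Graded modules -/

section Graded

variable {k M N : Type*} [Field k] [AddCommGroup M] [Module k M] [AddCommMonoid N] [Module k N]

/-- The linear map which is `f i` on the component of degree `i`. -/
def gradedLift {𝒜 : ℤ → Submodule k M} (h : DirectSum.IsInternal 𝒜) (f : ℤ → M →ₗ[k] N) :
    M →ₗ[k] N :=
  (DirectSum.toModule k ℤ N fun i => (f i).comp (𝒜 i).subtype).comp
    (LinearEquiv.ofBijective (DirectSum.coeLinearMap 𝒜) h).symm.toLinearMap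

theorem gradedLift_of_mem {𝒜 : ℤ → Submodule k M} (h : DirectSum.IsInternal 𝒜)
    (f : ℤ → M →ₗ[k] N) {i : ℤ} {x : M} (hx : x ∈ 𝒜 i) : gradedLift h f x = f i x := by
  have e : (LinearEquiv.ofBijective (DirectSum.coeLinearMap 𝒜) h).symm x
      = DirectSum.lof k ℤ (fun i => 𝒜 i) i ⟨x, hx⟩ := by
    rw [LinearEquiv.symm_apply_eq]
    exact (DirectSum.coeLinearMap_lof 𝒜 i ⟨x, hx⟩).symm
  rw [gradedLift, LinearMap.comp_apply, LinearEquiv.coe_coe, e, DirectSum.toModule_lof]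
  rfl

theorem graded_induction {𝒜 : ℤ → Submodule k M} (h : DirectSum.IsInternal 𝒜) {p : M → Prop}
    (hmem : ∀ i, ∀ x ∈ 𝒜 i, p x) (hadd : ∀ x y, p x → p y → p (x + y)) (x : M) : p x := by
  have hx : x ∈ iSup 𝒜 := by rw [h.submodule_iSup_eq_top]; trivial
  exact Submodule.iSup_induction 𝒜 (motive := p) hx hmem (hmem 0 0 (zero_mem _)) hadd

theorem isInternal_of_weights {𝒜 : ℤ → Submodule k M} (c : M →ₗ[k] (ℤ →₀ M))
    (hc : ∀ i, ∀ x ∈ 𝒜 i, c x = Finsupp.single i x) (htop : iSup 𝒜 = ⊤) :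
    DirectSum.IsInternal 𝒜 := by
  have key : ∀ (v : DirectSum ℤ fun i => 𝒜 i) (j : ℤ),
      c (DirectSum.coeLinearMap 𝒜 v) j = (v j : M) := by
    intro v j
    induction v using DirectSum.induction_on with
    | zero => simp
    | of i x =>
      have : DirectSum.coeLinearMap 𝒜 (DirectSum.of (fun i => 𝒜 i) i x) = (x : M) :=
        DirectSum.coeLinearMap_lof 𝒜 i x
      rw [this, hc i x x.2, DirectSum.coe_of_apply, Finsupp.single_apply]
      split_ifs <;> rfl
    | add x y hx hy => simp [hx, hy]
  refine ⟨fun v w hvw => ?_, ?_⟩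
  · ext j
    have hvw' : DirectSum.coeLinearMap 𝒜 v = DirectSum.coeLinearMap 𝒜 w := hvw
    rw [← key, ← key, hvw']
  · have : LinearMap.range (DirectSum.coeLinearMap 𝒜) = ⊤ := by
      rw [← htop]; exact DirectSum.range_coeLinearMap
    exact LinearMap.range_eq_top.1 this

end Graded

/-! ### Differential graded Lie algebras and commutative dg algebras -/

/-- A (cohomologically graded, unbounded) dg Lie algebra over `k`. -/
structure DGLieAlgebra (k : Type u) [Field k] where
  carrier : Type u
  [addCommGroup : AddCommGroup carrier]
  [module : Module k carrier]
  deg : ℤ → Submodule k carrier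
  isInternal : DirectSum.IsInternal deg
  d : carrier →ₗ[k] carrier
  d_mem : ∀ {i : ℤ} {x : carrier}, x ∈ deg i → d x ∈ deg (i + 1)
  d_d : ∀ x : carrier, d (d x) = 0
  bracket : carrier →ₗ[k] carrier →ₗ[k] carrier
  bracket_mem : ∀ {i j : ℤ} {x y : carrier}, x ∈ deg i → y ∈ deg j → bracket x y ∈ deg (i + j)
  bracket_skew : ∀ {i j : ℤ} {x y : carrier}, x ∈ deg i → y ∈ deg j →
    bracket x y = -((i * j).negOnePow • bracket y x)
  jacobi : ∀ {i j : ℤ} {x y : carrier} (z : carrier), x ∈ deg i → y ∈ deg j →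
    bracket x (bracket y z) =
      bracket (bracket x y) z + (i * j).negOnePow • bracket y (bracket x z)
  d_bracket : ∀ {i : ℤ} {x : carrier} (y : carrier), x ∈ deg i →
    d (bracket x y) = bracket (d x) y + i.negOnePow • bracket x (d y)

attribute [instance] DGLieAlgebra.addCommGroup DGLieAlgebra.module

namespace DGLieAlgebra

variable {k : Type u} [Field k]

/-- A morphism of dg Lie algebras. -/
@[ext]
structure Hom (g h : DGLieAlgebra k) where
  toLinearMap : g.carrier →ₗ[k] h.carrier
  map_mem : ∀ {i : ℤ} {x : g.carrier}, x ∈ g.deg i → toLinearMap x ∈ h.deg i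
  map_d : ∀ x : g.carrier, toLinearMap (g.d x) = h.d (toLinearMap x)
  map_bracket : ∀ x y : g.carrier,
    toLinearMap (g.bracket x y) = h.bracket (toLinearMap x) (toLinearMap y)

instance : Category (DGLieAlgebra k) where
  Hom g h := Hom g h
  id g := ⟨LinearMap.id, fun h => h, fun _ => rfl, fun _ _ => rfl⟩
  comp f f' := ⟨f'.toLinearMap.comp f.toLinearMap, fun h => f'.map_mem (f.map_mem h),
    fun x => by simp [f.map_d, f'.map_d], fun x y => by simp [f.map_bracket, f'.map_bracket]⟩

@[ext]
theorem hom_ext {g h : DGLieAlgebra k} {f f' : g ⟶ h} (e : f.toLinearMap = f'.toLinearMap) :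
    f = f' := Hom.ext e

@[simp]
theorem id_toLinearMap (g : DGLieAlgebra k) : (𝟙 g : g ⟶ g).toLinearMap = LinearMap.id := rfl

@[simp]
theorem comp_toLinearMap {g h l : DGLieAlgebra k} (f : g ⟶ h) (f' : h ⟶ l) :
    (f ≫ f').toLinearMap = f'.toLinearMap.comp f.toLinearMap := rfl

/-- The lower central series: `g`, `[g, g]`, `[g, [g, g]]`, ... -/
def lcs (g : DGLieAlgebra k) : ℕ → Submodule k g.carrier
  | 0 => ⊤
  | n + 1 => Submodule.map₂ g.bracket ⊤ (lcs g n)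

/-- A dg Lie algebra is nilpotent if its lower central series reaches zero. -/
def IsNilpotent (g : DGLieAlgebra k) : Prop := ∃ n, g.lcs n = ⊥

end DGLieAlgebra

/-- A graded commutative dg algebra over `k`. -/
structure CommDGAlgebra (k : Type u) [Field k] where
  carrier : Type u
  [ring : Ring carrier]
  [algebra : Algebra k carrier]
  deg : ℤ → Submodule k carrier
  isInternal : DirectSum.IsInternal deg
  one_mem : (1 : carrier) ∈ deg 0
  mul_mem : ∀ {i j : ℤ} {x y : carrier}, x ∈ deg i → y ∈ deg j → x * y ∈ deg (i + j)
  graded_comm : ∀ {i j : ℤ} {x y : carrier}, x ∈ deg i → y ∈ deg j →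
    x * y = (i * j).negOnePow • (y * x)
  d : carrier →ₗ[k] carrier
  d_mem : ∀ {i : ℤ} {x : carrier}, x ∈ deg i → d x ∈ deg (i + 1)
  d_d : ∀ x : carrier, d (d x) = 0
  d_mul : ∀ {i : ℤ} {x : carrier} (y : carrier), x ∈ deg i →
    d (x * y) = d x * y + i.negOnePow • (x * d y)

attribute [instance] CommDGAlgebra.ring CommDGAlgebra.algebra

namespace CommDGAlgebra

variable {k : Type u} [Field k]

/-- A morphism of commutative dg algebras. -/
@[ext]
structure Hom (A B : CommDGAlgebra k) where
  toAlgHom : A.carrier →ₐ[k] B.carrier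
  map_mem : ∀ {i : ℤ} {x : A.carrier}, x ∈ A.deg i → toAlgHom x ∈ B.deg i
  map_d : ∀ x : A.carrier, toAlgHom (A.d x) = B.d (toAlgHom x)

instance : Category (CommDGAlgebra k) where
  Hom A B := Hom A B
  id A := ⟨AlgHom.id k _, fun h => h, fun _ => rfl⟩
  comp f f' := ⟨f'.toAlgHom.comp f.toAlgHom, fun h => f'.map_mem (f.map_mem h),
    fun x => by simp [f.map_d, f'.map_d]⟩

@[ext]
theorem hom_ext {A B : CommDGAlgebra k} {f f' : A ⟶ B} (e : f.toAlgHom = f'.toAlgHom) :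
    f = f' := Hom.ext e

@[simp]
theorem id_toAlgHom (A : CommDGAlgebra k) : (𝟙 A : A ⟶ A).toAlgHom = AlgHom.id k _ := rfl

@[simp]
theorem comp_toAlgHom {A B C : CommDGAlgebra k} (f : A ⟶ B) (f' : B ⟶ C) :
    (f ≫ f').toAlgHom = f'.toAlgHom.comp f.toAlgHom := rfl

end CommDGAlgebra

/-! ### The tensor product of a commutative dg algebra and a dg Lie algebra -/

namespace TensorDGLie

variable {k : Type u} [Field k] (A : CommDGAlgebra k) (g : DGLieAlgebra k)

/-- Degree `m` of `A ⊗ g`: spanned by `a ⊗ x` with `|a| + |x| = m`. -/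
def deg (m : ℤ) : Submodule k (A.carrier ⊗[k] g.carrier) :=
  Submodule.span k {z | ∃ (p i : ℤ) (a : A.carrier) (x : g.carrier),
    a ∈ A.deg p ∧ x ∈ g.deg i ∧ p + i = m ∧ z = a ⊗ₜ[k] x}

variable {A g}

theorem tmul_mem {p i : ℤ} {a : A.carrier} {x : g.carrier} (ha : a ∈ A.deg p) (hx : x ∈ g.deg i) :
    a ⊗ₜ[k] x ∈ deg A g (p + i) :=
  Submodule.subset_span ⟨p, i, a, x, ha, hx, rfl, rfl⟩

theorem tmul_mem' {p i m : ℤ} {a : A.carrier} {x : g.carrier} (ha : a ∈ A.deg p)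
    (hx : x ∈ g.deg i) (h : p + i = m) : a ⊗ₜ[k] x ∈ deg A g m := h ▸ tmul_mem ha hx

theorem induction {P : A.carrier ⊗[k] g.carrier → Prop}
    (h : ∀ (p i : ℤ) (a : A.carrier) (x : g.carrier), a ∈ A.deg p → x ∈ g.deg i → P (a ⊗ₜ[k] x))
    (hadd : ∀ z w, P z → P w → P (z + w)) (z : A.carrier ⊗[k] g.carrier) : P z := by
  induction z using TensorProduct.induction_on with
  | zero => simpa using h 0 0 0 0 (zero_mem _) (zero_mem _)
  | add z w hz hw => exact hadd z w hz hw
  | tmul a x =>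
    refine graded_induction A.isInternal (p := fun a => P (a ⊗ₜ[k] x)) (fun p a ha => ?_)
      (fun a b h1 h2 => by rw [TensorProduct.add_tmul]; exact hadd _ _ h1 h2) a
    exact graded_induction g.isInternal (p := fun x => P (a ⊗ₜ[k] x))
      (fun i x hx => h p i a x ha hx)
      (fun a b h1 h2 => by rw [TensorProduct.tmul_add]; exact hadd _ _ h1 h2) x

theorem deg_induction {m : ℤ} {P : A.carrier ⊗[k] g.carrier → Prop}
    (h : ∀ (p i : ℤ) (a : A.carrier) (x : g.carrier), a ∈ A.deg p → x ∈ g.deg i → p + i = m →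
      P (a ⊗ₜ[k] x))
    (hadd : ∀ z w, P z → P w → P (z + w)) (hsmul : ∀ (c : k) z, P z → P (c • z))
    {z : A.carrier ⊗[k] g.carrier} (hz : z ∈ deg A g m) : P z := by
  refine Submodule.span_induction (p := fun z _ => P z) ?_ ?_ (fun z w _ _ => hadd z w)
    (fun c z _ => hsmul c z) hz
  · rintro _ ⟨p, i, a, x, ha, hx, hm, rfl⟩
    exact h p i a x ha hx hm
  · simpa using h m 0 0 0 (zero_mem _) (zero_mem _) (by simp)

theorem isInternal : DirectSum.IsInternal (deg A g) := by
  let cA := gradedLift A.isInternal fun p => Finsupp.lsingle (R := k) p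
  let cg := gradedLift g.isInternal fun i => Finsupp.lsingle (R := k) i
  let c : A.carrier ⊗[k] g.carrier →ₗ[k] (ℤ →₀ A.carrier ⊗[k] g.carrier) :=
    (Finsupp.lmapDomain _ k fun q : ℤ × ℤ => q.1 + q.2).comp
      ((finsuppTensorFinsupp k k A.carrier g.carrier ℤ ℤ).toLinearMap.comp
        (TensorProduct.map cA cg))
  refine isInternal_of_weights c (fun m z hz => ?_) ?_
  · refine deg_induction (P := fun z => c z = Finsupp.single m z) ?_ ?_ ?_ hz
    · rintro p i a x ha hx rfl
      simp [c, cA, cg, gradedLift_of_mem _ _ ha, gradedLift_of_mem _ _ hx]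
    · intro z w h1 h2
      rw [map_add, h1, h2, Finsupp.single_add]
    · intro t z h1
      rw [map_smul, h1, Finsupp.smul_single]
  · rw [eq_top_iff]
    intro z _
    exact induction (P := fun z => z ∈ iSup (deg A g))
      (fun p i a x ha hx => Submodule.mem_iSup_of_mem (p + i) (tmul_mem ha hx))
      (fun z w => add_mem) z

variable (A g)

/-- The sign operator `a ↦ (-1) ^ (i * |a|) a`. -/
def signTwist (i : ℤ) : A.carrier →ₗ[k] A.carrier :=
  gradedLift A.isInternal fun p => ((i * p).negOnePow : ℤ) • LinearMap.id

/-- The Koszul braiding `x ⊗ a ↦ (-1) ^ (|x| * |a|) a ⊗ x`. -/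
def braiding : g.carrier ⊗[k] A.carrier →ₗ[k] A.carrier ⊗[k] g.carrier :=
  TensorProduct.lift (gradedLift g.isInternal fun i =>
    (TensorProduct.mk k A.carrier g.carrier).flip.compl₂ (signTwist A i))

/-- The bracket `[a ⊗ x, b ⊗ y] = (-1) ^ (|x| * |b|) ab ⊗ [x, y]`. -/
def bracket : A.carrier ⊗[k] g.carrier →ₗ[k] A.carrier ⊗[k] g.carrier →ₗ[k]
    A.carrier ⊗[k] g.carrier :=
  TensorProduct.curry <|
    (TensorProduct.map (LinearMap.mul' k A.carrier) (TensorProduct.lift g.bracket)).comp <|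
    (TensorProduct.assoc k A.carrier A.carrier (g.carrier ⊗[k] g.carrier)).symm.toLinearMap.comp <|
    (LinearMap.lTensor A.carrier
      ((TensorProduct.assoc k A.carrier g.carrier g.carrier).toLinearMap.comp <|
        (LinearMap.rTensor g.carrier (braiding A g)).comp <|
        (TensorProduct.assoc k g.carrier A.carrier g.carrier).symm.toLinearMap)).comp <|
    (TensorProduct.assoc k A.carrier g.carrier (A.carrier ⊗[k] g.carrier)).toLinearMap

/-- The differential `d (a ⊗ x) = da ⊗ x + (-1) ^ |a| a ⊗ dx`. -/
def d : A.carrier ⊗[k] g.carrier →ₗ[k] A.carrier ⊗[k] g.carrier :=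
  TensorProduct.map A.d LinearMap.id + TensorProduct.map (signTwist A 1) g.d

variable {A g}

theorem signTwist_of_mem (i : ℤ) {p : ℤ} {a : A.carrier} (ha : a ∈ A.deg p) :
    signTwist A i a = (i * p).negOnePow • a := by
  rw [signTwist, gradedLift_of_mem _ _ ha, Units.smul_def]
  rfl

theorem smul_tmul' {M N : Type*} [AddCommGroup M] [Module k M] [AddCommGroup N] [Module k N]
    (s : ℤˣ) (a : M) (x : N) : (s • a) ⊗ₜ[k] x = s • (a ⊗ₜ[k] x) := by
  rcases Int.units_eq_one_or s with rfl | rfl <;> simp [TensorProduct.neg_tmul]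

theorem tmul_smul' {M N : Type*} [AddCommGroup M] [Module k M] [AddCommGroup N] [Module k N]
    (s : ℤˣ) (a : M) (x : N) : a ⊗ₜ[k] (s • x) = s • (a ⊗ₜ[k] x) := by
  rcases Int.units_eq_one_or s with rfl | rfl <;> simp [TensorProduct.tmul_neg]

theorem map_units_smul {M N : Type*} [AddCommGroup M] [Module k M] [AddCommGroup N] [Module k N]
    (f : M →ₗ[k] N) (s : ℤˣ) (x : M) : f (s • x) = s • f x := by
  rcases Int.units_eq_one_or s with rfl | rfl <;> simp

theorem bracket_units_smul (s : ℤˣ) (z w : A.carrier ⊗[k] g.carrier) :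
    bracket A g (s • z) w = s • bracket A g z w := by
  rcases Int.units_eq_one_or s with rfl | rfl <;> simp

theorem braiding_tmul {i p : ℤ} {x : g.carrier} {a : A.carrier} (hx : x ∈ g.deg i)
    (ha : a ∈ A.deg p) : braiding A g (x ⊗ₜ[k] a) = (i * p).negOnePow • (a ⊗ₜ[k] x) := by
  rw [braiding, TensorProduct.lift.tmul, gradedLift_of_mem _ _ hx]
  simp [signTwist_of_mem i ha]

theorem bracket_tmul (a : A.carrier) {i p : ℤ} {x : g.carrier} {b : A.carrier} (y : g.carrier)
    (hx : x ∈ g.deg i) (hb : b ∈ A.deg p) :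
    bracket A g (a ⊗ₜ[k] x) (b ⊗ₜ[k] y) =
      (i * p).negOnePow • ((a * b) ⊗ₜ[k] g.bracket x y) := by
  simp only [bracket, TensorProduct.curry_apply, LinearMap.comp_apply, LinearEquiv.coe_coe,
    TensorProduct.assoc_tmul, LinearMap.lTensor_tmul, TensorProduct.assoc_symm_tmul,
    LinearMap.rTensor_tmul, braiding_tmul hx hb, smul_tmul']
  rcases Int.units_eq_one_or (i * p).negOnePow with h | h <;>
    simp [h, TensorProduct.tmul_neg]

theorem d_tmul {p : ℤ} {a : A.carrier} (x : g.carrier) (ha : a ∈ A.deg p) :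
    d A g (a ⊗ₜ[k] x) = A.d a ⊗ₜ[k] x + p.negOnePow • (a ⊗ₜ[k] g.d x) := by
  simp [d, signTwist_of_mem 1 ha, smul_tmul']

theorem d_mem {m : ℤ} {z : A.carrier ⊗[k] g.carrier} (hz : z ∈ deg A g m) :
    d A g z ∈ deg A g (m + 1) := by
  refine deg_induction (P := fun z => d A g z ∈ deg A g (m + 1)) ?_ ?_ ?_ hz
  · rintro p i a x ha hx rfl
    rw [d_tmul x ha, Units.smul_def]
    exact add_mem (tmul_mem' (A.d_mem ha) hx (by ring))
      (zsmul_mem (tmul_mem' ha (g.d_mem hx) (by ring)) _)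
  · intro z w h1 h2
    rw [map_add]; exact add_mem h1 h2
  · intro t z h1
    rw [map_smul]; exact Submodule.smul_mem _ _ h1

theorem d_d (z : A.carrier ⊗[k] g.carrier) : d A g (d A g z) = 0 := by
  refine induction (P := fun z => d A g (d A g z) = 0) ?_ ?_ z
  · intro p i a x ha hx
    rw [d_tmul x ha, map_add, map_units_smul, d_tmul x (A.d_mem ha), d_tmul _ ha, A.d_d, g.d_d,
      Int.negOnePow_succ]
    simp
  · intro z w h1 h2
    rw [map_add, map_add, h1, h2, add_zero]

theorem bracket_mem {m n : ℤ} {z w : A.carrier ⊗[k] g.carrier} (hz : z ∈ deg A g m)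
    (hw : w ∈ deg A g n) : bracket A g z w ∈ deg A g (m + n) := by
  refine deg_induction (P := fun z => bracket A g z w ∈ deg A g (m + n)) ?_ ?_ ?_ hz
  · rintro p i a x ha hx rfl
    refine deg_induction (P := fun w => bracket A g (a ⊗ₜ[k] x) w ∈ deg A g (p + i + n))
      ?_ ?_ ?_ hw
    · rintro q j b y hb hy rfl
      rw [bracket_tmul a y hx hb, Units.smul_def]
      exact zsmul_mem (tmul_mem' (A.mul_mem ha hb) (g.bracket_mem hx hy) (by ring)) _
    · intro z w h1 h2
      rw [map_add]; exact add_mem h1 h2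
    · intro t z h1
      rw [map_smul]; exact Submodule.smul_mem _ _ h1
  · intro z w h1 h2
    rw [map_add]; exact add_mem h1 h2
  · intro t z h1
    rw [map_smul]; exact Submodule.smul_mem _ _ h1

theorem sign_eq {m n : ℤ} (h : Even (m - n)) : m.negOnePow = n.negOnePow :=
  (Int.negOnePow_eq_iff m n).2 h

theorem bracket_skew {m n : ℤ} {z w : A.carrier ⊗[k] g.carrier} (hz : z ∈ deg A g m)
    (hw : w ∈ deg A g n) :
    bracket A g z w = -((m * n).negOnePow • bracket A g w z) := by
  refine deg_induction (P := fun z => bracket A g z w = -((m * n).negOnePow • bracket A g w z))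
    ?_ ?_ ?_ hz
  · rintro p i a x ha hx rfl
    refine deg_induction (P := fun w => bracket A g (a ⊗ₜ[k] x) w =
      -(((p + i) * n).negOnePow • bracket A g w (a ⊗ₜ[k] x))) ?_ ?_ ?_ hw
    · rintro q j b y hb hy rfl
      rw [bracket_tmul a y hx hb, bracket_tmul b x hy ha, A.graded_comm ha hb,
        g.bracket_skew hx hy, TensorProduct.tmul_neg, smul_tmul', tmul_smul', smul_neg,
        smul_smul, smul_smul, smul_smul, ← Int.negOnePow_add, ← Int.negOnePow_add,
        ← Int.negOnePow_add]
      congr 2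
      apply sign_eq
      ring_nf
      simp [parity_simps]
    · intro z w h1 h2
      rw [map_add, h1, h2, map_add, LinearMap.add_apply, smul_add, neg_add]
    · intro t z h1
      rw [map_smul, h1, map_smul, LinearMap.smul_apply, smul_neg, smul_comm]
  · intro z w h1 h2
    rw [map_add, LinearMap.add_apply, h1, h2, map_add, smul_add, neg_add]
  · intro t z h1
    rw [map_smul, LinearMap.smul_apply, h1, map_smul, smul_neg, smul_comm]

theorem jacobi {m n : ℤ} {z w : A.carrier ⊗[k] g.carrier} (v : A.carrier ⊗[k] g.carrier)
    (hz : z ∈ deg A g m) (hw : w ∈ deg A g n) :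
    bracket A g z (bracket A g w v) = bracket A g (bracket A g z w) v +
      (m * n).negOnePow • bracket A g w (bracket A g z v) := by
  refine deg_induction (P := fun z => bracket A g z (bracket A g w v) =
    bracket A g (bracket A g z w) v + (m * n).negOnePow • bracket A g w (bracket A g z v))
    ?_ ?_ ?_ hz
  · rintro p i a x ha hx rfl
    refine deg_induction (P := fun w => bracket A g (a ⊗ₜ[k] x) (bracket A g w v) =
      bracket A g (bracket A g (a ⊗ₜ[k] x) w) v +
      ((p + i) * n).negOnePow • bracket A g w (bracket A g (a ⊗ₜ[k] x) v)) ?_ ?_ ?_ hw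
    · rintro q j b y hb hy rfl
      refine induction (P := fun v => bracket A g (a ⊗ₜ[k] x) (bracket A g (b ⊗ₜ[k] y) v) =
        bracket A g (bracket A g (a ⊗ₜ[k] x) (b ⊗ₜ[k] y)) v + ((p + i) * (q + j)).negOnePow •
          bracket A g (b ⊗ₜ[k] y) (bracket A g (a ⊗ₜ[k] x) v)) ?_ ?_ v
      · intro r l c u hc hu
        rw [bracket_tmul b u hy hc, bracket_tmul a y hx hb, bracket_tmul a u hx hc,
          map_units_smul, map_units_smul, bracket_units_smul,
          bracket_tmul a _ hx (A.mul_mem hb hc), bracket_tmul b _ hy (A.mul_mem ha hc),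
          bracket_tmul (a * b) u (g.bracket_mem hx hy) hc, g.jacobi u hx hy,
          TensorProduct.tmul_add, tmul_smul', ← mul_assoc b a c, A.graded_comm hb ha,
          smul_mul_assoc, smul_tmul', mul_assoc a b c]
        simp only [smul_add, smul_smul, ← Int.negOnePow_add]
        congr 2
        · apply sign_eq
          ring_nf
          simp [parity_simps]
        · apply sign_eq
          ring_nf
          simp [parity_simps]
      · intro z w h1 h2
        simp only [map_add, h1, h2, smul_add]
        abel
    · intro z w h1 h2
      simp only [map_add, LinearMap.add_apply, h1, h2, smul_add]
      abel
    · intro t z h1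
      simp only [map_smul, LinearMap.smul_apply, h1, smul_add, smul_comm t]
  · intro z w h1 h2
    simp only [map_add, LinearMap.add_apply, h1, h2, smul_add]
    abel
  · intro t z h1
    simp only [map_smul, LinearMap.smul_apply, h1, smul_add, smul_comm t]

theorem d_bracket {m : ℤ} {z : A.carrier ⊗[k] g.carrier} (w : A.carrier ⊗[k] g.carrier)
    (hz : z ∈ deg A g m) :
    d A g (bracket A g z w) = bracket A g (d A g z) w + m.negOnePow • bracket A g z (d A g w) := by
  refine deg_induction (P := fun z => d A g (bracket A g z w) =
    bracket A g (d A g z) w + m.negOnePow • bracket A g z (d A g w)) ?_ ?_ ?_ hz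
  · rintro p i a x ha hx rfl
    refine induction (P := fun w => d A g (bracket A g (a ⊗ₜ[k] x) w) =
      bracket A g (d A g (a ⊗ₜ[k] x)) w +
        (p + i).negOnePow • bracket A g (a ⊗ₜ[k] x) (d A g w)) ?_ ?_ w
    · intro q j b y hb hy
      rw [bracket_tmul a y hx hb, map_units_smul, d_tmul _ (A.mul_mem ha hb), d_tmul x ha,
        d_tmul y hb, map_add, map_add, LinearMap.add_apply, map_units_smul, bracket_units_smul,
        bracket_tmul _ y hx hb, bracket_tmul a y (g.d_mem hx) hb,
        bracket_tmul a y hx (A.d_mem hb), bracket_tmul a _ hx hb, A.d_mul b ha,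
        g.d_bracket y hx, TensorProduct.add_tmul, TensorProduct.tmul_add, smul_tmul', tmul_smul']
      have e1 : (i * q).negOnePow * p.negOnePow =
          (p + i).negOnePow * (i * (q + 1)).negOnePow := by
        simp only [← Int.negOnePow_add]
        apply sign_eq
        ring_nf
        simp [parity_simps]
      have e2 : (i * q).negOnePow * (p + q).negOnePow =
          p.negOnePow * ((i + 1) * q).negOnePow := by
        simp only [← Int.negOnePow_add]
        apply sign_eq
        ring_nf
        simp [parity_simps]
      have e3 : (i * q).negOnePow * ((p + q).negOnePow * i.negOnePow) =
          (p + i).negOnePow * (q.negOnePow * (i * q).negOnePow) := by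
        simp only [← Int.negOnePow_add]
        apply sign_eq
        ring_nf
        simp [parity_simps]
      simp only [smul_add, smul_smul, e1, e2, e3]
      abel
    · intro z w h1 h2
      simp only [map_add, h1, h2, smul_add]
      abel
  · intro z w h1 h2
    simp only [map_add, LinearMap.add_apply, h1, h2, smul_add]
    abel
  · intro t z h1
    simp only [map_smul, LinearMap.smul_apply, h1, smul_add, smul_comm t]

end TensorDGLie

namespace DGLieAlgebra

variable {k : Type u} [Field k]

/-- The dg Lie algebra `A ⊗ g`. -/
def tensor (A : CommDGAlgebra k) (g : DGLieAlgebra k) : DGLieAlgebra k where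
  carrier := A.carrier ⊗[k] g.carrier
  deg := TensorDGLie.deg A g
  isInternal := TensorDGLie.isInternal
  d := TensorDGLie.d A g
  d_mem := TensorDGLie.d_mem
  d_d := TensorDGLie.d_d
  bracket := TensorDGLie.bracket A g
  bracket_mem := TensorDGLie.bracket_mem
  bracket_skew := TensorDGLie.bracket_skew
  jacobi := TensorDGLie.jacobi
  d_bracket := TensorDGLie.d_bracket

/-- The morphism `f ⊗ φ : A ⊗ g ⟶ B ⊗ h`. -/
def tensorMap {A B : CommDGAlgebra k} {g h : DGLieAlgebra k} (f : A ⟶ B) (φ : g ⟶ h) :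
    tensor A g ⟶ tensor B h where
  toLinearMap := TensorProduct.map f.toAlgHom.toLinearMap φ.toLinearMap
  map_mem {m z} hz := by
    refine TensorDGLie.deg_induction (P := fun z => TensorProduct.map f.toAlgHom.toLinearMap
      φ.toLinearMap z ∈ TensorDGLie.deg B h m) ?_ ?_ ?_ hz
    · rintro p i a x ha hx rfl
      exact TensorDGLie.tmul_mem (f.map_mem ha) (φ.map_mem hx)
    · intro z w h1 h2
      rw [map_add]; exact add_mem h1 h2
    · intro t z h1
      rw [map_smul]; exact Submodule.smul_mem _ _ h1
  map_d z := by
    refine TensorDGLie.induction (P := fun z => TensorProduct.map f.toAlgHom.toLinearMap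
      φ.toLinearMap (TensorDGLie.d A g z) = TensorDGLie.d B h
        (TensorProduct.map f.toAlgHom.toLinearMap φ.toLinearMap z)) ?_ ?_ z
    · intro p i a x ha hx
      rw [TensorDGLie.d_tmul x ha, TensorProduct.map_tmul, map_add, TensorDGLie.map_units_smul,
        TensorProduct.map_tmul, TensorProduct.map_tmul, AlgHom.toLinearMap_apply,
        AlgHom.toLinearMap_apply, TensorDGLie.d_tmul _ (f.map_mem ha), f.map_d, φ.map_d]
    · intro z w h1 h2
      simp only [map_add, h1, h2]
  map_bracket := fun (z w : A.carrier ⊗[k] g.carrier) => by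
    refine TensorDGLie.induction (P := fun z => TensorProduct.map f.toAlgHom.toLinearMap
      φ.toLinearMap (TensorDGLie.bracket A g z w) = TensorDGLie.bracket B h
        (TensorProduct.map f.toAlgHom.toLinearMap φ.toLinearMap z)
        (TensorProduct.map f.toAlgHom.toLinearMap φ.toLinearMap w)) ?_ ?_ z
    · intro p i a x ha hx
      refine TensorDGLie.induction (P := fun w => TensorProduct.map f.toAlgHom.toLinearMap
        φ.toLinearMap (TensorDGLie.bracket A g (a ⊗ₜ[k] x) w) = TensorDGLie.bracket B h
          (TensorProduct.map f.toAlgHom.toLinearMap φ.toLinearMap (a ⊗ₜ[k] x))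
          (TensorProduct.map f.toAlgHom.toLinearMap φ.toLinearMap w)) ?_ ?_ w
      · intro q j b y hb hy
        rw [TensorDGLie.bracket_tmul a y hx hb, TensorDGLie.map_units_smul,
          TensorProduct.map_tmul, TensorProduct.map_tmul, TensorProduct.map_tmul,
          AlgHom.toLinearMap_apply, AlgHom.toLinearMap_apply, AlgHom.toLinearMap_apply,
          TensorDGLie.bracket_tmul _ _ (φ.map_mem hx) (f.map_mem hb), map_mul, φ.map_bracket]
      · intro z w h1 h2
        simp only [map_add, h1, h2]
    · intro z w h1 h2
      simp only [map_add, LinearMap.add_apply, h1, h2]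

theorem tensorMap_id (A : CommDGAlgebra k) (g : DGLieAlgebra k) :
    tensorMap (𝟙 A) (𝟙 g) = 𝟙 (tensor A g) :=
  hom_ext TensorProduct.map_id

theorem tensorMap_comp {A B C : CommDGAlgebra k} {g h l : DGLieAlgebra k}
    (f : A ⟶ B) (f' : B ⟶ C) (φ : g ⟶ h) (φ' : h ⟶ l) :
    tensorMap (f ≫ f') (φ ≫ φ') = tensorMap f φ ≫ tensorMap f' φ' :=
  hom_ext (TensorProduct.map_comp f'.toAlgHom.toLinearMap φ'.toLinearMap
    f.toAlgHom.toLinearMap φ.toLinearMap)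

/-- The morphism `g ⟶ A ⊗ g`, `x ↦ 1 ⊗ x`. -/
def const (A : CommDGAlgebra k) (g : DGLieAlgebra k) : g ⟶ tensor A g where
  toLinearMap := TensorProduct.mk k A.carrier g.carrier 1
  map_mem {i x} hx := TensorDGLie.tmul_mem' A.one_mem hx (zero_add i)
  map_d x := by
    have h : A.d 1 = 0 := by simpa using A.d_mul 1 A.one_mem
    exact ((TensorDGLie.d_tmul x A.one_mem).trans (by simp [h]; rfl)).symm
  map_bracket x y := by
    refine graded_induction g.isInternal (p := fun x => (1 : A.carrier) ⊗ₜ[k] g.bracket x y =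
      TensorDGLie.bracket A g (1 ⊗ₜ[k] x) (1 ⊗ₜ[k] y)) ?_ ?_ x
    · intro i x hx
      rw [TensorDGLie.bracket_tmul 1 y hx A.one_mem]
      simp
    · intro x x' h1 h2
      rw [map_add, LinearMap.add_apply, TensorProduct.tmul_add, TensorProduct.tmul_add, map_add,
        LinearMap.add_apply, h1, h2]

theorem const_tensorMap {A B : CommDGAlgebra k} {g h : DGLieAlgebra k} (f : A ⟶ B) (φ : g ⟶ h) :
    const A g ≫ tensorMap f φ = φ ≫ const B h := by
  ext x
  change f.toAlgHom 1 ⊗ₜ[k] φ.toLinearMap x = 1 ⊗ₜ[k] φ.toLinearMap x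
  rw [map_one]

theorem lcs_tensor (A : CommDGAlgebra k) (g : DGLieAlgebra k) (n : ℕ) :
    (tensor A g).lcs n ≤ Submodule.map₂ (TensorProduct.mk k A.carrier g.carrier) ⊤ (g.lcs n) := by
  induction n with
  | zero =>
    intro z _
    rw [lcs, TensorProduct.map₂_mk_top_top_eq_top]
    trivial
  | succ n ih =>
    refine Submodule.map₂_le.2 fun (z : A.carrier ⊗[k] g.carrier) _
      (w : A.carrier ⊗[k] g.carrier) hw => ?_
    refine TensorDGLie.induction (P := fun z => TensorDGLie.bracket A g z w ∈
      Submodule.map₂ (TensorProduct.mk k A.carrier g.carrier) ⊤ (g.lcs (n + 1))) ?_ ?_ z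
    · intro p i a x ha hx
      have : Submodule.map₂ (TensorProduct.mk k A.carrier g.carrier) ⊤ (g.lcs n) ≤
          (Submodule.map₂ (TensorProduct.mk k A.carrier g.carrier) ⊤ (g.lcs (n + 1))).comap
            (TensorDGLie.bracket A g (a ⊗ₜ[k] x)) := by
        refine Submodule.map₂_le.2 fun b _ y hy => ?_
        refine graded_induction A.isInternal (p := fun b => TensorDGLie.bracket A g (a ⊗ₜ[k] x)
          (b ⊗ₜ[k] y) ∈ Submodule.map₂ (TensorProduct.mk k A.carrier g.carrier) ⊤
            (g.lcs (n + 1))) ?_ ?_ b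
        · intro q b hb
          rw [TensorDGLie.bracket_tmul a y hx hb, Units.smul_def]
          exact zsmul_mem (Submodule.apply_mem_map₂ _ Submodule.mem_top
            (Submodule.apply_mem_map₂ _ Submodule.mem_top hy)) _
        · intro b b' h1 h2
          rw [TensorProduct.add_tmul, map_add]
          exact add_mem h1 h2
      exact this (ih hw)
    · intro z z' h1 h2
      rw [map_add, LinearMap.add_apply]
      exact add_mem h1 h2

theorem IsNilpotent.tensor {g : DGLieAlgebra k} (h : g.IsNilpotent) (A : CommDGAlgebra k) :
    (tensor A g).IsNilpotent := by
  obtain ⟨n, hn⟩ := h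
  refine ⟨n, eq_bot_iff.2 ((lcs_tensor A g n).trans ?_)⟩
  rw [hn, Submodule.map₂_bot_right]
  exact le_rfl

end DGLieAlgebra

/-! ### Polynomial differential forms on the standard simplices -/

namespace PolyForms

variable (k : Type u) [Field k]

/-- Generators: `Sum.inl i` is the coordinate `t i`, `Sum.inr i` is `dt i`. -/
abbrev Gen (n : ℕ) : Type := Fin (n + 1) ⊕ Fin (n + 1)

/-- The relations: graded commutativity, `∑ t i = 1` and `∑ dt i = 0`. -/
inductive Rel (n : ℕ) : FreeAlgebra k (Gen n) → FreeAlgebra k (Gen n) → Prop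
  | t_t (i j : Fin (n + 1)) : Rel n
      (FreeAlgebra.ι k (.inl i) * FreeAlgebra.ι k (.inl j))
      (FreeAlgebra.ι k (.inl j) * FreeAlgebra.ι k (.inl i))
  | t_dt (i j : Fin (n + 1)) : Rel n
      (FreeAlgebra.ι k (.inl i) * FreeAlgebra.ι k (.inr j))
      (FreeAlgebra.ι k (.inr j) * FreeAlgebra.ι k (.inl i))
  | dt_dt (i j : Fin (n + 1)) : Rel n
      (FreeAlgebra.ι k (.inr i) * FreeAlgebra.ι k (.inr j))
      (-(FreeAlgebra.ι k (.inr j) * FreeAlgebra.ι k (.inr i)))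
  | sum_t : Rel n (∑ i, FreeAlgebra.ι k (.inl i)) 1
  | sum_dt : Rel n (∑ i, FreeAlgebra.ι k (.inr i)) 0

/-- The algebra `k[t₀, …, tₙ, dt₀, …, dtₙ] / (∑ tᵢ - 1, ∑ dtᵢ)`. -/
def Alg (n : ℕ) : Type u := RingQuot (Rel k n)

instance (n : ℕ) : Ring (Alg k n) := inferInstanceAs (Ring (RingQuot (Rel k n)))
instance (n : ℕ) : Algebra k (Alg k n) := inferInstanceAs (Algebra k (RingQuot (Rel k n)))

variable {k}

/-- The class of a generator. -/
def gen {n : ℕ} (x : Gen n) : Alg k n := RingQuot.mkAlgHom k (Rel k n) (FreeAlgebra.ι k x)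

/-- The coordinate function `t i`. -/
def t {n : ℕ} (i : Fin (n + 1)) : Alg k n := gen (.inl i)

/-- Its differential `dt i`. -/
def dt {n : ℕ} (i : Fin (n + 1)) : Alg k n := gen (.inr i)

theorem t_mul_t {n : ℕ} (i j : Fin (n + 1)) : (t i * t j : Alg k n) = t j * t i := by
  have := RingQuot.mkAlgHom_rel k (Rel.t_t (k := k) i j)
  rwa [map_mul, map_mul] at this

theorem t_mul_dt {n : ℕ} (i j : Fin (n + 1)) : (t i * dt j : Alg k n) = dt j * t i := by
  have := RingQuot.mkAlgHom_rel k (Rel.t_dt (k := k) i j)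
  rwa [map_mul, map_mul] at this

theorem dt_mul_dt {n : ℕ} (i j : Fin (n + 1)) : (dt i * dt j : Alg k n) = -(dt j * dt i) := by
  have := RingQuot.mkAlgHom_rel k (Rel.dt_dt (k := k) i j)
  rwa [map_neg, map_mul, map_mul] at this

theorem sum_t (n : ℕ) : ∑ i, (t i : Alg k n) = 1 := by
  have := RingQuot.mkAlgHom_rel k (Rel.sum_t (k := k) (n := n))
  rwa [map_one, map_sum] at this

theorem sum_dt (n : ℕ) : ∑ i, (dt i : Alg k n) = 0 := by
  have := RingQuot.mkAlgHom_rel k (Rel.sum_dt (k := k) (n := n))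
  rwa [map_zero, map_sum] at this

/-- The universal property of `Alg k n`. -/
def lift {n : ℕ} {B : Type*} [Ring B] [Algebra k B] (f : Fin (n + 1) → B) (df : Fin (n + 1) → B)
    (h1 : ∀ i j, f i * f j = f j * f i) (h2 : ∀ i j, f i * df j = df j * f i)
    (h3 : ∀ i j, df i * df j = -(df j * df i)) (h4 : ∑ i, f i = 1) (h5 : ∑ i, df i = 0) :
    Alg k n →ₐ[k] B :=
  RingQuot.liftAlgHom k ⟨FreeAlgebra.lift k (Sum.elim f df), by
    rintro _ _ (⟨i, j⟩ | ⟨i, j⟩ | ⟨i, j⟩ | _ | _) <;> simp [h1, h2, h4, h5]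
    exact h3 i j⟩

section lift

variable {n : ℕ} {B : Type*} [Ring B] [Algebra k B] (f : Fin (n + 1) → B) (df : Fin (n + 1) → B)
    (h1 : ∀ i j, f i * f j = f j * f i) (h2 : ∀ i j, f i * df j = df j * f i)
    (h3 : ∀ i j, df i * df j = -(df j * df i)) (h4 : ∑ i, f i = 1) (h5 : ∑ i, df i = 0)

@[simp]
theorem lift_t (i : Fin (n + 1)) : lift (k := k) f df h1 h2 h3 h4 h5 (t i) = f i :=
  (RingQuot.liftAlgHom_mkAlgHom_apply ..).trans (by simp)

@[simp]
theorem lift_dt (i : Fin (n + 1)) : lift (k := k) f df h1 h2 h3 h4 h5 (dt i) = df i :=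
  (RingQuot.liftAlgHom_mkAlgHom_apply ..).trans (by simp)

end lift

theorem algHom_ext {n : ℕ} {B : Type*} [Ring B] [Algebra k B] {φ ψ : Alg k n →ₐ[k] B}
    (h : ∀ i, φ (t i) = ψ (t i)) (h' : ∀ i, φ (dt i) = ψ (dt i)) : φ = ψ := by
  refine RingQuot.ringQuot_ext' k φ ψ (FreeAlgebra.hom_ext (funext fun x => ?_))
  rcases x with i | i
  · exact h i
  · exact h' i

/-- The parity automorphism: `t i ↦ t i`, `dt i ↦ - dt i`. -/
def parity (n : ℕ) : Alg k n →ₐ[k] Alg k n :=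
  lift t (fun i => -dt i) t_mul_t (by simp [t_mul_dt])
    (fun i j => by simpa using dt_mul_dt i j) (sum_t n) (by simp [sum_dt])

/-- The algebra map `ω ↦ !![parity ω, dω; 0, ω]`, whose multiplicativity is the graded Leibniz
rule for `d`. -/
def dMatrix (n : ℕ) : Alg k n →ₐ[k] Matrix (Fin 2) (Fin 2) (Alg k n) :=
  lift (fun i => !![t i, dt i; 0, t i]) (fun i => !![-dt i, 0; 0, dt i])
    (fun i j => by
      simp [t_mul_t i j, t_mul_dt, add_comm])
    (fun i j => by
      simp [t_mul_dt, dt_mul_dt i j])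
    (fun i j => by
      ext a b
      fin_cases a <;> fin_cases b <;> simp [dt_mul_dt i j])
    (by
      ext a b
      fin_cases a <;> fin_cases b <;> simp [Matrix.sum_apply, sum_t, sum_dt])
    (by
      ext a b
      fin_cases a <;> fin_cases b <;> simp [Matrix.sum_apply, sum_dt])

/-- The de Rham differential. -/
def d (n : ℕ) : Alg k n →ₗ[k] Alg k n :=
  (Matrix.entryLinearMap k (Alg k n) 0 1).comp (dMatrix n).toLinearMap

theorem alg_induction {n : ℕ} {P : Alg k n → Prop} (hk : ∀ c : k, P (algebraMap k _ c))
    (ht : ∀ i, P (t i)) (hdt : ∀ i, P (dt i)) (hmul : ∀ x y, P x → P y → P (x * y))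
    (hadd : ∀ x y, P x → P y → P (x + y)) (ω : Alg k n) : P ω := by
  obtain ⟨x, rfl⟩ := RingQuot.mkAlgHom_surjective k (Rel k n) ω
  induction x using FreeAlgebra.induction with
  | grade0 c => rw [AlgHom.commutes]; exact hk c
  | grade1 x =>
    rcases x with i | i
    · exact ht i
    · exact hdt i
  | mul x y hx hy => rw [map_mul]; exact hmul _ _ hx hy
  | add x y hx hy => rw [map_add]; exact hadd _ _ hx hy

theorem dMatrix_eq {n : ℕ} (ω : Alg k n) :
    dMatrix n ω = !![parity n ω, d n ω; 0, ω] := by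
  have key : dMatrix n ω 0 0 = parity n ω ∧ dMatrix n ω 1 0 = 0 ∧ dMatrix n ω 1 1 = ω := by
    refine alg_induction (P := fun ω => dMatrix n ω 0 0 = parity n ω ∧ dMatrix n ω 1 0 = 0 ∧
      dMatrix n ω 1 1 = ω) ?_ ?_ ?_ ?_ ?_ ω
    · intro c
      rw [AlgHom.commutes, AlgHom.commutes]
      simp [Matrix.algebraMap_matrix_apply]
    · intro i; simp [dMatrix, parity]
    · intro i; simp [dMatrix, parity]
    · rintro x y ⟨h1, h2, h3⟩ ⟨h4, h5, h6⟩
      rw [map_mul, map_mul]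
      simp [Matrix.mul_apply, Fin.sum_univ_two, h1, h2, h3, h4, h5, h6]
    · rintro x y ⟨h1, h2, h3⟩ ⟨h4, h5, h6⟩
      rw [map_add, map_add]
      simp [h1, h2, h3, h4, h5, h6]
  ext a b
  fin_cases a <;> fin_cases b
  · exact key.1
  · rfl
  · exact key.2.1
  · exact key.2.2

theorem d_mul_parity {n : ℕ} (x y : Alg k n) : d n (x * y) = d n x * y + parity n x * d n y := by
  have h : d n (x * y) = dMatrix n (x * y) 0 1 := rfl
  rw [h, map_mul, dMatrix_eq, dMatrix_eq]
  simp [Matrix.mul_apply, Fin.sum_univ_two, add_comm]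

@[simp]
theorem d_t {n : ℕ} (i : Fin (n + 1)) : d n (t i : Alg k n) = dt i := by
  simp [d, dMatrix]

@[simp]
theorem d_dt {n : ℕ} (i : Fin (n + 1)) : d n (dt i : Alg k n) = 0 := by
  simp [d, dMatrix]

@[simp]
theorem parity_t {n : ℕ} (i : Fin (n + 1)) : parity n (t i : Alg k n) = t i := by
  simp [parity]

@[simp]
theorem parity_dt {n : ℕ} (i : Fin (n + 1)) : parity n (dt i : Alg k n) = -dt i := by
  simp [parity]

@[simp]
theorem d_one (n : ℕ) : d n (1 : Alg k n) = 0 := by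
  have := d_mul_parity (1 : Alg k n) 1
  simpa using this

/-- The degree of a generator. -/
def wt {n : ℕ} : Gen n → ℤ := Sum.elim (fun _ => 0) (fun _ => 1)

/-- The `m`-forms: spanned by the words in the `t i`, `dt i` with exactly `m` factors `dt i`. -/
def deg (k : Type u) [Field k] (n : ℕ) (m : ℤ) : Submodule k (Alg k n) :=
  Submodule.span k {ω | ∃ l : List (Gen n), (l.map wt).sum = m ∧ ω = (l.map gen).prod}

theorem word_mem {n : ℕ} {m : ℤ} (l : List (Gen n)) (h : (l.map wt).sum = m) :
    ((l.map gen).prod : Alg k n) ∈ deg k n m := Submodule.subset_span ⟨l, h, rfl⟩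

theorem deg_induction {n : ℕ} {m : ℤ} {P : Alg k n → Prop}
    (h : ∀ l : List (Gen n), (l.map wt).sum = m → P (l.map gen).prod) (h0 : P 0)
    (hadd : ∀ x y, P x → P y → P (x + y)) (hsmul : ∀ (c : k) x, P x → P (c • x))
    {ω : Alg k n} (hω : ω ∈ deg k n m) : P ω := by
  refine Submodule.span_induction (p := fun z _ => P z) ?_ h0 (fun z w _ _ => hadd z w)
    (fun c z _ => hsmul c z) hω
  rintro _ ⟨l, hl, rfl⟩
  exact h l hl

theorem t_mem {n : ℕ} (i : Fin (n + 1)) : (t i : Alg k n) ∈ deg k n 0 := by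
  simpa [t] using word_mem (k := k) (m := 0) [Sum.inl i] (by simp [wt])

theorem dt_mem {n : ℕ} (i : Fin (n + 1)) : (dt i : Alg k n) ∈ deg k n 1 := by
  simpa [dt] using word_mem (k := k) (m := 1) [Sum.inr i] (by simp [wt])

theorem one_mem (n : ℕ) : (1 : Alg k n) ∈ deg k n 0 := by
  simpa using word_mem (k := k) (n := n) (m := 0) [] (by simp)

theorem mul_mem {n : ℕ} {p q : ℤ} {x y : Alg k n} (hx : x ∈ deg k n p) (hy : y ∈ deg k n q) :
    x * y ∈ deg k n (p + q) := by
  refine deg_induction (P := fun x => x * y ∈ deg k n (p + q)) ?_ (by simp) ?_ ?_ hx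
  · intro l hl
    refine deg_induction (P := fun y => (l.map gen).prod * y ∈ deg k n (p + q)) ?_ (by simp)
      ?_ ?_ hy
    · intro l' hl'
      rw [← List.prod_append, ← List.map_append]
      exact word_mem _ (by rw [List.map_append, List.sum_append, hl, hl'])
    · intro z w h1 h2
      rw [mul_add]; exact add_mem h1 h2
    · intro c z h1
      rw [mul_smul_comm]; exact Submodule.smul_mem _ _ h1
  · intro z w h1 h2
    rw [add_mul]; exact add_mem h1 h2
  · intro c z h1
    rw [smul_mul_assoc]; exact Submodule.smul_mem _ _ h1

theorem iSup_deg (n : ℕ) : iSup (deg k n) = ⊤ := by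
  rw [eq_top_iff]
  intro ω _
  have hle : ∀ m, deg k n m ≤ iSup (deg k n) := le_iSup (deg k n)
  refine alg_induction (P := fun ω => ω ∈ iSup (deg k n)) ?_ ?_ ?_ ?_ ?_ ω
  · intro c
    rw [Algebra.algebraMap_eq_smul_one]
    exact Submodule.smul_mem _ _ (hle 0 (one_mem n))
  · exact fun i => hle 0 (t_mem i)
  · exact fun i => hle 1 (dt_mem i)
  · intro x y hx hy
    refine Submodule.iSup_induction _ (motive := fun x => x * y ∈ iSup (deg k n)) hx ?_ (by simp) ?_
    · intro p x hx
      refine Submodule.iSup_induction _ (motive := fun y => x * y ∈ iSup (deg k n)) hy ?_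
        (by simp) ?_
      · exact fun q y hy => hle (p + q) (mul_mem hx hy)
      · intro z w h1 h2
        rw [mul_add]; exact add_mem h1 h2
    · intro z w h1 h2
      rw [add_mul]; exact add_mem h1 h2
  · exact fun x y => add_mem

/-- The coaction `t i ↦ t i`, `dt i ↦ dt i * T` recording the degree. -/
def coact (n : ℕ) : Alg k n →ₐ[k] AddMonoidAlgebra (Alg k n) ℤ :=
  lift (fun i => .single 0 (t i)) (fun i => .single 1 (dt i))
    (fun i j => by
      rw [AddMonoidAlgebra.single_mul_single, AddMonoidAlgebra.single_mul_single, t_mul_t i j])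
    (fun i j => by
      rw [AddMonoidAlgebra.single_mul_single, AddMonoidAlgebra.single_mul_single, t_mul_dt i j,
        add_comm])
    (fun i j => by
      rw [AddMonoidAlgebra.single_mul_single, AddMonoidAlgebra.single_mul_single, dt_mul_dt i j,
        AddMonoidAlgebra.single_neg])
    (by
      have := map_sum (AddMonoidAlgebra.singleAddHom (R := Alg k n) (0 : ℤ)) t Finset.univ
      rw [sum_t] at this
      exact this.symm)
    (by
      have := map_sum (AddMonoidAlgebra.singleAddHom (R := Alg k n) (1 : ℤ)) dt Finset.univ
      rw [sum_dt, map_zero] at this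
      exact this.symm)

theorem coact_word {n : ℕ} (l : List (Gen n)) :
    coact n ((l.map gen).prod : Alg k n) = .single (l.map wt).sum (l.map gen).prod := by
  induction l with
  | nil => simp
  | cons x l ih =>
    have hx : coact n (gen x : Alg k n) = .single (wt x) (gen x) := by
      rcases x with i | i
      · exact lift_t ..
      · exact lift_dt ..
    simp only [List.map_cons, List.prod_cons, List.sum_cons, map_mul, ih, hx,
      AddMonoidAlgebra.single_mul_single]

theorem isInternal (n : ℕ) : DirectSum.IsInternal (deg k n) := by
  let c : Alg k n →ₗ[k] (ℤ →₀ Alg k n) :=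
    { toFun := fun ω => (coact n ω).coeff
      map_add' := fun x y => by simp
      map_smul' := fun r x => by simp }
  refine isInternal_of_weights c (fun m z hz => ?_) (iSup_deg n)
  refine deg_induction (P := fun z => c z = Finsupp.single m z) ?_ (by simp) ?_ ?_ hz
  · rintro l rfl
    change (coact n _).coeff = _
    rw [coact_word]
    rfl
  · intro z w h1 h2
    rw [map_add, h1, h2, Finsupp.single_add]
  · intro t z h1
    rw [map_smul, h1, Finsupp.smul_single]

theorem parity_word {n : ℕ} (l : List (Gen n)) :
    parity n ((l.map gen).prod : Alg k n) = (l.map wt).sum.negOnePow • (l.map gen).prod := by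
  induction l with
  | nil => simp
  | cons x l ih =>
    simp only [List.map_cons, List.prod_cons, List.sum_cons, map_mul, ih]
    rcases x with i | i
    · change parity n (t i) * _ = (0 + _ : ℤ).negOnePow • (t i * _)
      rw [parity_t, zero_add, mul_smul_comm]
    · change parity n (dt i) * _ = (1 + _ : ℤ).negOnePow • (dt i * _)
      rw [parity_dt, mul_smul_comm, add_comm, Int.negOnePow_succ]
      simp

theorem parity_of_mem {n : ℕ} {m : ℤ} {ω : Alg k n} (hω : ω ∈ deg k n m) :
    parity n ω = m.negOnePow • ω := by
  refine deg_induction (P := fun ω => parity n ω = m.negOnePow • ω) ?_ (by simp) ?_ ?_ hω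
  · rintro l rfl
    exact parity_word l
  · intro z w h1 h2
    rw [map_add, h1, h2, smul_add]
  · intro c z h1
    rw [map_smul, h1, smul_comm]

theorem t_comm {n : ℕ} (i : Fin (n + 1)) (ω : Alg k n) : t i * ω = ω * t i := by
  refine alg_induction (P := fun ω => t i * ω = ω * t i) ?_ (t_mul_t i) (t_mul_dt i) ?_ ?_ ω
  · exact fun c => (Algebra.commutes c _).symm
  · intro x y h1 h2
    rw [← mul_assoc, h1, mul_assoc, h2, mul_assoc]
  · intro x y h1 h2
    rw [mul_add, add_mul, h1, h2]

theorem dt_comm {n : ℕ} (i : Fin (n + 1)) (ω : Alg k n) : dt i * ω = parity n ω * dt i := by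
  refine alg_induction (P := fun ω => dt i * ω = parity n ω * dt i) ?_ ?_ ?_ ?_ ?_ ω
  · intro c
    rw [AlgHom.commutes]
    exact (Algebra.commutes c _).symm
  · intro j
    rw [parity_t, t_mul_dt]
  · intro j
    rw [parity_dt, dt_mul_dt, neg_mul]
  · intro x y h1 h2
    rw [← mul_assoc, h1, mul_assoc, h2, map_mul, mul_assoc]
  · intro x y h1 h2
    rw [map_add, mul_add, add_mul, h1, h2]

theorem graded_comm {n : ℕ} {p q : ℤ} {x y : Alg k n} (hx : x ∈ deg k n p) (hy : y ∈ deg k n q) :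
    x * y = (p * q).negOnePow • (y * x) := by
  refine deg_induction (P := fun x => x * y = (p * q).negOnePow • (y * x)) ?_ (by simp) ?_ ?_ hx
  · rintro l rfl
    clear hx
    induction l with
    | nil => simp
    | cons g l ih =>
      simp only [List.map_cons, List.prod_cons, List.sum_cons]
      rw [mul_assoc, ih, mul_smul_comm, ← mul_assoc]
      rcases g with i | i
      · change _ • (t i * y * _) = ((0 + _) * q).negOnePow • (y * (t i * _))
        rw [t_comm, zero_add, mul_assoc]
      · change _ • (dt i * y * _) = ((1 + _) * q).negOnePow • (y * (dt i * _))
        rw [dt_comm, parity_of_mem hy, smul_mul_assoc, smul_mul_assoc, smul_smul, mul_assoc,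
          ← Int.negOnePow_add]
        congr 2
        ring
  · intro z w h1 h2
    rw [add_mul, mul_add, h1, h2, smul_add]
  · intro c z h1
    rw [smul_mul_assoc, h1, mul_smul_comm, smul_comm]

theorem d_mul {n : ℕ} {p : ℤ} {x : Alg k n} (y : Alg k n) (hx : x ∈ deg k n p) :
    d n (x * y) = d n x * y + p.negOnePow • (x * d n y) := by
  rw [d_mul_parity, parity_of_mem hx, smul_mul_assoc]

theorem d_d {n : ℕ} (ω : Alg k n) : d n (d n ω) = 0 := by
  have hpar : ∀ ω : Alg k n, parity n (d n ω) = -d n (parity n ω) := by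
    refine alg_induction ?_ ?_ ?_ ?_ ?_
    · intro c
      rw [AlgHom.commutes, Algebra.algebraMap_eq_smul_one, map_smul, d_one]
      simp
    · intro i; simp
    · intro i; simp
    · intro x y h1 h2
      have h3 : parity n (parity n x) = x := by
        have : (parity n).comp (parity n) = AlgHom.id k (Alg k n) :=
          algHom_ext (by simp) (by simp)
        exact DFunLike.congr_fun this x
      rw [d_mul_parity, map_add, map_mul, map_mul, map_mul, d_mul_parity, h1, h2, h3]
      noncomm_ring
    · intro x y h1 h2
      simp only [map_add, h1, h2, neg_add]
  refine alg_induction (P := fun ω => d n (d n ω) = 0) ?_ ?_ ?_ ?_ ?_ ω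
  · intro c
    rw [Algebra.algebraMap_eq_smul_one, map_smul, d_one]
    simp
  · intro i; simp
  · intro i; simp
  · intro x y h1 h2
    have h3 : parity n (parity n x) = x := by
      have : (parity n).comp (parity n) = AlgHom.id k (Alg k n) :=
        algHom_ext (by simp) (by simp)
      exact DFunLike.congr_fun this x
    rw [d_mul_parity, map_add, d_mul_parity, d_mul_parity, h1, h2, hpar, h3]
    noncomm_ring
  · intro x y h1 h2
    rw [map_add, map_add, h1, h2, add_zero]

theorem d_mem {n : ℕ} {m : ℤ} {ω : Alg k n} (hω : ω ∈ deg k n m) : d n ω ∈ deg k n (m + 1) := by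
  refine deg_induction (P := fun ω => d n ω ∈ deg k n (m + 1)) ?_ (by simp) ?_ ?_ hω
  · rintro l rfl
    clear hω
    induction l with
    | nil => simp
    | cons g l ih =>
      simp only [List.map_cons, List.prod_cons, List.sum_cons]
      rcases g with i | i
      · change d n (t i * _) ∈ deg k n (0 + _ + 1)
        rw [d_mul _ (t_mem i), d_t, Units.smul_def, add_assoc, zero_add]
        refine add_mem ?_ (zsmul_mem ?_ _)
        · rw [add_comm]
          exact mul_mem (dt_mem i) (word_mem l rfl)
        · rw [← zero_add (_ + _ : ℤ)]
          exact mul_mem (t_mem i) ih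
      · change d n (dt i * _) ∈ deg k n (1 + _ + 1)
        rw [d_mul _ (dt_mem i), d_dt, Units.smul_def, add_assoc, zero_mul, zero_add]
        exact zsmul_mem (mul_mem (dt_mem i) ih) _
  · intro z w h1 h2
    rw [map_add]; exact add_mem h1 h2
  · intro c z h1
    rw [map_smul]; exact Submodule.smul_mem _ _ h1

variable (k) in
/-- The commutative dg algebra `Ω_n` of polynomial differential forms on the `n`-simplex. -/
def cdga (n : ℕ) : CommDGAlgebra k where
  carrier := Alg k n
  deg := deg k n
  isInternal := isInternal n
  one_mem := one_mem n
  mul_mem := mul_mem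
  graded_comm := graded_comm
  d := d n
  d_mem := d_mem
  d_d := d_d
  d_mul := d_mul

/-- Pullback of forms along the affine map of simplices given on vertices by `φ`:
`t i ↦ ∑_{φ j = i} t j`, `dt i ↦ ∑_{φ j = i} dt j`. -/
def pullback {m n : ℕ} (φ : Fin (m + 1) → Fin (n + 1)) : Alg k n →ₐ[k] Alg k m :=
  lift (fun i => ∑ j with φ j = i, t j) (fun i => ∑ j with φ j = i, dt j)
    (fun i j => by
      rw [Finset.sum_mul_sum, Finset.sum_mul_sum, Finset.sum_comm]
      simp only [t_mul_t])
    (fun i j => by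
      rw [Finset.sum_mul_sum, Finset.sum_mul_sum, Finset.sum_comm]
      simp only [t_mul_dt])
    (fun i j => by
      rw [Finset.sum_mul_sum, Finset.sum_mul_sum, Finset.sum_comm, ← Finset.sum_neg_distrib]
      refine Finset.sum_congr rfl fun a _ => ?_
      rw [← Finset.sum_neg_distrib]
      exact Finset.sum_congr rfl fun b _ => dt_mul_dt b a)
    (by rw [Finset.sum_fiberwise, sum_t])
    (by rw [Finset.sum_fiberwise, sum_dt])

@[simp]
theorem pullback_t {m n : ℕ} (φ : Fin (m + 1) → Fin (n + 1)) (i : Fin (n + 1)) :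
    pullback (k := k) φ (t i) = ∑ j with φ j = i, t j := lift_t ..

@[simp]
theorem pullback_dt {m n : ℕ} (φ : Fin (m + 1) → Fin (n + 1)) (i : Fin (n + 1)) :
    pullback (k := k) φ (dt i) = ∑ j with φ j = i, dt j := lift_dt ..

theorem pullback_id (n : ℕ) : pullback (k := k) (id : Fin (n + 1) → Fin (n + 1)) = AlgHom.id k _ :=
  algHom_ext (fun i => by simp [Finset.filter_eq']) (fun i => by simp [Finset.filter_eq'])

theorem pullback_comp {l m n : ℕ} (ψ : Fin (l + 1) → Fin (m + 1)) (φ : Fin (m + 1) → Fin (n + 1)) :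
    pullback (k := k) (φ ∘ ψ) = (pullback ψ).comp (pullback φ) := by
  have key : ∀ (i : Fin (n + 1)) (f : Fin (l + 1) → Alg k l),
      ∑ j with (φ ∘ ψ) j = i, f j = ∑ j with φ j = i, ∑ a with ψ a = j, f a := by
    intro i f
    have e : ∀ a, (φ ∘ ψ) a = i ↔ φ (ψ a) = i := fun a => Iff.rfl
    simp only [Finset.sum_filter, e]
    have h : ∀ j, (if φ j = i then ∑ a, (if ψ a = j then f a else 0) else 0) =
        ∑ a, if ψ a = j then (if φ (ψ a) = i then f a else 0) else 0 := by
      intro j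
      split_ifs with hj
      · refine Finset.sum_congr rfl fun a _ => ?_
        split_ifs <;> simp_all
      · refine (Finset.sum_eq_zero fun a _ => ?_).symm
        split_ifs <;> simp_all
    simp only [h]
    rw [Finset.sum_comm]
    simp
  refine algHom_ext (fun i => ?_) (fun i => ?_)
  · rw [pullback_t, AlgHom.comp_apply, pullback_t, map_sum, key]
    exact Finset.sum_congr rfl fun j _ => (pullback_t ψ j).symm
  · rw [pullback_dt, AlgHom.comp_apply, pullback_dt, map_sum, key]
    exact Finset.sum_congr rfl fun j _ => (pullback_dt ψ j).symm

theorem pullback_d {m n : ℕ} (φ : Fin (m + 1) → Fin (n + 1)) (ω : Alg k n) :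
    pullback φ (d n ω) = d m (pullback φ ω) := by
  have hpar : (pullback (k := k) φ).comp (parity n) = (parity m).comp (pullback φ) :=
    algHom_ext (fun i => by simp) (fun i => by simp)
  refine alg_induction (P := fun ω => pullback φ (d n ω) = d m (pullback φ ω)) ?_ ?_ ?_ ?_ ?_ ω
  · intro c
    rw [AlgHom.commutes, Algebra.algebraMap_eq_smul_one, Algebra.algebraMap_eq_smul_one,
      map_smul (d m), map_smul (d n), d_one, d_one]
    simp
  · intro i; simp
  · intro i; simp
  · intro x y h1 h2
    rw [d_mul_parity, map_add, map_mul, map_mul, map_mul, d_mul_parity, h1, h2]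
    congr 2
    exact DFunLike.congr_fun hpar x
  · intro x y h1 h2
    simp only [map_add, h1, h2]

theorem pullback_mem {m n : ℕ} (φ : Fin (m + 1) → Fin (n + 1)) {p : ℤ} {ω : Alg k n}
    (hω : ω ∈ deg k n p) : pullback φ ω ∈ deg k m p := by
  refine deg_induction (P := fun ω => pullback φ ω ∈ deg k m p) ?_ (by simp) ?_ ?_ hω
  · rintro l rfl
    clear hω
    induction l with
    | nil => simpa using one_mem m
    | cons g l ih =>
      simp only [List.map_cons, List.prod_cons, List.sum_cons, map_mul]
      refine mul_mem ?_ ih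
      rcases g with i | i
      · change pullback φ (t i) ∈ deg k m 0
        rw [pullback_t]
        exact sum_mem fun j _ => t_mem j
      · change pullback φ (dt i) ∈ deg k m 1
        rw [pullback_dt]
        exact sum_mem fun j _ => dt_mem j
  · intro z w h1 h2
    rw [map_add]; exact add_mem h1 h2
  · intro c z h1
    rw [map_smul]; exact Submodule.smul_mem _ _ h1

variable (k) in
/-- The simplicial commutative dg algebra `n ↦ Ω_n`. -/
def omega : SimplexCategoryᵒᵖ ⥤ CommDGAlgebra k where
  obj n := cdga k n.unop.len
  map φ := ⟨pullback φ.unop.toOrderHom, pullback_mem _, pullback_d _⟩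
  map_id _ := CommDGAlgebra.hom_ext (pullback_id _)
  map_comp φ ψ := CommDGAlgebra.hom_ext
    (pullback_comp ψ.unop.toOrderHom φ.unop.toOrderHom)

end PolyForms

/-! ### Maurer-Cartan elements, the exponential group and its action -/

namespace DGLieAlgebra

variable {k : Type u} [Field k]

/-- The Maurer-Cartan elements: `x` of degree `1` with `dx + [x, x] / 2 = 0`. -/
def MC (g : DGLieAlgebra k) : Type u :=
  {x : g.carrier // x ∈ g.deg 1 ∧ g.d x + (2 : k)⁻¹ • g.bracket x x = 0}

/-- A morphism of dg Lie algebras acts on Maurer-Cartan elements. -/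
def MC.map {g h : DGLieAlgebra k} (f : g ⟶ h) (x : g.MC) : h.MC :=
  ⟨f.toLinearMap x.1, f.map_mem x.2.1, by
    rw [← f.map_d, ← f.map_bracket, ← map_smul, ← map_add, x.2.2, map_zero]⟩

/-- The right-nested bracket `[x₁, [x₂, … [xₙ₋₁, xₙ] … ]]` of a list. -/
def nestedBracket (g : DGLieAlgebra k) : List g.carrier → g.carrier
  | [] => 0
  | [x] => x
  | x :: y :: l => g.bracket x (nestedBracket g (y :: l))

/-- The word `x ^ r₁ y ^ s₁ … x ^ rₘ y ^ sₘ` for the list of the pairs `(rᵢ, sᵢ)`. -/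
def bchWord {X : Type*} (x y : X) (l : List (ℕ × ℕ)) : List X :=
  l.flatMap fun p => List.replicate p.1 x ++ List.replicate p.2 y

/-- The coefficient `(-1) ^ (m - 1) / (m * ∑ (rᵢ + sᵢ) * ∏ rᵢ! sᵢ!)` of Dynkin's formula. -/
def bchCoeff (k : Type u) [Field k] (l : List (ℕ × ℕ)) : k :=
  (-1) ^ (l.length + 1) / ((l.length : k) * ((l.map fun p => p.1 + p.2).sum : ℕ) *
    ((l.map fun p => p.1.factorial * p.2.factorial).prod : ℕ))

/-- The Baker-Campbell-Hausdorff product `log (exp x * exp y)` by Dynkin's formula, the sum being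
over all nonempty lists of pairs `(rᵢ, sᵢ) ≠ (0, 0)`; it is finite if `g` is nilpotent. On elements
of degree `0` it is the multiplication of the group `exp g⁰`, whose underlying set is `g⁰`. -/
def bch (g : DGLieAlgebra k) (x y : g.carrier) : g.carrier :=
  ∑ᶠ l : {l : List (ℕ × ℕ) // l ≠ [] ∧ (0, 0) ∉ l},
    bchCoeff k l.1 • g.nestedBracket (bchWord x y l.1)

/-- The gauge action of `exp a`, for `a` of degree `0`, on elements of degree `1`:
`exp (ad a) x - ((exp (ad a) - 1) / ad a) (da)`, which is `exp (ad a) (d + x) - d`. -/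
def gauge (g : DGLieAlgebra k) (a x : g.carrier) : g.carrier :=
  (∑ᶠ j : ℕ, (j.factorial : k)⁻¹ • ((g.bracket a : Module.End k g.carrier) ^ j) x) -
    ∑ᶠ j : ℕ, ((j + 1).factorial : k)⁻¹ • ((g.bracket a : Module.End k g.carrier) ^ j) (g.d a)

/-! Compatibility of these constructions with morphisms. -/

theorem lcs_add {g : DGLieAlgebra k} {n : ℕ} (h : g.lcs n = ⊥) (m : ℕ) : g.lcs (n + m) = ⊥ := by
  induction m with
  | zero => exact h
  | succ m ih => rw [← add_assoc, lcs, ih, Submodule.map₂_bot_right]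

theorem nestedBracket_mem (g : DGLieAlgebra k) (l : List g.carrier) :
    g.nestedBracket l ∈ g.lcs (l.length - 1) := by
  induction l with
  | nil => exact zero_mem _
  | cons x l ih =>
    cases l with
    | nil => exact Submodule.mem_top
    | cons y l =>
      rw [nestedBracket]
      exact Submodule.apply_mem_map₂ _ Submodule.mem_top ih

theorem pow_bracket_mem (g : DGLieAlgebra k) (a x : g.carrier) (j : ℕ) :
    ((g.bracket a : Module.End k g.carrier) ^ j) x ∈ g.lcs j := by
  induction j with
  | zero => exact Submodule.mem_top
  | succ j ih =>
    rw [pow_succ', Module.End.mul_apply]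
    exact Submodule.apply_mem_map₂ _ Submodule.mem_top ih

theorem finite_bchIndex (N : ℕ) :
    {l : List (ℕ × ℕ) | (0, 0) ∉ l ∧ (l.map fun p => p.1 + p.2).sum ≤ N}.Finite := by
  refine ((List.finite_length_le (Fin (N + 1) × Fin (N + 1)) N).image
    (List.map fun p => ((p.1 : ℕ), (p.2 : ℕ)))).subset ?_
  rintro l ⟨h0, hl⟩
  have key : ∀ l : List (ℕ × ℕ), (0, 0) ∉ l → l.length ≤ (l.map fun p => p.1 + p.2).sum ∧
      ∀ p ∈ l, p.1 + p.2 ≤ (l.map fun p => p.1 + p.2).sum := by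
    intro l
    induction l with
    | nil => simp
    | cons p l ih =>
      intro h
      obtain ⟨h1, h2⟩ := ih fun h' => h (List.mem_cons_of_mem _ h')
      have hp : 1 ≤ p.1 + p.2 := by
        rcases p with ⟨r, s⟩
        by_contra hc
        have : r = 0 ∧ s = 0 := by simpa using hc
        exact h (by simp [this.1, this.2])
      refine ⟨?_, ?_⟩
      · simp only [List.length_cons, List.map_cons, List.sum_cons]
        omega
      · intro q hq
        rcases List.mem_cons.1 hq with rfl | hq
        · simp
        · have := h2 q hq
          simp only [List.map_cons, List.sum_cons]
          omega
  obtain ⟨h1, h2⟩ := key l h0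
  refine ⟨l.map fun p => (Fin.ofNat (N + 1) p.1, Fin.ofNat (N + 1) p.2), ?_, ?_⟩
  · simpa using h1.trans hl
  · rw [List.map_map]
    refine (List.map_congr_left fun p hp => ?_).trans (List.map_id l)
    have := (h2 p hp).trans hl
    ext <;> simp <;> omega

theorem length_bchWord {X : Type*} (x y : X) (l : List (ℕ × ℕ)) :
    (bchWord x y l).length = (l.map fun p => p.1 + p.2).sum := by
  simp [bchWord, List.length_flatMap]

theorem finite_bch {g : DGLieAlgebra k} (hg : g.IsNilpotent) (x y : g.carrier) :
    (Function.support fun l : {l : List (ℕ × ℕ) // l ≠ [] ∧ (0, 0) ∉ l} =>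
      bchCoeff k l.1 • g.nestedBracket (bchWord x y l.1)).Finite := by
  obtain ⟨n, hn⟩ := hg
  refine ((finite_bchIndex n).preimage Subtype.val_injective.injOn).subset fun l hl => ?_
  refine ⟨l.2.2, not_lt.1 fun hlt => hl ?_⟩
  have h := nestedBracket_mem g (bchWord x y l.1)
  rw [length_bchWord] at h
  obtain ⟨m, hm⟩ : ∃ m, (l.1.map fun p => p.1 + p.2).sum - 1 = n + m :=
    ⟨(l.1.map fun p => p.1 + p.2).sum - 1 - n, by omega⟩
  rw [hm, lcs_add hn, Submodule.mem_bot] at h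
  simp only [h, smul_zero]

theorem finite_pow_bracket {g : DGLieAlgebra k} (hg : g.IsNilpotent) (c : ℕ → k)
    (a x : g.carrier) : (Function.support fun j : ℕ =>
      c j • ((g.bracket a : Module.End k g.carrier) ^ j) x).Finite := by
  obtain ⟨n, hn⟩ := hg
  refine (Set.finite_lt_nat n).subset fun j hj => ?_
  by_contra hlt
  obtain ⟨m, rfl⟩ := Nat.exists_eq_add_of_le (not_lt.1 hlt)
  have h := pow_bracket_mem g a x (n + m)
  rw [lcs_add hn, Submodule.mem_bot] at h
  exact hj (by simp only [h, smul_zero])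

section map

variable {g h : DGLieAlgebra k} (f : g ⟶ h)

theorem map_nestedBracket (l : List g.carrier) :
    f.toLinearMap (g.nestedBracket l) = h.nestedBracket (l.map f.toLinearMap) := by
  induction l with
  | nil => exact map_zero _
  | cons x l ih =>
    cases l with
    | nil => rfl
    | cons y l =>
      rw [nestedBracket, f.map_bracket, ih]
      rfl

theorem map_bch (hg : g.IsNilpotent) (x y : g.carrier) :
    f.toLinearMap (g.bch x y) = h.bch (f.toLinearMap x) (f.toLinearMap y) := by
  rw [bch, ← LinearMap.toAddMonoidHom_coe, AddMonoidHom.map_finsum _ (finite_bch hg x y), bch]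
  refine finsum_congr fun l => ?_
  rw [LinearMap.toAddMonoidHom_coe, map_smul, map_nestedBracket]
  simp [bchWord, List.map_flatMap]

theorem map_pow_bracket (a x : g.carrier) (j : ℕ) :
    f.toLinearMap (((g.bracket a : Module.End k g.carrier) ^ j) x) =
      ((h.bracket (f.toLinearMap a) : Module.End k h.carrier) ^ j) (f.toLinearMap x) := by
  induction j with
  | zero => rfl
  | succ j ih =>
    rw [pow_succ', pow_succ', Module.End.mul_apply, Module.End.mul_apply, f.map_bracket, ih]

theorem map_gauge (hg : g.IsNilpotent) (a x : g.carrier) :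
    f.toLinearMap (g.gauge a x) = h.gauge (f.toLinearMap a) (f.toLinearMap x) := by
  rw [gauge, map_sub, ← LinearMap.toAddMonoidHom_coe,
    AddMonoidHom.map_finsum _ (finite_pow_bracket hg (fun j => (j.factorial : k)⁻¹) a x),
    AddMonoidHom.map_finsum _
      (finite_pow_bracket hg (fun j => ((j + 1).factorial : k)⁻¹) a (g.d a)), gauge]
  congr 1
  · refine finsum_congr fun j => ?_
    rw [LinearMap.toAddMonoidHom_coe, map_smul, map_pow_bracket]
  · refine finsum_congr fun j => ?_
    rw [LinearMap.toAddMonoidHom_coe, map_smul, map_pow_bracket, f.map_d]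

end map

end DGLieAlgebra

/-- The category of nilpotent dg Lie algebras. -/
abbrev NilpotentDGLie (k : Type u) [Field k] : Type (u + 1) :=
  ObjectProperty.FullSubcategory (C := DGLieAlgebra k) DGLieAlgebra.IsNilpotent

open DGLieAlgebra

/-! ### The nerve `Σ(g)` -/

/-- The functor `g ↦ Σ(g)`, where `Σ(g)` is the simplicial set `n ↦ MC (Ω_n ⊗ g)`. -/
def hinichNerve (k : Type u) [Field k] : NilpotentDGLie k ⥤ SSet.{u} where
  obj g :=
    { obj := fun n => (tensor ((PolyForms.omega k).obj n) g.obj).MC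
      map := fun φ => ↾(MC.map (tensorMap ((PolyForms.omega k).map φ) (𝟙 g.obj)))
      map_id := fun n => by
        ext x
        refine Subtype.ext ?_
        change (tensorMap ((PolyForms.omega k).map (𝟙 n)) (𝟙 g.obj)).toLinearMap x.1 = x.1
        rw [CategoryTheory.Functor.map_id, tensorMap_id]
        rfl
      map_comp := fun φ ψ => by
        ext x
        refine Subtype.ext ?_
        change (tensorMap ((PolyForms.omega k).map (φ ≫ ψ)) (𝟙 g.obj)).toLinearMap x.1 =
          (tensorMap ((PolyForms.omega k).map φ) (𝟙 g.obj) ≫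
            tensorMap ((PolyForms.omega k).map ψ) (𝟙 g.obj)).toLinearMap x.1
        rw [← tensorMap_comp, CategoryTheory.Functor.map_comp, Category.comp_id] }
  map {g h} f :=
    { app := fun n => ↾(MC.map (tensorMap (𝟙 ((PolyForms.omega k).obj n)) f.hom))
      naturality := fun m n φ => by
        ext x
        refine Subtype.ext ?_
        change (tensorMap ((PolyForms.omega k).map φ) (𝟙 g.obj) ≫
            tensorMap (𝟙 _) f.hom).toLinearMap x.1 =
          (tensorMap (𝟙 _) f.hom ≫
            tensorMap ((PolyForms.omega k).map φ) (𝟙 h.obj)).toLinearMap x.1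
        rw [← tensorMap_comp, ← tensorMap_comp, Category.comp_id, Category.comp_id,
          Category.id_comp, Category.id_comp] }
  map_id g := by
    ext n x
    refine Subtype.ext ?_
    change (tensorMap (𝟙 _) (𝟙 g.obj)).toLinearMap x.1 = x.1
    rw [tensorMap_id]
    rfl
  map_comp {g h l} f f' := by
    ext n x
    refine Subtype.ext ?_
    change (tensorMap (𝟙 _) (f.hom ≫ f'.hom)).toLinearMap x.1 =
      (tensorMap (𝟙 _) f.hom ≫ tensorMap (𝟙 _) f'.hom).toLinearMap x.1
    rw [← tensorMap_comp, Category.comp_id]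

/-! ### The simplicial Deligne groupoid and its nerve -/

/-- `exp a ∈ exp (A ⊗ g)⁰` carries the Maurer-Cartan element `x` of `g` to `y`. For `A = Ω_n` these
`a` are the `n`-morphisms `x ⟶ y` of the simplicial Deligne groupoid `Γ(g)`, whose objects are the
Maurer-Cartan elements of `g`; the identities are `exp 0`, and composition is the multiplication of
`exp (A ⊗ g)⁰`. -/
def IsDeligneMorphism (k : Type u) [Field k] (A : CommDGAlgebra k) (g : DGLieAlgebra k)
    (x y : g.MC) (a : (tensor A g).carrier) : Prop :=
  a ∈ (tensor A g).deg 0 ∧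
    (tensor A g).gauge a ((const A g).toLinearMap x.1) = (const A g).toLinearMap y.1

/-- A `q`-simplex of the nerve of the groupoid with objects `MC g` and with morphisms the elements
of `exp (A ⊗ g)⁰` carrying one object to another, that is a functor from the poset
`{0 < … < q}` to this groupoid. -/
structure DeligneNerveSimplex {k : Type u} [Field k] (A : CommDGAlgebra k) (g : DGLieAlgebra k)
    (q : ℕ) : Type u where
  obj : Fin (q + 1) → g.MC
  hom : ∀ i j : Fin (q + 1), i ≤ j → (tensor A g).carrier
  isMorphism : ∀ (i j : Fin (q + 1)) (h : i ≤ j),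
    IsDeligneMorphism k A g (obj i) (obj j) (hom i j h)
  hom_id : ∀ i : Fin (q + 1), hom i i le_rfl = 0
  hom_comp : ∀ (i j l : Fin (q + 1)) (h : i ≤ j) (h' : j ≤ l),
    hom i l (h.trans h') = (tensor A g).bch (hom j l h') (hom i j h)

theorem DeligneNerveSimplex.eq_of {k : Type u} [Field k] {A : CommDGAlgebra k}
    {g : DGLieAlgebra k} {q : ℕ} {s s' : DeligneNerveSimplex A g q} (h : s.obj = s'.obj)
    (h' : ∀ (i j : Fin (q + 1)) (hij : i ≤ j), s.hom i j hij = s'.hom i j hij) : s = s' := by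
  cases s
  cases s'
  obtain rfl := h
  obtain rfl : _ = _ := funext fun i => funext fun j => funext fun hij => h' i j hij
  rfl

/-- Functoriality of the simplices of the nerves in `A`, `g` and the poset. -/
def DeligneNerveSimplex.map {k : Type u} [Field k] {A B : CommDGAlgebra k} {g h : DGLieAlgebra k}
    (hg : g.IsNilpotent) (f : A ⟶ B) (φ : g ⟶ h) {m n : ℕ} (θ : Fin (m + 1) →o Fin (n + 1))
    (s : DeligneNerveSimplex A g n) : DeligneNerveSimplex B h m where
  obj i := MC.map φ (s.obj (θ i))
  hom i j hij := (tensorMap f φ).toLinearMap (s.hom (θ i) (θ j) (θ.monotone hij))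
  isMorphism i j hij := by
    obtain ⟨h1, h2⟩ := s.isMorphism (θ i) (θ j) (θ.monotone hij)
    have e : ∀ x : g.carrier, (const B h).toLinearMap (φ.toLinearMap x) =
        (tensorMap f φ).toLinearMap ((const A g).toLinearMap x) := fun x =>
      (LinearMap.congr_fun (congrArg Hom.toLinearMap (const_tensorMap f φ)) x).symm
    refine ⟨(tensorMap f φ).map_mem h1, ?_⟩
    change gauge _ _ ((const B h).toLinearMap (φ.toLinearMap _)) =
      (const B h).toLinearMap (φ.toLinearMap _)
    rw [e, e, ← h2, map_gauge _ (hg.tensor A)]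
  hom_id i := by rw [s.hom_id, map_zero]
  hom_comp i j l hij hjl := by
    rw [s.hom_comp _ _ _ (θ.monotone hij) (θ.monotone hjl), map_bch _ (hg.tensor A)]

/-- The functor `g ↦ 𝒩(Γ(g))`: the diagonal of the bisimplicial set formed by the nerves of the
groupoids `Γ_n(g)`, so that an `n`-simplex is an `n`-simplex of the nerve of `Γ_n(g)`. -/
def deligneNerve (k : Type u) [Field k] : NilpotentDGLie k ⥤ SSet.{u} where
  obj g :=
    { obj := fun n => DeligneNerveSimplex ((PolyForms.omega k).obj n) g.obj n.unop.len
      map := fun φ => ↾(DeligneNerveSimplex.map g.property ((PolyForms.omega k).map φ) (𝟙 g.obj)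
        φ.unop.toOrderHom)
      map_id := fun n => by
        ext s
        refine DeligneNerveSimplex.eq_of rfl fun i j hij => ?_
        change (tensorMap ((PolyForms.omega k).map (𝟙 n)) (𝟙 g.obj)).toLinearMap (s.hom i j hij) = _
        rw [CategoryTheory.Functor.map_id, tensorMap_id]
        rfl
      map_comp := fun {a b c} φ ψ => by
        ext s
        refine DeligneNerveSimplex.eq_of rfl fun i j hij => ?_
        change (tensorMap ((PolyForms.omega k).map (φ ≫ ψ)) (𝟙 g.obj)).toLinearMap _ =
          (tensorMap ((PolyForms.omega k).map φ) (𝟙 g.obj) ≫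
            tensorMap ((PolyForms.omega k).map ψ) (𝟙 g.obj)).toLinearMap _
        rw [← tensorMap_comp, CategoryTheory.Functor.map_comp, Category.comp_id]
        rfl }
  map {g h} f :=
    { app := fun n => ↾(DeligneNerveSimplex.map g.property (𝟙 ((PolyForms.omega k).obj n)) f.hom
        OrderHom.id)
      naturality := fun m n φ => by
        ext s
        refine DeligneNerveSimplex.eq_of rfl fun i j hij => ?_
        change (tensorMap ((PolyForms.omega k).map φ) (𝟙 g.obj) ≫
            tensorMap (𝟙 _) f.hom).toLinearMap _ =
          (tensorMap (𝟙 _) f.hom ≫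
            tensorMap ((PolyForms.omega k).map φ) (𝟙 h.obj)).toLinearMap _
        rw [← tensorMap_comp, ← tensorMap_comp, Category.comp_id, Category.comp_id,
          Category.id_comp, Category.id_comp]
        rfl }
  map_id g := by
    ext n s
    refine DeligneNerveSimplex.eq_of rfl fun i j hij => ?_
    change (tensorMap (𝟙 _) (𝟙 g.obj)).toLinearMap (s.hom i j hij) = s.hom i j hij
    rw [tensorMap_id]
    rfl
  map_comp {g h l} f f' := by
    ext n s
    refine DeligneNerveSimplex.eq_of rfl fun i j hij => ?_
    change (tensorMap (𝟙 _) (f.hom ≫ f'.hom)).toLinearMap (s.hom i j hij) =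
      (tensorMap (𝟙 _) f.hom ≫ tensorMap (𝟙 _) f'.hom).toLinearMap (s.hom i j hij)
    rw [← tensorMap_comp, Category.comp_id]

/-! ### Natural homotopy equivalence -/

/-- `f` is a homotopy equivalence: it has a homotopy inverse. -/
def IsSimplicialHomotopyEquivalence {X Y : SSet.{u}} (f : X ⟶ Y) : Prop :=
  ∃ g : Y ⟶ X, Nonempty (SSet.Homotopy (f ≫ g) (𝟙 X)) ∧ Nonempty (SSet.Homotopy (g ≫ f) (𝟙 Y))

/-- Two functors with values in simplicial sets are naturally homotopy equivalent if they are
connected by a finite zigzag of natural transformations, each of which consists of homotopy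
equivalences. -/
def NaturallyHomotopyEquivalent {C : Type*} [Category C] (F G : C ⥤ SSet.{u}) : Prop :=
  Relation.EqvGen (fun F' G' : C ⥤ SSet.{u} => ∃ τ : F' ⟶ G',
    ∀ X : C, IsSimplicialHomotopyEquivalence (τ.app X)) F G

end

/-!
Both `Σ(g)` and `𝒩(Γ(g))` are retracts of the simplicial set `gaugeNerve k` at `g`, whose
`n`-simplices are the `n`-simplices of the nerve of the full Deligne groupoid of `Ω_n ⊗ g`: chains of
Maurer-Cartan elements `x₀, …, xₙ` of `Ω_n ⊗ g` together with gauge transformations `g_ij` between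
them. The first sits inside as the chains of identities (`constChain`), the second as the chains
whose objects are constant forms (`deligneChain`). Both inclusions are natural in `g`, and they form
the zigzag.

A family of gauge transformations `u_i`, one for each vertex of each simplex and compatible with the
simplicial structure (`GaugeFamily`), acts on `gaugeNerve k` by `x_i ↦ u_i x_i`,
`g_ij ↦ u_j g_ij u_i⁻¹`, and this endomorphism is homotopic to the identity: over a simplex of the
interval, apply `u_i` only at the vertices which lie over `0` (`GaugeFamily.homotopy`). So it is
enough to find families which retract `gaugeNerve k` onto each of the two subobjects. These
retractions need not be natural in `g`.

* For `𝒩(Γ(g))`, let `u_i` be the canonical gauge transformation from `x_i` to the constant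
  Maurer-Cartan element given by the value of `x_i` at the vertex `i`. With `η` the homotopy of `Ω_n`
  coming from the linear contraction of the simplex to the vertex `i`, it is the solution `c` of
  `η (exp c • x + dc) = c` (`Contraction.gaugeFix`). Then `η (exp c • x) = 0`, and a Maurer-Cartan
  element killed by `η` is constant (`Contraction.eq_const_of_formOp_η_eq_zero`,
  `Contraction.gauge_gaugeFix`). The homotopy `η` is natural for the maps of simplices preserving the
  chosen vertex (`PolyForms.pullback_homotopy`), so the `u_i` are compatible with the simplicial
  structure.

* For `Σ(g)`, let `u_i` be the barycentre of the `g_ij`: the solution `b` of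
  `∑ j, t_j (g_ij b⁻¹) = 0`, where the sum is taken in the Lie algebra (`WeightSystem.barycentre`).
  The equation shows at once that `u_i = u_j g_ij`, so that all morphisms of the new chain are
  identities (`GaugeChain.twist_centre`).

Both equations are solved by `exists_unique_fixedPoint`: they are fixed point equations of maps
which are contractive for the finite filtration of `Ω_n ⊗ g` by the lower central series of `g`.
Uniqueness of the solutions gives all the compatibilities.

The construction uses that `exp g⁰` is a group which acts on the Maurer-Cartan elements. The gauge
action is the exponential of the representation `extRep` of `g⁰` on `g × k`, where `(x, c)` stands for
`x + c d`, so Dynkin's formula in an associative algebra (`nexp_dynkin`) shows that it is compatible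
with the Baker-Campbell-Hausdorff product (`gauge_bch`). The representation need not be faithful on
`g⁰`, but on paths, that is on `Ω_1 ⊗ g` for `g` with zero differential, it determines the
derivative of the path; since every element is the end point of the path `t ⊗ a`, the group laws
follow (`eval_one_eq`, `bch_assoc`).
-/

noncomputable section

/-! ### Power series in a nilpotent element -/

section NilEval

open PowerSeries Finset

variable {k A B : Type*} [Field k] [Ring A] [Algebra k A] [Ring B] [Algebra k B]

/-- The value `f(a)` of a power series at a nilpotent element `a`. The nilpotency class of an element
which is not nilpotent is `0`, so the value is `0` there. -/
def nilEval (f : k⟦X⟧) (a : A) : A := ∑ i ∈ range (nilpotencyClass a), coeff i f • a ^ i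

theorem nilEval_eq_sum (f : k⟦X⟧) {a : A} {N : ℕ} (h : a ^ N = 0) :
    nilEval f a = ∑ i ∈ range N, coeff i f • a ^ i := by
  refine sum_subset (range_subset_range.2 (csInf_le' h)) fun i _ hi => ?_
  rw [pow_eq_zero_of_le (not_lt.1 fun h' => hi (mem_range.2 h')) (pow_nilpotencyClass ⟨N, h⟩),
    smul_zero]

theorem nilEval_eq_aeval (f : k⟦X⟧) {a : A} {N : ℕ} (h : a ^ N = 0) :
    nilEval f a = Polynomial.aeval a (trunc N f) := by
  rw [nilEval_eq_sum f h, Polynomial.aeval_def, eval₂_trunc_eq_sum_range]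
  simp [Algebra.smul_def]

theorem aeval_trunc_coe (p : Polynomial k) {a : A} {N : ℕ} (h : a ^ N = 0) :
    Polynomial.aeval a (trunc N (p : k⟦X⟧)) = Polynomial.aeval a p := by
  induction p using Polynomial.induction_on' with
  | add p q hp hq => rw [Polynomial.coe_add, map_add, map_add, map_add, hp, hq]
  | monomial n c =>
    rw [Polynomial.aeval_def, eval₂_trunc_eq_sum_range, Polynomial.aeval_monomial]
    simp only [Polynomial.coeff_coe, Polynomial.coeff_monomial]
    by_cases hn : n < N
    · rw [sum_eq_single_of_mem n (mem_range.2 hn) fun j _ hj => by rw [if_neg hj.symm]; simp]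
      simp
    · rw [pow_eq_zero_of_le (not_lt.1 hn) h, mul_zero]
      refine sum_eq_zero fun j hj => ?_
      rw [if_neg (by have := mem_range.1 hj; omega)]
      simp

theorem nilEval_mul (f g : k⟦X⟧) {a : A} (h : IsNilpotent a) :
    nilEval (f * g) a = nilEval f a * nilEval g a := by
  obtain ⟨N, h⟩ := h
  rw [nilEval_eq_aeval _ h, nilEval_eq_aeval _ h, nilEval_eq_aeval _ h, ← map_mul,
    ← aeval_trunc_coe (_ * _) h, Polynomial.coe_mul, trunc_trunc_mul_trunc]

theorem nilEval_add (f g : k⟦X⟧) (a : A) :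
    nilEval (f + g) a = nilEval f a + nilEval g a := by
  simp [nilEval, add_smul, sum_add_distrib]

theorem nilEval_coe (p : Polynomial k) {a : A} (h : IsNilpotent a) :
    nilEval (p : k⟦X⟧) a = Polynomial.aeval a p := by
  obtain ⟨N, h⟩ := h
  rw [nilEval_eq_aeval _ h, aeval_trunc_coe p h]

theorem nilEval_one {a : A} (h : IsNilpotent a) : nilEval (1 : k⟦X⟧) a = 1 := by
  have := nilEval_coe (1 : Polynomial k) h
  simpa using this

theorem nilEval_X {a : A} (h : IsNilpotent a) : nilEval (X : k⟦X⟧) a = a := by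
  have := nilEval_coe (Polynomial.X : Polynomial k) h
  simpa using this

/-- Evaluation at a nilpotent element as an algebra homomorphism. -/
def nilEvalHom {a : A} (h : IsNilpotent a) : k⟦X⟧ →ₐ[k] A where
  toFun f := nilEval f a
  map_one' := nilEval_one h
  map_mul' f g := nilEval_mul f g h
  map_zero' := by simp [nilEval]
  map_add' f g := nilEval_add f g a
  commutes' c := by
    have := nilEval_coe (Polynomial.C c : Polynomial k) h
    rw [Polynomial.coe_C, Polynomial.aeval_C] at this
    exact this

theorem nilEval_pow_eq_zero {g : k⟦X⟧} (hg : constantCoeff g = 0) {a : A} {N : ℕ}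
    (h : a ^ N = 0) : nilEval g a ^ N = 0 := by
  obtain ⟨g', rfl⟩ := X_dvd_iff.2 hg
  have e := map_pow (nilEvalHom (k := k) ⟨N, h⟩) (X * g') N
  change nilEval _ a = nilEval _ a ^ N at e
  rw [← e, mul_pow, nilEval_mul _ _ ⟨N, h⟩]
  have e2 := map_pow (nilEvalHom (k := k) ⟨N, h⟩) X N
  change nilEval _ a = nilEval _ a ^ N at e2
  rw [e2, nilEval_X ⟨N, h⟩, h, zero_mul]

theorem isNilpotent_nilEval {g : k⟦X⟧} (hg : constantCoeff g = 0) {a : A} (h : IsNilpotent a) :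
    IsNilpotent (nilEval g a) := by
  obtain ⟨N, h⟩ := h
  exact ⟨N, nilEval_pow_eq_zero hg h⟩

/-- Evaluation is compatible with substitution: split off the truncation of `f`, a polynomial; the
remainder is a multiple of `g ^ N`, which vanishes at `a`. -/
theorem nilEval_subst (f : k⟦X⟧) {g : k⟦X⟧} (hg : constantCoeff g = 0) {a : A}
    (h : IsNilpotent a) : nilEval (f.subst g) a = nilEval f (nilEval g a) := by
  have hs : HasSubst g := HasSubst.of_constantCoeff_zero' hg
  obtain ⟨N, hN⟩ := h
  have hb := nilEval_pow_eq_zero hg hN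
  have e : ∀ s, nilEvalHom (k := k) ⟨N, hN⟩ s = nilEval s a := fun _ => rfl
  have h1 : f.subst g = Polynomial.aeval g (trunc N f) +
      g ^ N * (mk fun i => coeff (i + N) f : k⟦X⟧).subst g := by
    conv_lhs => rw [eq_X_pow_mul_shift_add_trunc N f]
    rw [subst_add hs, subst_mul hs, subst_pow hs, subst_X hs, subst_coe hs, add_comm]
  rw [h1, nilEval_eq_aeval f hb, ← e, map_add, map_mul, map_pow, ← Polynomial.aeval_algHom_apply,
    e, hb, zero_mul, add_zero]

theorem map_nilEval (φ : A →ₐ[k] B) (f : k⟦X⟧) {a : A} (h : IsNilpotent a) :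
    φ (nilEval f a) = nilEval f (φ a) := by
  obtain ⟨N, h⟩ := h
  rw [nilEval_eq_sum f h, nilEval_eq_sum f (N := N) (by rw [← map_pow, h, map_zero]), map_sum]
  simp

end NilEval

section ExpLog

open PowerSeries Finset

variable (k : Type*) {A B : Type*} [Field k] [CharZero k] [Ring A] [Algebra k A] [Ring B]
  [Algebra k B]

theorem constantCoeff_subst_of_constantCoeff {k : Type*} [Field k] {f g : k⟦X⟧}
    (hf : constantCoeff f = 0) (hg : constantCoeff g = 0) : constantCoeff (f.subst g) = 0 := by
  have hs : HasSubst g := HasSubst.of_constantCoeff_zero' hg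
  obtain ⟨f', rfl⟩ := X_dvd_iff.2 hf
  rw [subst_mul hs, subst_X hs, map_mul, hg, zero_mul]

theorem deriv_log_mul : (d⁄dX k (log k)) * (1 + X) = 1 := by
  rw [deriv_log]
  ext n
  rw [mul_add, mul_one, map_add, coeff_mk]
  cases n with
  | zero => simp
  | succ n => simp [coeff_succ_mul_X, coeff_one, pow_succ]

theorem log_subst_exp : (log k).subst (exp k - 1) = X := by
  have hs : HasSubst (exp k - 1) := HasSubst.exp_sub_one
  refine derivative.ext ?_ ?_
  · rw [derivative_subst hs, map_sub, derivative_exp, Derivation.map_one_eq_zero, sub_zero,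
      derivative_X]
    have h2 := congrArg (fun f => f.subst (exp k - 1)) (deriv_log_mul k)
    simp only [subst_mul hs, subst_add hs, subst_X hs] at h2
    have h3 : (1 : k⟦X⟧).subst (exp k - 1) = (1 : k⟦X⟧) := by
      rw [← coe_substAlgHom hs, map_one]
    rw [h3] at h2
    simpa using h2
  · rw [constantCoeff_subst_of_constantCoeff constantCoeff_log (by simp)]
    simp

theorem exp_subst_log : (exp k).subst (log k) = 1 + X := by
  have hs : HasSubst (log k) := HasSubst.log
  have h1 := deriv_log_mul k
  have h0 : constantCoeff ((exp k).subst (log k)) = 1 := by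
    have e : (exp k).subst (log k) = 1 + (exp k - 1).subst (log k) := by
      have : (1 : k⟦X⟧).subst (log k) = (1 : k⟦X⟧) := by rw [← coe_substAlgHom hs, map_one]
      nth_rewrite 1 [← this]
      rw [← subst_add hs, add_sub_cancel]
    rw [e, map_add, constantCoeff_subst_of_constantCoeff (by simp) constantCoeff_log]
    simp
  set F := (exp k).subst (log k) with hF
  have h2 : d⁄dX k F = F * d⁄dX k (log k) := by
    rw [hF, derivative_subst hs, derivative_exp]
  -- `F * log'` is constant, since both `F' = F * log'` and `(log')' = -(log')²`
  have h3 : F * d⁄dX k (log k) = 1 := by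
    refine derivative.ext ?_ ?_
    · have h4 : d⁄dX k (d⁄dX k (log k)) = -(d⁄dX k (log k) * d⁄dX k (log k)) := by
        have := congrArg (d⁄dX k) h1
        simp only [Derivation.leibniz, map_add, Derivation.map_one_eq_zero, derivative_X,
          zero_add, smul_eq_mul, mul_one] at this
        linear_combination (d⁄dX k (log k)) * this - (d⁄dX k (d⁄dX k (log k))) * h1
      rw [Derivation.leibniz, h2, h4, Derivation.map_one_eq_zero]
      simp only [smul_eq_mul]
      ring
    · rw [map_mul, h0, deriv_log]
      simp [← coeff_zero_eq_constantCoeff_apply]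
  linear_combination (1 + X) * h3 - F * h1

/-- The exponential of a nilpotent element. -/
def nexp (a : A) : A := nilEval (exp k) a

/-- The logarithm `log (1 + u)` for a nilpotent element `u`. -/
def nlog (u : A) : A := nilEval (log k) u

theorem nexp_eq_sum {a : A} {N : ℕ} (h : a ^ N = 0) :
    nexp k a = ∑ i ∈ range N, (i.factorial : k)⁻¹ • a ^ i := by
  rw [nexp, nilEval_eq_sum _ h]
  simp [coeff_exp]

theorem nlog_eq_sum {a : A} {N : ℕ} (h : a ^ N = 0) :
    nlog k a = ∑ i ∈ range N, ((-1) ^ (i + 1) / (i : k)) • a ^ i := by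
  rw [nlog, nilEval_eq_sum _ h]
  refine sum_congr rfl fun i _ => ?_
  rw [coeff_log]
  split_ifs with hi
  · simp [hi]
  · simp

theorem isNilpotent_nlog {u : A} (h : IsNilpotent u) : IsNilpotent (nlog k u) :=
  isNilpotent_nilEval constantCoeff_log h

theorem nilEval_sub_one {a : A} (h : IsNilpotent a) :
    nilEval (exp k - 1) a = nexp k a - 1 := by
  have := map_sub (nilEvalHom (k := k) h) (exp k) 1
  rw [map_one] at this
  exact this

theorem nlog_nexp {a : A} (h : IsNilpotent a) : nlog k (nexp k a - 1) = a := by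
  rw [← nilEval_sub_one k h, nlog, ← nilEval_subst _ (by simp) h, log_subst_exp, nilEval_X h]

theorem nexp_nlog {u : A} (h : IsNilpotent u) : nexp k (nlog k u) = 1 + u := by
  rw [nexp, nlog, ← nilEval_subst _ constantCoeff_log h, exp_subst_log, nilEval_add, nilEval_X h,
    nilEval_one h]

theorem nexp_injective {a b : A} (ha : IsNilpotent a) (hb : IsNilpotent b)
    (h : nexp k a = nexp k b) : a = b := by
  rw [← nlog_nexp k ha, ← nlog_nexp k hb, h]

theorem map_nexp (φ : A →ₐ[k] B) {a : A} (h : IsNilpotent a) :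
    φ (nexp k a) = nexp k (φ a) := map_nilEval φ _ h

theorem nexp_add_of_commute {a b : A} (h : Commute a b) (ha : IsNilpotent a)
    (hb : IsNilpotent b) : nexp k (a + b) = nexp k a * nexp k b := by
  let _ : Module ℚ A := Module.compHom A (algebraMap ℚ k)
  have key : ∀ c : A, IsNilpotent c → nexp k c = IsNilpotent.exp c := by
    rintro c ⟨N, hc⟩
    rw [nexp_eq_sum k hc, IsNilpotent.exp_eq_sum hc]
    refine sum_congr rfl fun i _ => ?_
    change _ = (algebraMap ℚ k (i.factorial : ℚ)⁻¹) • c ^ i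
    simp
  rw [key _ (h.isNilpotent_add ha hb), key _ ha, key _ hb,
    IsNilpotent.exp_add_of_commute h ha hb]

theorem nexp_zero : nexp k (0 : A) = 1 := by
  rw [nexp_eq_sum k (pow_one 0)]
  simp

theorem nexp_mul_nexp_neg {a : A} (h : IsNilpotent a) : nexp k a * nexp k (-a) = 1 := by
  rw [← nexp_add_of_commute k (Commute.neg_right rfl) h h.neg, add_neg_cancel, nexp_zero]

theorem nexp_neg_mul_nexp {a : A} (h : IsNilpotent a) : nexp k (-a) * nexp k a = 1 := by
  rw [← nexp_add_of_commute k (Commute.neg_left rfl) h.neg h, neg_add_cancel, nexp_zero]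

end ExpLog

/-! ### Dynkin's formula in an associative algebra -/

section Dynkin

open Finset
open DGLieAlgebra (bchWord bchCoeff finite_bchIndex length_bchWord)

section Lists

variable {α A : Type*} [DecidableEq α] [Semiring A]

/-- The lists of length `m` with entries in a finite set. -/
def listsOf (Q : Finset α) : ℕ → Finset (List α)
  | 0 => {[]}
  | m + 1 => (Q ×ˢ listsOf Q m).image fun p => p.1 :: p.2

theorem mem_listsOf {Q : Finset α} {m : ℕ} {l : List α} :
    l ∈ listsOf Q m ↔ l.length = m ∧ ∀ q ∈ l, q ∈ Q := by
  induction m generalizing l with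
  | zero =>
    rw [listsOf, mem_singleton, List.length_eq_zero_iff]
    exact ⟨fun h => by simp [h], fun h => h.1⟩
  | succ m ih =>
    rw [listsOf, mem_image]
    constructor
    · rintro ⟨⟨q, l⟩, h, rfl⟩
      rw [mem_product, ih] at h
      simpa [h.2.1] using ⟨h.1, h.2.2⟩
    · rintro ⟨h1, h2⟩
      cases l with
      | nil => simp at h1
      | cons q l =>
        refine ⟨(q, l), ?_, rfl⟩
        rw [mem_product, ih]
        exact ⟨h2 q (by simp), by simpa using h1, fun p hp => h2 p (by simp [hp])⟩

theorem sum_pow_eq_sum_lists (Q : Finset α) (f : α → A) (m : ℕ) :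
    (∑ q ∈ Q, f q) ^ m = ∑ l ∈ listsOf Q m, (l.map f).prod := by
  induction m with
  | zero => simp [listsOf]
  | succ m ih =>
    rw [pow_succ', ih, listsOf, sum_image, sum_product, sum_mul_sum]
    · simp
    · rintro ⟨q, l⟩ _ ⟨q', l'⟩ _ h
      simpa using h

end Lists

/-- The nonempty lists of pairs `≠ (0, 0)` of total degree at most `N`. -/
def bchIndex (N : ℕ) : Finset (List (ℕ × ℕ)) := (finite_bchIndex N).toFinset.erase []

/-- The total degree of a list of pairs. -/
abbrev bchDeg (l : List (ℕ × ℕ)) : ℕ := (l.map fun p => p.1 + p.2).sum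

theorem mem_bchIndex {N : ℕ} {l : List (ℕ × ℕ)} :
    l ∈ bchIndex N ↔ l ≠ [] ∧ (0, 0) ∉ l ∧ bchDeg l ≤ N := by
  simp [bchIndex]

theorem length_le_bchDeg {l : List (ℕ × ℕ)} (h : (0, 0) ∉ l) : l.length ≤ bchDeg l := by
  induction l with
  | nil => simp
  | cons p l ih =>
    have h1 := ih fun h' => h (List.mem_cons_of_mem _ h')
    have hp : 1 ≤ p.1 + p.2 := by
      rcases p with ⟨r, s⟩
      by_contra hc
      have : r = 0 ∧ s = 0 := by simpa using hc
      exact h (by simp [this.1, this.2])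
    simp only [List.length_cons, bchDeg, List.map_cons, List.sum_cons] at h1 ⊢
    omega

theorem le_bchDeg {l : List (ℕ × ℕ)} {p : ℕ × ℕ} (h : p ∈ l) : p.1 + p.2 ≤ bchDeg l :=
  List.single_le_sum (by simp) _ (List.mem_map_of_mem h)

theorem bchDeg_pos {l : List (ℕ × ℕ)} (h : l ≠ []) (h0 : (0, 0) ∉ l) : 0 < bchDeg l :=
  (List.length_pos_iff.2 h).trans_le (length_le_bchDeg h0)

variable (k : Type*) {A : Type*} [Field k] [Ring A] [Algebra k A]

/-- The operator `[a, ·]` of an associative algebra. -/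
def adL : A →ₗ[k] Module.End k A := LinearMap.mul k A - (LinearMap.mul k A).flip

theorem adL_apply (a b : A) : adL k a b = a * b - b * a := rfl

theorem adL_eq (a : A) : adL k a = LinearMap.mulLeft k a + -LinearMap.mulRight k a := by
  ext b
  simp [adL_apply, sub_eq_add_neg]

theorem isNilpotent_mulLeft {a : A} (h : IsNilpotent a) : IsNilpotent (LinearMap.mulLeft k a) :=
  h.map (Algebra.lmul k A)

theorem isNilpotent_mulRight {a : A} (h : IsNilpotent a) :
    IsNilpotent (LinearMap.mulRight k a) := by
  obtain ⟨N, h⟩ := h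
  exact ⟨N, by rw [LinearMap.pow_mulRight, h]; simp⟩

/-- The right-nested commutator of a list. -/
def nestedComm : List A → A
  | [] => 0
  | [a] => a
  | a :: b :: l => a * nestedComm (b :: l) - nestedComm (b :: l) * a

/-- If `[E, a] = a` for all letters, then `ad a₁ … ad aₘ` turns `E` into a nested commutator. -/
theorem adL_list_prod {E : A} {L : List A} (hL : ∀ a ∈ L, E * a - a * E = a) (hne : L ≠ []) :
    (L.map (adL k)).prod E = -nestedComm L := by
  induction L with
  | nil => exact absurd rfl hne
  | cons a L ih =>
    rw [List.map_cons, List.prod_cons, Module.End.mul_apply]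
    cases L with
    | nil =>
      have := hL a (by simp)
      simp only [List.map_nil, List.prod_nil, Module.End.one_apply, adL_apply, nestedComm]
      rw [← neg_sub, this]
    | cons b L =>
      rw [ih (fun c hc => hL c (by simp [hc])) (by simp), map_neg, adL_apply, nestedComm]

/-- If `[E, a] = a` for all letters, then `[E, ·]` counts the letters of a word. -/
theorem commutator_list_prod {E : A} {L : List A} (hL : ∀ a ∈ L, E * a - a * E = a) :
    E * L.prod - L.prod * E = (L.length : A) * L.prod := by
  induction L with
  | nil => simp
  | cons a L ih =>
    have h1 := hL a (by simp)
    have h2 := ih fun c hc => hL c (by simp [hc])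
    rw [List.prod_cons, List.length_cons, Nat.cast_succ, add_mul, one_mul, ← mul_assoc]
    have h3 : E * a * L.prod - a * L.prod * E =
        (E * a - a * E) * L.prod + a * (E * L.prod - L.prod * E) := by noncomm_ring
    rw [h3, h1, h2, ← mul_assoc, ← (Nat.cast_commute L.length a).eq, mul_assoc, add_comm]

/-- The coefficient `(-1) ^ (m - 1) / (m * ∏ rᵢ! sᵢ!)` of a word in the expansion of
`log (exp x * exp y)`. -/
def logCoeff (l : List (ℕ × ℕ)) : k :=
  ((-1) ^ (l.length + 1) / (l.length : k)) *
    (((l.map fun p => p.1.factorial * p.2.factorial).prod : ℕ) : k)⁻¹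

theorem bchCoeff_eq (l : List (ℕ × ℕ)) :
    bchCoeff k l = (bchDeg l : k)⁻¹ * logCoeff k l := by
  rw [bchCoeff, logCoeff, div_eq_mul_inv, div_eq_mul_inv, mul_inv, mul_inv]
  ring

/-- Every word in the letters `x`, `y` with at least `N` letters vanishes. -/
def WordsVanish (x y : A) (N : ℕ) : Prop :=
  ∀ l : List A, (∀ z ∈ l, z = x ∨ z = y) → N ≤ l.length → l.prod = 0

theorem mem_bchWord {X : Type*} {x y z : X} {l : List (ℕ × ℕ)} (h : z ∈ bchWord x y l) :
    z = x ∨ z = y := by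
  simp only [bchWord, List.mem_flatMap, List.mem_append, List.mem_replicate] at h
  tauto

theorem map_bchWord {X Y : Type*} (f : X → Y) (x y : X) (l : List (ℕ × ℕ)) :
    (bchWord x y l).map f = bchWord (f x) (f y) l := by
  simp [bchWord, List.map_flatMap]

variable {k} {x y : A} {N : ℕ}

theorem WordsVanish.mono {M : ℕ} (h : WordsVanish x y N) (hNM : N ≤ M) : WordsVanish x y M :=
  fun l hl hM => h l hl (hNM.trans hM)

theorem WordsVanish.pow_left (h : WordsVanish x y N) : x ^ N = 0 := by
  simpa using h (List.replicate N x) (fun z hz => Or.inl (List.eq_of_mem_replicate hz)) (by simp)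

theorem WordsVanish.pow_right (h : WordsVanish x y N) : y ^ N = 0 := by
  simpa using h (List.replicate N y) (fun z hz => Or.inr (List.eq_of_mem_replicate hz)) (by simp)

theorem WordsVanish.bchWord (h : WordsVanish x y N) {l : List (ℕ × ℕ)} (hl : N ≤ bchDeg l) :
    (bchWord x y l).prod = 0 :=
  h _ (fun _ => mem_bchWord) (by rwa [length_bchWord])

variable (k)

/-- The operators `ad x`, `ad y` satisfy the same kind of nilpotency as `x`, `y`, since a word in
them is a combination of the maps `b ↦ v * b * w` with words `v`, `w`. -/
theorem WordsVanish.adL (h : WordsVanish x y N) :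
    WordsVanish (adL k x) (adL k y) (2 * N) := by
  have key : ∀ L : List (Module.End k A), (∀ z ∈ L, z = _root_.adL k x ∨ z = _root_.adL k y) →
      ∀ b, L.prod b ∈ Submodule.span k {c | ∃ v w : List A, (∀ z ∈ v, z = x ∨ z = y) ∧
        (∀ z ∈ w, z = x ∨ z = y) ∧ v.length + w.length = L.length ∧
          c = v.prod * b * w.prod} := by
    intro L hL b
    induction L with
    | nil => exact Submodule.subset_span ⟨[], [], by simp, by simp, by simp, by simp⟩
    | cons z L ih =>
      obtain ⟨a, ha, rfl⟩ : ∃ a, (a = x ∨ a = y) ∧ z = _root_.adL k a := by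
        rcases hL z (by simp) with rfl | rfl
        · exact ⟨x, Or.inl rfl, rfl⟩
        · exact ⟨y, Or.inr rfl, rfl⟩
      rw [List.prod_cons, Module.End.mul_apply]
      refine Submodule.span_induction (p := fun c _ => _root_.adL k a c ∈ _) ?_ (by simp)
        (fun c d _ _ hc hd => by rw [map_add]; exact add_mem hc hd)
        (fun t c _ hc => by rw [map_smul]; exact Submodule.smul_mem _ _ hc)
        (ih fun z hz => hL z (by simp [hz]))
      rintro _ ⟨v, w, hv, hw, hlen, rfl⟩
      rw [adL_apply]
      refine sub_mem (Submodule.subset_span ⟨a :: v, w, ?_, hw, ?_, ?_⟩)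
        (Submodule.subset_span ⟨v, w ++ [a], hv, ?_, ?_, ?_⟩)
      · rintro z hz
        rcases List.mem_cons.1 hz with rfl | hz
        exacts [ha, hv z hz]
      · simp only [List.length_cons]
        omega
      · simp [mul_assoc]
      · rintro z hz
        rcases List.mem_append.1 hz with hz | hz
        · exact hw z hz
        · rw [List.mem_singleton.1 hz]
          exact ha
      · simp only [List.length_append, List.length_cons, List.length_nil]
        omega
      · simp [mul_assoc]
  intro L hL hlen
  ext b
  have hb := key L hL b
  refine (Submodule.mem_bot k).1 (Submodule.span_le.2 ?_ hb)
  rintro _ ⟨v, w, hv, hw, hvw, rfl⟩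
  rcases le_or_gt N v.length with h1 | h1
  · simp [h v hv h1]
  · simp [h w hw (by omega)]

theorem commute_mulLeft_neg_mulRight (a : A) :
    Commute (LinearMap.mulLeft k a : Module.End k A) (-LinearMap.mulRight k a) :=
  Commute.neg_right (a := (LinearMap.mulLeft k a : Module.End k A))
    (LinearMap.commute_mulLeft_right a a)

theorem isNilpotent_adL {a : A} (h : IsNilpotent a) : IsNilpotent (adL k a) := by
  rw [adL_eq]
  exact (commute_mulLeft_neg_mulRight k a).isNilpotent_add
    (isNilpotent_mulLeft k h) (isNilpotent_mulRight k h).neg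

variable [CharZero k]

theorem nexp_mul_nexp_sub_one_eq (h : WordsVanish x y (N + 1)) :
    nexp k x * nexp k y - 1 = ∑ q ∈ (range (N + 1) ×ˢ range (N + 1)).erase (0, 0),
      ((q.1.factorial * q.2.factorial : ℕ) : k)⁻¹ • (x ^ q.1 * y ^ q.2) := by
  have e := add_sum_erase (range (N + 1) ×ˢ range (N + 1))
    (fun q => ((q.1.factorial * q.2.factorial : ℕ) : k)⁻¹ • (x ^ q.1 * y ^ q.2))
    (mk_mem_product (mem_range.2 N.succ_pos) (mem_range.2 N.succ_pos))
  rw [nexp_eq_sum k h.pow_left, nexp_eq_sum k h.pow_right, sum_mul_sum, ← sum_product',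
    sub_eq_iff_eq_add']
  refine (sum_congr rfl fun q _ => ?_).trans (e.symm.trans (by simp))
  rw [smul_mul_smul_comm, Nat.cast_mul, mul_inv]

theorem nexp_mul_nexp_sub_one_pow (h : WordsVanish x y (N + 1)) (m : ℕ) :
    (nexp k x * nexp k y - 1) ^ m =
      ∑ l ∈ listsOf ((range (N + 1) ×ˢ range (N + 1)).erase (0, 0)) m,
        (((l.map fun p => p.1.factorial * p.2.factorial).prod : ℕ) : k)⁻¹ •
          (bchWord x y l).prod := by
  rw [nexp_mul_nexp_sub_one_eq k h, sum_pow_eq_sum_lists]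
  refine sum_congr rfl fun l hl => ?_
  clear hl
  induction l with
  | nil => simp [bchWord]
  | cons q l ih =>
    rw [List.map_cons, List.prod_cons, ih, smul_mul_smul_comm]
    simp [bchWord, mul_assoc, mul_comm]

theorem nexp_mul_nexp_sub_one_pow_eq_zero (h : WordsVanish x y (N + 1)) :
    (nexp k x * nexp k y - 1) ^ (N + 1) = 0 := by
  rw [nexp_mul_nexp_sub_one_pow k h]
  refine sum_eq_zero fun l hl => ?_
  rw [mem_listsOf] at hl
  rw [h.bchWord, smul_zero]
  rw [← hl.1]
  exact length_le_bchDeg fun h0 => by simpa using hl.2 _ h0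

/-- The expansion of `log (exp x * exp y)` in words. -/
theorem nlog_nexp_mul_nexp (h : WordsVanish x y (N + 1)) :
    nlog k (nexp k x * nexp k y - 1) =
      ∑ l ∈ bchIndex N, logCoeff k l • (bchWord x y l).prod := by
  set Q := (range (N + 1) ×ˢ range (N + 1)).erase (0, 0) with hQ
  have hQ0 : ∀ l : List (ℕ × ℕ), (∀ q ∈ l, q ∈ Q) → (0, 0) ∉ l := fun l hl h0 => by
    simpa [hQ] using hl _ h0
  rw [nlog_eq_sum k (nexp_mul_nexp_sub_one_pow_eq_zero k h)]
  have e : ∀ m ∈ range (N + 1), ((-1) ^ (m + 1) / (m : k)) • (nexp k x * nexp k y - 1) ^ m =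
      ∑ l ∈ listsOf Q m, logCoeff k l • (bchWord x y l).prod := by
    intro m _
    rw [nexp_mul_nexp_sub_one_pow k h, smul_sum]
    refine sum_congr rfl fun l hl => ?_
    rw [logCoeff, (mem_listsOf.1 hl).1, smul_smul]
  rw [sum_congr rfl e, ← sum_biUnion]
  · refine (sum_subset ?_ ?_).symm
    · intro l hl
      obtain ⟨h1, h2, h3⟩ := mem_bchIndex.1 hl
      rw [mem_biUnion]
      refine ⟨l.length, mem_range.2 (by have := length_le_bchDeg h2; omega), ?_⟩
      refine mem_listsOf.2 ⟨rfl, fun q hq => ?_⟩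
      have := le_bchDeg hq
      rw [hQ, mem_erase, mem_product, mem_range, mem_range]
      exact ⟨fun h0 => h2 (h0 ▸ hq), by omega, by omega⟩
    · intro l hl hl'
      obtain ⟨m, _, hm⟩ := mem_biUnion.1 hl
      by_cases h1 : l = []
      · simp [h1, logCoeff]
      · rw [h.bchWord, smul_zero]
        by_contra hlt
        exact hl' (mem_bchIndex.2 ⟨h1, hQ0 l (mem_listsOf.1 hm).2, by omega⟩)
  · intro m _ m' _ hne
    rw [Function.onFun, disjoint_left]
    intro l hl hl'
    exact hne ((mem_listsOf.1 hl).1.symm.trans (mem_listsOf.1 hl').1)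

theorem nexp_mulLeft {a : A} (h : IsNilpotent a) :
    nexp k (LinearMap.mulLeft k a) = LinearMap.mulLeft k (nexp k a) :=
  (map_nexp k (Algebra.lmul k A) h).symm

theorem nexp_mulRight {a : A} (h : IsNilpotent a) :
    nexp k (LinearMap.mulRight k a) = LinearMap.mulRight k (nexp k a) := by
  obtain ⟨N, h⟩ := h
  rw [nexp_eq_sum k h, nexp_eq_sum k (N := N) (by rw [LinearMap.pow_mulRight, h]; simp)]
  ext b
  simp [LinearMap.pow_mulRight, mul_sum]

/-- `exp (ad a)` is conjugation by `exp a`. -/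
theorem nexp_adL {a : A} (h : IsNilpotent a) (b : A) :
    nexp k (adL k a) b = nexp k a * b * nexp k (-a) := by
  have e : -LinearMap.mulRight k a = LinearMap.mulRight k (-a) := by ext; simp
  rw [adL_eq, nexp_add_of_commute k (commute_mulLeft_neg_mulRight k a)
    (isNilpotent_mulLeft k h) (isNilpotent_mulRight k h).neg, e, nexp_mulLeft k h,
    nexp_mulRight k h.neg]
  simp [mul_assoc]

theorem WordsVanish.isNilpotent_left (h : WordsVanish x y N) : IsNilpotent x := ⟨N, h.pow_left⟩

theorem WordsVanish.isNilpotent_right (h : WordsVanish x y N) : IsNilpotent y := ⟨N, h.pow_right⟩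

theorem WordsVanish.isNilpotent_nexp_mul (h : WordsVanish x y N) :
    IsNilpotent (nexp k x * nexp k y - 1) :=
  ⟨N + 1, nexp_mul_nexp_sub_one_pow_eq_zero k (h.mono N.le_succ)⟩

theorem nexp_neg_nlog_nexp_mul (h : WordsVanish x y N) :
    nexp k (-nlog k (nexp k x * nexp k y - 1)) = nexp k (-y) * nexp k (-x) := by
  have hu := h.isNilpotent_nexp_mul k
  have h1 := nexp_neg_mul_nexp k (isNilpotent_nlog k hu)
  rw [nexp_nlog k hu, add_sub_cancel] at h1
  have h2 : nexp k x * nexp k y * (nexp k (-y) * nexp k (-x)) = 1 := by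
    rw [mul_assoc, ← mul_assoc (nexp k y), nexp_mul_nexp_neg k h.isNilpotent_right, one_mul,
      nexp_mul_nexp_neg k h.isNilpotent_left]
  exact left_inv_eq_right_inv h1 h2

theorem nexp_adL_mul_nexp_adL (h : WordsVanish x y N) :
    nexp k (adL k x) * nexp k (adL k y) =
      nexp k (adL k (nlog k (nexp k x * nexp k y - 1))) := by
  have hu := h.isNilpotent_nexp_mul k
  ext b
  rw [Module.End.mul_apply, nexp_adL k h.isNilpotent_left, nexp_adL k h.isNilpotent_right,
    nexp_adL k (isNilpotent_nlog k hu), nexp_neg_nlog_nexp_mul k h, nexp_nlog k hu,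
    add_sub_cancel]
  simp only [mul_assoc]

/-- Dynkin's identity in the presence of an element `E` with `[E, x] = x` and `[E, y] = y`: apply
`log (exp (ad x) * exp (ad y)) = ad (log (exp x * exp y))` to `E`. -/
theorem sum_logCoeff_smul_nestedComm {E : A} (hx : E * x - x * E = x) (hy : E * y - y * E = y)
    (h : WordsVanish x y (N + 1)) :
    ∑ l ∈ bchIndex (2 * N + 1), (logCoeff k l * bchDeg l) • (bchWord x y l).prod =
      ∑ l ∈ bchIndex (2 * N + 1), logCoeff k l • nestedComm (bchWord x y l) := by
  have hE : ∀ l : List (ℕ × ℕ), ∀ a ∈ bchWord x y l, E * a - a * E = a := by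
    intro l a ha
    rcases mem_bchWord ha with rfl | rfl
    exacts [hx, hy]
  have hu := h.isNilpotent_nexp_mul k
  have h1 : WordsVanish (adL k x) (adL k y) (2 * N + 1 + 1) := (h.adL k).mono (by omega)
  have h2 := nlog_nexp_mul_nexp k h1
  rw [nexp_adL_mul_nexp_adL k h, nlog_nexp k (isNilpotent_adL k (isNilpotent_nlog k hu)),
    nlog_nexp_mul_nexp k (h.mono (by omega : N + 1 ≤ 2 * N + 1 + 1))] at h2
  have h3 := congrArg (fun f => -f E) h2
  simp only [LinearMap.sum_apply, LinearMap.smul_apply, adL_apply, neg_sub] at h3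
  rw [mul_sum, sum_mul, ← sum_sub_distrib, ← sum_neg_distrib] at h3
  refine Eq.trans (sum_congr rfl fun l _ => ?_) (h3.trans (sum_congr rfl fun l hl => ?_))
  · rw [mul_smul_comm, smul_mul_assoc, ← smul_sub, commutator_list_prod (hE l), length_bchWord,
      mul_smul, ← nsmul_eq_mul, Nat.cast_smul_eq_nsmul]
  · rw [← map_bchWord, adL_list_prod k (hE l), smul_neg, neg_neg]
    have h4 := bchDeg_pos (mem_bchIndex.1 hl).1 (mem_bchIndex.1 hl).2.1
    rintro h5
    have h6 := length_bchWord x y l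
    rw [h5] at h6
    exact h4.ne h6

open Polynomial in
/-- Dynkin's formula in an associative algebra. The element `E` needed for
`sum_logCoeff_smul_nestedComm` is the Euler operator `X * d/dX` on `A[X]`, acting on the
multiplications by `X * x` and `X * y`. -/
theorem sum_logCoeff_smul_word (h : WordsVanish x y (N + 1)) :
    ∑ l ∈ bchIndex (2 * N + 1), logCoeff k l • (bchWord x y l).prod =
      ∑ l ∈ bchIndex (2 * N + 1), bchCoeff k l • nestedComm (bchWord x y l) := by
  let f : A → Module.End k A[X] := fun a => LinearMap.mulLeft k (monomial 1 a)
  -- the Euler operator `X * d/dX`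
  let E : Module.End k A[X] :=
    (LinearMap.mulLeft k (X : A[X])).comp ((Polynomial.derivative (R := A)).restrictScalars k)
  have hfE : ∀ a, E * f a - f a * E = f a := by
    intro a
    ext p : 1
    have e : X * derivative (monomial 1 a * p) - monomial 1 a * (X * derivative p) =
        monomial 1 a * p := by
      rw [derivative_mul, mul_add, ← mul_assoc X (monomial 1 a), (commute_X (monomial 1 a)).eq,
        mul_assoc (monomial 1 a) X, add_sub_cancel_right, derivative_monomial, ← mul_assoc,
        X_mul_monomial]
      simp
    exact e
  have hprod : ∀ L : List A, (L.map f).prod = LinearMap.mulLeft k (monomial L.length L.prod) := by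
    intro L
    induction L with
    | nil => ext; simp
    | cons a L ih =>
      rw [List.map_cons, List.prod_cons, ih, List.length_cons, List.prod_cons]
      ext p : 1
      simp only [f, Module.End.mul_apply, LinearMap.mulLeft_apply]
      rw [← mul_assoc, monomial_mul_monomial, add_comm]
  have hnest : ∀ L : List A, nestedComm (L.map f) =
      LinearMap.mulLeft k (monomial L.length (nestedComm L)) := by
    intro L
    induction L with
    | nil => ext; simp [nestedComm]
    | cons a L ih =>
      cases L with
      | nil => rfl
      | cons b L =>
        simp only [List.map_cons] at ih ⊢
        rw [nestedComm, ih, nestedComm]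
        ext p : 1
        simp only [f, Module.End.mul_apply, LinearMap.sub_apply, LinearMap.mulLeft_apply]
        rw [← mul_assoc, ← mul_assoc, ← sub_mul, monomial_mul_monomial, monomial_mul_monomial,
          add_comm 1, ← map_sub]
        rfl
  -- a word in `f x`, `f y` is the image of the word in `x`, `y` with the corresponding letters
  have hf : WordsVanish (f x) (f y) (N + 1) := by
    classical
    intro L hL hlen
    let g : Module.End k A[X] → A := fun z => if z = f x then x else y
    have hg : ∀ z ∈ L, f (g z) = z ∧ (g z = x ∨ g z = y) := by
      intro z hz
      by_cases hzx : z = f x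
      · simp [g, hzx]
      · rcases hL z hz with h' | h'
        · exact absurd h' hzx
        · simp only [g, if_neg hzx]
          exact ⟨h'.symm, by simp⟩
    have e : L = (L.map g).map f := by
      rw [List.map_map]
      exact ((List.map_congr_left fun z hz => (hg z hz).1).trans (List.map_id L)).symm
    rw [e, hprod, h (L.map g) ?_ (by simpa using hlen)]
    · simp
    · intro a ha
      obtain ⟨z, hz, rfl⟩ := List.mem_map.1 ha
      exact (hg z hz).2
  have key := sum_logCoeff_smul_nestedComm k (hfE x) (hfE y) hf
  simp only [← map_bchWord, hprod, hnest, length_bchWord] at key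
  have key1 := congrArg (fun φ : Module.End k A[X] => φ 1) key
  simp only [LinearMap.sum_apply, LinearMap.smul_apply, LinearMap.mulLeft_apply, mul_one] at key1
  -- the functional `X ^ n * a ↦ a / n`
  let J : A[X] →ₗ[k] A :=
    { toFun := fun p => p.sum fun n a => (n : k)⁻¹ • a
      map_add' := fun p q => sum_add_index p q _ (by simp) (by simp [smul_add])
      map_smul' := fun c p => by
        rw [sum_smul_index' _ _ _ (by simp), RingHom.id_apply, Polynomial.sum, Polynomial.sum,
          smul_sum]
        simp only [smul_comm c] }
  have hJ : ∀ n a, J (monomial n a) = (n : k)⁻¹ • a := fun n a => sum_monomial_index a _ (by simp)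
  have key2 := congrArg J key1
  simp only [map_sum, map_smul, hJ, smul_smul] at key2
  refine Eq.trans (sum_congr rfl fun l hl => ?_) (key2.trans (sum_congr rfl fun l hl => ?_))
  · have := bchDeg_pos (mem_bchIndex.1 hl).1 (mem_bchIndex.1 hl).2.1
    rw [mul_assoc, mul_inv_cancel₀ (by exact_mod_cast this.ne'), mul_one]
  · rw [bchCoeff_eq, mul_comm]

/-- `exp` of Dynkin's series is `exp x * exp y`. -/
theorem nexp_dynkin (h : WordsVanish x y (N + 1)) :
    _root_.IsNilpotent (∑ l ∈ bchIndex (2 * N + 1), bchCoeff k l • nestedComm (bchWord x y l)) ∧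
      nexp k (∑ l ∈ bchIndex (2 * N + 1), bchCoeff k l • nestedComm (bchWord x y l)) =
        nexp k x * nexp k y := by
  have hu := h.isNilpotent_nexp_mul k
  rw [← sum_logCoeff_smul_word k h,
    ← nlog_nexp_mul_nexp k (h.mono (by omega : N + 1 ≤ 2 * N + 1 + 1))]
  exact ⟨isNilpotent_nlog k hu, by rw [nexp_nlog k hu, add_sub_cancel]⟩

end Dynkin

/-! ### The contraction of the simplex onto a vertex -/

namespace PolyForms

open Polynomial (monomial)

variable {k : Type u} [Field k] {n : ℕ}

/-- The value of the coordinate `t j` at the vertex `v`. -/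
def vtx {B : Type*} [Zero B] [One B] (v j : Fin (n + 1)) : B := if j = v then 1 else 0

theorem sum_vtx {B : Type*} [Semiring B] (v : Fin (n + 1)) :
    ∑ j, (vtx v j : B) = 1 := by simp [vtx]

theorem vtx_mul {B : Type*} [Semiring B] (v j : Fin (n + 1)) (b : B) :
    vtx v j * b = b * vtx v j := by
  unfold vtx
  split_ifs <;> simp

theorem map_vtx {B C F : Type*} [Semiring B] [Semiring C] [FunLike F B C] [RingHomClass F B C]
    (f : F) (v j : Fin (n + 1)) : f (vtx v j) = vtx v j := by
  unfold vtx
  split_ifs <;> simp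

/-- Evaluation of a form at the vertex `v`. -/
def evalVertex (v : Fin (n + 1)) : Alg k n →ₐ[k] k :=
  lift (vtx v) 0 (fun _ _ => mul_comm _ _) (by simp) (by simp) (sum_vtx v) (by simp)

@[simp]
theorem evalVertex_t (v j : Fin (n + 1)) : evalVertex v (t j : Alg k n) = vtx v j := lift_t ..

@[simp]
theorem evalVertex_dt (v j : Fin (n + 1)) : evalVertex v (dt j : Alg k n) = 0 := lift_dt ..

theorem parity_parity (ω : Alg k n) : parity n (parity n ω) = ω := by
  have : (parity n).comp (parity n) = AlgHom.id k (Alg k n) := algHom_ext (by simp) (by simp)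
  exact DFunLike.congr_fun this ω

theorem d_algebraMap (c : k) : d n (algebraMap k (Alg k n) c) = 0 := by
  rw [Algebra.algebraMap_eq_smul_one, map_smul, d_one, smul_zero]

theorem d_parity (ω : Alg k n) : d n (parity n ω) = -parity n (d n ω) := by
  refine alg_induction (P := fun ω => d n (parity n ω) = -parity n (d n ω)) ?_ ?_ ?_ ?_ ?_ ω
  · intro c
    rw [AlgHom.commutes, d_algebraMap, map_zero, neg_zero]
  · intro i; simp
  · intro i; simp
  · intro x y h1 h2
    rw [map_mul (parity n) x y, d_mul_parity, d_mul_parity, map_add, map_mul, map_mul, h1, h2]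
    noncomm_ring
  · intro x y h1 h2
    simp only [map_add, h1, h2, neg_add]

/-- The algebra map `ω ↦ !![parity ω, κ ω; 0, ω]`, where `κ` is the contraction with the Euler
vector field at the vertex `v`. That it is multiplicative says that `κ` is an odd derivation, so `κ`
can be defined on generators. -/
def contractMatrix (v : Fin (n + 1)) : Alg k n →ₐ[k] Matrix (Fin 2) (Fin 2) (Alg k n) :=
  lift (fun i => !![t i, 0; 0, t i]) (fun i => !![-dt i, t i - vtx v i; 0, dt i])
    (fun i j => by
      simp [t_mul_t i j])
    (fun i j => by
      simp [t_mul_dt, mul_sub, sub_mul, t_mul_t i j, vtx_mul])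
    (fun i j => by
      ext a b
      fin_cases a <;> fin_cases b <;>
        simp [dt_mul_dt i j, mul_sub, sub_mul, t_mul_dt, vtx_mul])
    (by
      ext a b
      fin_cases a <;> fin_cases b <;> simp [Matrix.sum_apply, sum_t])
    (by
      ext a b
      fin_cases a <;> fin_cases b <;> simp [Matrix.sum_apply, sum_dt, sum_t, sum_vtx])

/-- The contraction `κ` with the Euler vector field at the vertex `v`, whose flow is the linear
contraction of the simplex onto `v`. -/
def contract (v : Fin (n + 1)) : Alg k n →ₗ[k] Alg k n :=
  (Matrix.entryLinearMap k (Alg k n) 0 1).comp (contractMatrix v).toLinearMap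

theorem contractMatrix_eq (v : Fin (n + 1)) (ω : Alg k n) :
    contractMatrix v ω = !![parity n ω, contract v ω; 0, ω] := by
  have key : contractMatrix v ω 0 0 = parity n ω ∧ contractMatrix v ω 1 0 = 0 ∧
      contractMatrix v ω 1 1 = ω := by
    refine alg_induction (P := fun ω => contractMatrix v ω 0 0 = parity n ω ∧
      contractMatrix v ω 1 0 = 0 ∧ contractMatrix v ω 1 1 = ω) ?_ ?_ ?_ ?_ ?_ ω
    · intro c
      rw [AlgHom.commutes, AlgHom.commutes]
      simp [Matrix.algebraMap_matrix_apply]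
    · intro i; simp [contractMatrix, parity]
    · intro i; simp [contractMatrix, parity]
    · rintro x y ⟨h1, h2, h3⟩ ⟨h4, h5, h6⟩
      rw [map_mul, map_mul]
      simp [Matrix.mul_apply, Fin.sum_univ_two, h1, h2, h3, h4, h5, h6]
    · rintro x y ⟨h1, h2, h3⟩ ⟨h4, h5, h6⟩
      rw [map_add, map_add]
      simp [h1, h2, h3, h4, h5, h6]
  ext a b
  fin_cases a <;> fin_cases b
  · exact key.1
  · rfl
  · exact key.2.1
  · exact key.2.2

theorem contract_mul (v : Fin (n + 1)) (x y : Alg k n) :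
    contract v (x * y) = contract v x * y + parity n x * contract v y := by
  have h : contract v (x * y) = contractMatrix v (x * y) 0 1 := rfl
  rw [h, map_mul, contractMatrix_eq, contractMatrix_eq]
  simp [Matrix.mul_apply, Fin.sum_univ_two, add_comm]

@[simp]
theorem contract_t (v i : Fin (n + 1)) : contract v (t i : Alg k n) = 0 := by
  simp [contract, contractMatrix]

@[simp]
theorem contract_dt (v i : Fin (n + 1)) : contract v (dt i : Alg k n) = t i - vtx v i := by
  simp [contract, contractMatrix]

theorem contract_algebraMap (v : Fin (n + 1)) (c : k) :
    contract v (algebraMap k (Alg k n) c) = 0 := by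
  have h : contract v (1 : Alg k n) = 0 := by simpa using contract_mul v (1 : Alg k n) 1
  rw [Algebra.algebraMap_eq_smul_one, map_smul, h, smul_zero]

theorem contract_parity (v : Fin (n + 1)) (ω : Alg k n) :
    contract v (parity n ω) = -parity n (contract v ω) := by
  refine alg_induction (P := fun ω => contract v (parity n ω) = -parity n (contract v ω))
    ?_ ?_ ?_ ?_ ?_ ω
  · intro c
    rw [AlgHom.commutes, contract_algebraMap, map_zero, neg_zero]
  · intro i; simp
  · intro i; simp [map_vtx]
  · intro x y h1 h2
    rw [map_mul (parity n) x y, contract_mul, contract_mul, map_add, map_mul, map_mul, h1, h2]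
    noncomm_ring
  · intro x y h1 h2
    simp only [map_add, h1, h2, neg_add]

theorem contract_contract (v : Fin (n + 1)) (ω : Alg k n) : contract v (contract v ω) = 0 := by
  refine alg_induction (P := fun ω => contract v (contract v ω) = 0) ?_ ?_ ?_ ?_ ?_ ω
  · intro c
    rw [contract_algebraMap, map_zero]
  · intro i; simp
  · intro i
    have := contract_algebraMap (n := n) v (vtx v i : k)
    rw [map_vtx] at this
    simp [this]
  · intro x y h1 h2
    rw [contract_mul, map_add, contract_mul, contract_mul, h1, h2, contract_parity,
      parity_parity]
    noncomm_ring
  · intro x y h1 h2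
    rw [map_add, map_add, h1, h2, add_zero]

theorem evalVertex_contract (v : Fin (n + 1)) (ω : Alg k n) :
    evalVertex v (contract v ω) = 0 := by
  refine alg_induction (P := fun ω => evalVertex v (contract v ω) = 0) ?_ ?_ ?_ ?_ ?_ ω
  · intro c
    rw [contract_algebraMap, map_zero]
  · intro i; simp
  · intro i; simp [map_vtx]
  · intro x y h1 h2
    rw [contract_mul, map_add, map_mul, map_mul, h1, h2, zero_mul, mul_zero, add_zero]
  · intro x y h1 h2
    rw [map_add, map_add, h1, h2, add_zero]

/-- The Lie derivative along the Euler vector field at `v`. -/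
def euler (v : Fin (n + 1)) : Alg k n →ₗ[k] Alg k n :=
  (d n).comp (contract v) + (contract v).comp (d n)

theorem euler_apply (v : Fin (n + 1)) (ω : Alg k n) :
    euler v ω = d n (contract v ω) + contract v (d n ω) := rfl

theorem euler_mul (v : Fin (n + 1)) (x y : Alg k n) :
    euler v (x * y) = euler v x * y + x * euler v y := by
  simp only [euler_apply, contract_mul, d_mul_parity, map_add, d_parity, contract_parity,
    parity_parity]
  noncomm_ring

/-- The pullback of forms along the scaling with factor `X` and centre `v`. -/
def scale (v : Fin (n + 1)) : Alg k n →ₐ[k] Polynomial (Alg k n) :=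
  lift (fun i => monomial 0 (vtx v i) + monomial 1 (t i - vtx v i)) (fun i => monomial 1 (dt i))
    (fun i j => by
      simp only [mul_add, add_mul, Polynomial.monomial_mul_monomial, mul_sub, sub_mul,
        t_mul_t i j, vtx_mul v i]
      simp only [← vtx_mul v j, add_zero, zero_add, map_sub]
      abel)
    (fun i j => by
      simp only [mul_add, add_mul, Polynomial.monomial_mul_monomial, mul_sub, sub_mul, t_mul_dt,
        vtx_mul, zero_add, add_zero])
    (fun i j => by
      simp only [Polynomial.monomial_mul_monomial, dt_mul_dt i j, map_neg])
    (by
      rw [Finset.sum_add_distrib, ← map_sum, ← map_sum, Finset.sum_sub_distrib, sum_t, sum_vtx,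
        sub_self, map_zero, add_zero]
      rfl)
    (by rw [← map_sum, sum_dt, map_zero])

@[simp]
theorem scale_t (v i : Fin (n + 1)) : scale v (t i : Alg k n) =
    monomial 0 (vtx v i) + monomial 1 (t i - vtx v i) := lift_t ..

@[simp]
theorem scale_dt (v i : Fin (n + 1)) : scale v (dt i : Alg k n) = monomial 1 (dt i) := lift_dt ..

/-- The component of weight `m` of a form with respect to scaling with centre `v`: the coefficient of
`X ^ m` in its pullback. -/
def wtComp (v : Fin (n + 1)) (m : ℕ) : Alg k n →ₗ[k] Alg k n :=
  ((Polynomial.lcoeff (Alg k n) m).restrictScalars k).comp (scale v).toLinearMap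

theorem wtComp_apply (v : Fin (n + 1)) (m : ℕ) (ω : Alg k n) :
    wtComp v m ω = (scale v ω).coeff m := rfl

theorem wtComp_mul (v : Fin (n + 1)) (m : ℕ) (x y : Alg k n) :
    wtComp v m (x * y) =
      ∑ p ∈ Finset.HasAntidiagonal.antidiagonal m, wtComp v p.1 x * wtComp v p.2 y := by
  simp only [wtComp_apply, map_mul, Polynomial.coeff_mul]

theorem wtComp_algebraMap (v : Fin (n + 1)) (m : ℕ) (c : k) :
    wtComp v m (algebraMap k (Alg k n) c) = if m = 0 then algebraMap k (Alg k n) c else 0 := by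
  rw [wtComp_apply, AlgHom.commutes, Polynomial.algebraMap_apply, Polynomial.coeff_C]

theorem wtComp_t (v i : Fin (n + 1)) (m : ℕ) : wtComp v m (t i : Alg k n) =
    (if 0 = m then vtx v i else 0) + if 1 = m then t i - vtx v i else 0 := by
  rw [wtComp_apply, scale_t, Polynomial.coeff_add, Polynomial.coeff_monomial,
    Polynomial.coeff_monomial]

theorem wtComp_dt (v i : Fin (n + 1)) (m : ℕ) : wtComp v m (dt i : Alg k n) =
    if 1 = m then dt i else 0 := by
  rw [wtComp_apply, scale_dt, Polynomial.coeff_monomial]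

theorem wtComp_parity (v : Fin (n + 1)) (m : ℕ) (ω : Alg k n) :
    wtComp v m (parity n ω) = parity n (wtComp v m ω) := by
  refine alg_induction (P := fun ω => ∀ m, wtComp v m (parity n ω) = parity n (wtComp v m ω))
    ?_ ?_ ?_ ?_ ?_ ω m
  · intro c m
    rw [AlgHom.commutes, wtComp_algebraMap]
    split_ifs <;> simp
  · intro i m
    rw [parity_t, wtComp_t]
    split_ifs <;> simp [map_vtx]
  · intro i m
    rw [parity_dt, map_neg, wtComp_dt]
    split_ifs <;> simp
  · intro x y h1 h2 m
    simp only [map_mul, wtComp_mul, map_sum, h1, h2]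
  · intro x y h1 h2 m
    simp only [map_add, h1, h2]

theorem vtx_eq_algebraMap (v i : Fin (n + 1)) :
    (vtx v i : Alg k n) = algebraMap k (Alg k n) (vtx v i) := (map_vtx _ v i).symm

theorem wtComp_d (v : Fin (n + 1)) (m : ℕ) (ω : Alg k n) :
    wtComp v m (d n ω) = d n (wtComp v m ω) := by
  refine alg_induction (P := fun ω => ∀ m, wtComp v m (d n ω) = d n (wtComp v m ω))
    ?_ ?_ ?_ ?_ ?_ ω m
  · intro c m
    rw [d_algebraMap, wtComp_algebraMap]
    split_ifs <;> simp [d_algebraMap]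
  · intro i m
    rw [d_t, wtComp_t, wtComp_dt, vtx_eq_algebraMap]
    split_ifs <;> simp [d_algebraMap]
  · intro i m
    rw [d_dt, wtComp_dt]
    split_ifs <;> simp
  · intro x y h1 h2 m
    simp only [d_mul_parity, map_add, wtComp_mul, map_sum, h1, h2, wtComp_parity,
      Finset.sum_add_distrib]
  · intro x y h1 h2 m
    simp only [map_add, h1, h2]

theorem wtComp_contract (v : Fin (n + 1)) (m : ℕ) (ω : Alg k n) :
    wtComp v m (contract v ω) = contract v (wtComp v m ω) := by
  refine alg_induction
    (P := fun ω => ∀ m, wtComp v m (contract v ω) = contract v (wtComp v m ω)) ?_ ?_ ?_ ?_ ?_ ω m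
  · intro c m
    rw [contract_algebraMap, wtComp_algebraMap]
    split_ifs <;> simp [contract_algebraMap]
  · intro i m
    rw [contract_t, wtComp_t, vtx_eq_algebraMap]
    split_ifs <;> simp [contract_algebraMap]
  · intro i m
    rw [contract_dt, map_sub, wtComp_dt, wtComp_t, vtx_eq_algebraMap, wtComp_algebraMap]
    split_ifs <;> first | omega | simp [vtx_eq_algebraMap]
  · intro x y h1 h2 m
    simp only [contract_mul, map_add, wtComp_mul, map_sum, h1, h2, wtComp_parity,
      Finset.sum_add_distrib]
  · intro x y h1 h2 m
    simp only [map_add, h1, h2]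

/-- The Lie derivative along the Euler vector field is multiplication by the weight. -/
theorem wtComp_euler (v : Fin (n + 1)) (m : ℕ) (ω : Alg k n) :
    wtComp v m (euler v ω) = (m : k) • wtComp v m ω := by
  refine alg_induction
    (P := fun ω => ∀ m, wtComp v m (euler v ω) = (m : k) • wtComp v m ω) ?_ ?_ ?_ ?_ ?_ ω m
  · intro c m
    rw [euler_apply, contract_algebraMap, d_algebraMap, wtComp_algebraMap]
    split_ifs with h <;> simp [h]
  · intro i m
    rw [euler_apply, contract_t, d_t, contract_dt, map_zero, zero_add, map_sub, wtComp_t,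
      vtx_eq_algebraMap, wtComp_algebraMap]
    rcases m with _ | _ | m <;> simp
  · intro i m
    rw [euler_apply, d_dt, contract_dt, map_zero, add_zero, map_sub, d_t, vtx_eq_algebraMap,
      d_algebraMap, sub_zero, wtComp_dt]
    split_ifs with h
    · simp [← h]
    · simp
  · intro x y h1 h2 m
    simp only [euler_mul, map_add, wtComp_mul, h1, h2, Finset.smul_sum]
    rw [← Finset.sum_add_distrib]
    refine Finset.sum_congr rfl fun p hp => ?_
    rw [smul_mul_assoc, mul_smul_comm, ← add_smul, ← Nat.cast_add,
      Finset.HasAntidiagonal.mem_antidiagonal.1 hp]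
  · intro x y h1 h2 m
    simp only [map_add, h1, h2, smul_add]

/-- The component of weight `0` is the value at `v`, since scaling with factor `0` collapses the
simplex to `v`. -/
theorem wtComp_zero (v : Fin (n + 1)) (ω : Alg k n) :
    wtComp v 0 ω = algebraMap k (Alg k n) (evalVertex v ω) := by
  refine alg_induction (P := fun ω => wtComp v 0 ω = algebraMap k (Alg k n) (evalVertex v ω))
    ?_ ?_ ?_ ?_ ?_ ω
  · intro c
    rw [wtComp_algebraMap, AlgHom.commutes]
    simp
  · intro i
    rw [wtComp_t, evalVertex_t, ← vtx_eq_algebraMap]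
    simp
  · intro i
    rw [wtComp_dt, evalVertex_dt]
    simp
  · intro x y h1 h2
    rw [wtComp_mul]
    simp [h1, h2]
  · intro x y h1 h2
    simp only [map_add, h1, h2]

theorem wtComp_finite (v : Fin (n + 1)) (ω : Alg k n) {N : ℕ} (hN : (scale v ω).natDegree < N)
    {m : ℕ} (hm : N ≤ m) : wtComp v m ω = 0 :=
  Polynomial.coeff_eq_zero_of_natDegree_lt (hN.trans_le hm)

/-- The components sum to the form, since scaling with factor `1` is the identity. -/
theorem sum_wtComp (v : Fin (n + 1)) (ω : Alg k n) {N : ℕ} (hN : (scale v ω).natDegree < N) :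
    ∑ m ∈ Finset.range N, wtComp v m ω = ω := by
  have h : ∀ ω : Alg k n, (scale v ω).eval 1 = ω := by
    refine alg_induction ?_ ?_ ?_ ?_ ?_
    · intro c
      rw [AlgHom.commutes, Polynomial.algebraMap_apply, Polynomial.eval_C]
    · intro i; simp
    · intro i; simp
    · intro x y h1 h2
      rw [map_mul, Polynomial.eval, Polynomial.eval₂_mul_noncomm _ _ fun _ => Commute.one_right _]
      exact congrArg₂ (· * ·) h1 h2
    · intro x y h1 h2
      rw [map_add, Polynomial.eval_add, h1, h2]
  have := h ω
  rw [Polynomial.eval_eq_sum_range' hN] at this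
  simpa [wtComp_apply] using this

/-- The inverse of `euler v` on the forms without component of weight `0`. The component of weight
`0` is discarded, since `(0 : k)⁻¹ = 0`. -/
def invEuler (v : Fin (n + 1)) : Alg k n →ₗ[k] Alg k n where
  toFun ω := ∑ᶠ m : ℕ, (m : k)⁻¹ • wtComp v m ω
  map_add' x y := by
    rw [← finsum_add_distrib]
    · simp
    · refine (Set.finite_lt_nat ((scale v x).natDegree + 1)).subset fun m hm => ?_
      by_contra h
      exact hm (by simp only [wtComp_finite v x (Nat.lt_succ_self _) (not_lt.1 h), smul_zero])
    · refine (Set.finite_lt_nat ((scale v y).natDegree + 1)).subset fun m hm => ?_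
      by_contra h
      exact hm (by simp only [wtComp_finite v y (Nat.lt_succ_self _) (not_lt.1 h), smul_zero])
  map_smul' c x := by
    simp only [map_smul, RingHom.id_apply, smul_finsum]
    exact finsum_congr fun m => smul_comm _ _ _

theorem invEuler_eq_sum (v : Fin (n + 1)) (ω : Alg k n) {N : ℕ}
    (hN : (scale v ω).natDegree < N) :
    invEuler v ω = ∑ m ∈ Finset.range N, (m : k)⁻¹ • wtComp v m ω := by
  refine finsum_eq_sum_of_support_subset _ fun m hm => ?_
  rw [Finset.mem_coe, Finset.mem_range]
  by_contra h
  exact hm (by simp only [wtComp_finite v ω hN (not_lt.1 h), smul_zero])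

/-- `invEuler` commutes with the maps respecting weights. -/
theorem invEuler_comm {m : ℕ} {v : Fin (n + 1)} {w : Fin (m + 1)} (f : Alg k n →ₗ[k] Alg k m)
    (hf : ∀ i ω, wtComp w i (f ω) = f (wtComp v i ω)) (ω : Alg k n) :
    invEuler w (f ω) = f (invEuler v ω) := by
  rw [invEuler_eq_sum w (f ω) (N := (scale w (f ω)).natDegree + (scale v ω).natDegree + 1)
      (by omega),
    invEuler_eq_sum v ω (N := (scale w (f ω)).natDegree + (scale v ω).natDegree + 1) (by omega),
    map_sum]
  simp only [hf, map_smul]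

theorem invEuler_euler [CharZero k] (v : Fin (n + 1)) (ω : Alg k n) :
    invEuler v (euler v ω) = ω - algebraMap k (Alg k n) (evalVertex v ω) := by
  set N := (scale v (euler v ω)).natDegree + (scale v ω).natDegree with hN
  rw [invEuler_eq_sum v (euler v ω) (N := N + 1) (by omega)]
  have h := sum_wtComp v ω (N := N + 1) (by omega)
  rw [Finset.sum_range_succ'] at h ⊢
  rw [← wtComp_zero, eq_sub_iff_add_eq]
  refine Eq.trans ?_ h
  congr 1
  simp only [Nat.cast_zero, inv_zero, zero_smul, add_zero]
  refine Finset.sum_congr rfl fun m _ => ?_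
  rw [wtComp_euler, smul_smul, inv_mul_cancel₀ (Nat.cast_ne_zero.2 m.succ_ne_zero), one_smul]

/-- The homotopy between the identity and the evaluation at `v`, given by the linear contraction of
the simplex onto the vertex `v`. -/
def homotopy (v : Fin (n + 1)) : Alg k n →ₗ[k] Alg k n := (contract v).comp (invEuler v)

theorem homotopy_apply (v : Fin (n + 1)) (ω : Alg k n) :
    homotopy v ω = contract v (invEuler v ω) := rfl

/-- Cartan's formula for the Euler vector field, divided by the weight. -/
theorem d_homotopy [CharZero k] (v : Fin (n + 1)) (ω : Alg k n) :
    d n (homotopy v ω) + homotopy v (d n ω) =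
      ω - algebraMap k (Alg k n) (evalVertex v ω) := by
  rw [homotopy_apply, homotopy_apply, invEuler_comm (d n) (wtComp_d v), ← euler_apply,
    ← invEuler_euler]
  refine (invEuler_comm (euler v) (fun i x => ?_) ω).symm
  rw [euler_apply, map_add, wtComp_d, wtComp_contract, wtComp_contract, wtComp_d, euler_apply]

theorem homotopy_homotopy (v : Fin (n + 1)) (ω : Alg k n) : homotopy v (homotopy v ω) = 0 := by
  rw [homotopy_apply, homotopy_apply, invEuler_comm (contract v) (wtComp_contract v),
    contract_contract]

theorem evalVertex_homotopy (v : Fin (n + 1)) (ω : Alg k n) :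
    evalVertex v (homotopy v ω) = 0 := evalVertex_contract v _

theorem homotopy_one (v : Fin (n + 1)) : homotopy v (1 : Alg k n) = 0 := by
  have h : invEuler v (1 : Alg k n) = 0 := by
    refine finsum_eq_zero_of_forall_eq_zero fun m => ?_
    have := wtComp_algebraMap (n := n) v m (1 : k)
    rw [map_one] at this
    rw [this]
    split_ifs with h <;> simp [h]
  rw [homotopy_apply, h, map_zero]

theorem evalVertex_of_mem (v : Fin (n + 1)) {p : ℤ} (hp : p ≠ 0) {ω : Alg k n}
    (h : ω ∈ deg k n p) : evalVertex v ω = 0 := by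
  refine deg_induction (P := fun ω => evalVertex v ω = 0) ?_ (map_zero _) ?_ ?_ h
  · rintro l rfl
    clear h
    induction l with
    | nil => exact absurd rfl hp
    | cons g l ih =>
      rw [List.map_cons, List.prod_cons, map_mul]
      rcases g with i | i
      · rw [ih (by simpa [wt] using hp), mul_zero]
      · exact (congrArg (· * _) (evalVertex_dt v i)).trans (zero_mul _)
  · intro x y h1 h2
    rw [map_add, h1, h2, add_zero]
  · intro c x h1
    rw [map_smul, h1, smul_zero]

theorem evalVertex_d (v : Fin (n + 1)) (ω : Alg k n) : evalVertex v (d n ω) = 0 := by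
  have hpar : (evalVertex v).comp (parity n) = (evalVertex v : Alg k n →ₐ[k] k) :=
    algHom_ext (by simp) (by simp)
  refine alg_induction (P := fun ω => evalVertex v (d n ω) = 0) ?_ ?_ ?_ ?_ ?_ ω
  · intro c
    rw [d_algebraMap, map_zero]
  · intro i; simp
  · intro i; simp
  · intro x y h1 h2
    rw [d_mul_parity, map_add, map_mul, map_mul, h1, h2, zero_mul, mul_zero, add_zero]
  · intro x y h1 h2
    rw [map_add, map_add, h1, h2, add_zero]

theorem contract_mem (v : Fin (n + 1)) {p : ℤ} {ω : Alg k n} (h : ω ∈ deg k n p) :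
    contract v ω ∈ deg k n (p - 1) := by
  have hv : ∀ i, (vtx v i : Alg k n) ∈ deg k n 0 := fun i => by
    rw [vtx_eq_algebraMap, Algebra.algebraMap_eq_smul_one]
    exact Submodule.smul_mem _ _ (one_mem n)
  refine deg_induction (P := fun ω => contract v ω ∈ deg k n (p - 1)) ?_ (by simp) ?_ ?_ h
  · rintro l rfl
    clear h
    induction l with
    | nil =>
      have := contract_algebraMap (n := n) v (1 : k)
      rw [map_one] at this
      simp [this]
    | cons g l ih =>
      simp only [List.map_cons, List.prod_cons, List.sum_cons]
      rcases g with i | i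
      · change contract v (t i * _) ∈ deg k n (0 + _ - 1)
        rw [contract_mul, contract_t, parity_t, zero_mul, zero_add, zero_add]
        have := mul_mem (t_mem i) ih
        rwa [zero_add] at this
      · change contract v (dt i * _) ∈ deg k n (1 + _ - 1)
        rw [contract_mul, contract_dt, parity_dt]
        refine add_mem ?_ ?_
        · have := mul_mem (sub_mem (t_mem (k := k) i) (hv i)) (word_mem l rfl)
          rwa [zero_add, ← add_sub_cancel_left 1 (l.map wt).sum] at this
        · rw [neg_mul]
          refine neg_mem ?_
          rw [add_sub_assoc]
          exact mul_mem (dt_mem i) ih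
  · intro x y h1 h2
    rw [map_add]; exact add_mem h1 h2
  · intro c x h1
    rw [map_smul]; exact Submodule.smul_mem _ _ h1

theorem wtComp_mem (v : Fin (n + 1)) (m : ℕ) {p : ℤ} {ω : Alg k n} (h : ω ∈ deg k n p) :
    wtComp v m ω ∈ deg k n p := by
  have hv : ∀ i, (vtx v i : Alg k n) ∈ deg k n 0 := fun i => by
    rw [vtx_eq_algebraMap, Algebra.algebraMap_eq_smul_one]
    exact Submodule.smul_mem _ _ (one_mem n)
  refine deg_induction (P := fun ω => ∀ m, wtComp v m ω ∈ deg k n p) ?_ (by simp) ?_ ?_ h m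
  · rintro l rfl
    clear h
    induction l with
    | nil =>
      intro m
      have := wtComp_algebraMap (n := n) v m (1 : k)
      rw [map_one] at this
      simp only [List.map_nil, List.prod_nil, List.sum_nil, this]
      split_ifs
      exacts [one_mem n, zero_mem _]
    | cons g l ih =>
      intro m
      simp only [List.map_cons, List.prod_cons, List.sum_cons, wtComp_mul]
      refine sum_mem fun q _ => mul_mem ?_ (ih _)
      rcases g with i | i
      · change wtComp v _ (t i) ∈ deg k n 0
        rw [wtComp_t]
        refine add_mem ?_ ?_ <;> split_ifs
        exacts [hv i, zero_mem _, sub_mem (t_mem i) (hv i), zero_mem _]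
      · change wtComp v _ (dt i) ∈ deg k n 1
        rw [wtComp_dt]
        split_ifs
        exacts [dt_mem i, zero_mem _]
  · intro x y h1 h2 m
    rw [map_add]; exact add_mem (h1 m) (h2 m)
  · intro c x h1 m
    rw [map_smul]; exact Submodule.smul_mem _ _ (h1 m)

theorem homotopy_mem (v : Fin (n + 1)) {p : ℤ} {ω : Alg k n} (h : ω ∈ deg k n p) :
    homotopy v ω ∈ deg k n (p - 1) := by
  refine contract_mem v ?_
  rw [invEuler_eq_sum v ω (Nat.lt_succ_self _)]
  exact sum_mem fun m _ => Submodule.smul_mem _ _ (wtComp_mem v m h)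

/-! ### Naturality of the contraction -/

section pullback

variable {m : ℕ} (φ : Fin (m + 1) → Fin (n + 1)) (v : Fin (m + 1))

theorem sum_vtx_fiber {B : Type*} [Semiring B] (i : Fin (n + 1)) :
    ∑ j with φ j = i, (vtx v j : B) = vtx (φ v) i := by
  simp only [vtx, Finset.sum_ite_eq', Finset.mem_filter, Finset.mem_univ, true_and]
  exact if_congr eq_comm rfl rfl

theorem pullback_parity (ω : Alg k n) :
    pullback φ (parity n ω) = parity m (pullback φ ω) := by
  have hpar : (pullback (k := k) φ).comp (parity n) = (parity m).comp (pullback φ) :=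
    algHom_ext (fun i => by simp) (fun i => by simp)
  exact DFunLike.congr_fun hpar ω

theorem pullback_contract (ω : Alg k n) :
    pullback φ (contract (φ v) ω) = contract v (pullback φ ω) := by
  refine alg_induction (P := fun ω => pullback φ (contract (φ v) ω) = contract v (pullback φ ω))
    ?_ ?_ ?_ ?_ ?_ ω
  · intro c
    rw [contract_algebraMap, AlgHom.commutes, contract_algebraMap, map_zero]
  · intro i; simp
  · intro i
    simp [map_vtx, Finset.sum_sub_distrib, sum_vtx_fiber]
  · intro x y h1 h2
    rw [contract_mul, map_add, map_mul, map_mul, map_mul, contract_mul, h1, h2, pullback_parity]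
  · intro x y h1 h2
    simp only [map_add, h1, h2]

theorem wtComp_pullback (a : ℕ) (ω : Alg k n) :
    wtComp v a (pullback φ ω) = pullback φ (wtComp (φ v) a ω) := by
  refine alg_induction
    (P := fun ω => ∀ a, wtComp v a (pullback φ ω) = pullback φ (wtComp (φ v) a ω))
    ?_ ?_ ?_ ?_ ?_ ω a
  · intro c a
    rw [AlgHom.commutes, wtComp_algebraMap, wtComp_algebraMap]
    split_ifs <;> simp
  · intro i a
    rw [pullback_t, map_sum, wtComp_t]
    simp only [wtComp_t, Finset.sum_add_distrib]
    split_ifs <;> simp [map_vtx, Finset.sum_sub_distrib, sum_vtx_fiber]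
  · intro i a
    rw [pullback_dt, map_sum, wtComp_dt]
    simp only [wtComp_dt]
    split_ifs <;> simp
  · intro x y h1 h2 a
    simp only [map_mul, wtComp_mul, map_sum, h1, h2]
  · intro x y h1 h2 a
    simp only [map_add, h1, h2]

theorem pullback_homotopy (ω : Alg k n) :
    pullback φ (homotopy (φ v) ω) = homotopy v (pullback φ ω) := by
  rw [homotopy_apply, homotopy_apply, pullback_contract]
  exact congrArg _
    (invEuler_comm (pullback φ).toLinearMap (fun a x => wtComp_pullback φ v a x) ω).symm

theorem evalVertex_pullback (ω : Alg k n) :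
    evalVertex v (pullback φ ω) = evalVertex (φ v) ω := by
  have : (evalVertex v).comp (pullback φ) = (evalVertex (φ v) : Alg k n →ₐ[k] k) :=
    algHom_ext (fun i => by simp [sum_vtx_fiber]) (fun i => by simp)
  exact DFunLike.congr_fun this ω

end pullback

end PolyForms

/-! ### The gauge action as an exponential -/

namespace DGLieAlgebra

open Finset

variable {k : Type u} [Field k] {g h : DGLieAlgebra k}

/-- The operator `(x, c) ↦ ([a, x] - c da, 0)` on `g × k`, which is `[a, x + c d]` if `(x, c)` is
read as `x + c d` for a formal element `d` with `[d, x] = dx`. -/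
def extRep (g : DGLieAlgebra k) : g.carrier →ₗ[k] Module.End k (g.carrier × k) where
  toFun a := (LinearMap.inl k g.carrier k).comp ((g.bracket a).comp (LinearMap.fst k g.carrier k) -
    (LinearMap.toSpanSingleton k g.carrier (g.d a)).comp (LinearMap.snd k g.carrier k))
  map_add' a b := by
    refine LinearMap.ext fun p => Prod.ext ?_ ?_
    · simp
      abel
    · simp
  map_smul' c a := by
    refine LinearMap.ext fun p => Prod.ext ?_ ?_
    · simp [smul_sub, smul_comm c]
    · simp

theorem extRep_apply (a : g.carrier) (p : g.carrier × k) :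
    g.extRep a p = (g.bracket a p.1 - p.2 • g.d a, 0) := by
  refine Prod.ext ?_ ?_ <;> simp [extRep]

theorem bracket_skew_zero {a b : g.carrier} (ha : a ∈ g.deg 0) {i : ℤ} (hb : b ∈ g.deg i) :
    g.bracket a b = -g.bracket b a := by
  simpa using g.bracket_skew ha hb

theorem jacobi_zero {a b : g.carrier} (ha : a ∈ g.deg 0) {i : ℤ} (hb : b ∈ g.deg i)
    (x : g.carrier) : g.bracket a (g.bracket b x) =
      g.bracket (g.bracket a b) x + g.bracket b (g.bracket a x) := by
  simpa using g.jacobi x ha hb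

theorem d_bracket_zero {a : g.carrier} (ha : a ∈ g.deg 0) (x : g.carrier) :
    g.d (g.bracket a x) = g.bracket (g.d a) x + g.bracket a (g.d x) := by
  simpa using g.d_bracket x ha

theorem d_mem_one {a : g.carrier} (ha : a ∈ g.deg 0) : g.d a ∈ g.deg 1 := by
  simpa using g.d_mem ha

theorem bracket_mem_zero {a x : g.carrier} (ha : a ∈ g.deg 0) {i : ℤ} (hx : x ∈ g.deg i) :
    g.bracket a x ∈ g.deg i := by
  simpa using g.bracket_mem ha hx

/-- `extRep` is a representation of the Lie algebra `g⁰`. -/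
theorem extRep_bracket {a b : g.carrier} (ha : a ∈ g.deg 0) (hb : b ∈ g.deg 0) :
    g.extRep (g.bracket a b) = g.extRep a * g.extRep b - g.extRep b * g.extRep a := by
  refine LinearMap.ext fun p => Prod.ext ?_ ?_
  · simp only [LinearMap.sub_apply, Module.End.mul_apply, extRep_apply, Prod.fst_sub, zero_smul,
      sub_zero, map_sub, map_smul]
    rw [jacobi_zero ha hb, d_bracket_zero ha, bracket_skew_zero hb (d_mem_one ha), smul_add,
      smul_neg]
    abel
  · simp [extRep_apply]

theorem lcs_eq_bot_of_le {n m : ℕ} (h : g.lcs n = ⊥) (hm : n ≤ m) : g.lcs m = ⊥ := by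
  obtain ⟨r, rfl⟩ := Nat.exists_eq_add_of_le hm
  exact lcs_add h r

/-- The product of `m + 1` operators `extRep a` takes values in the `m`-th step of the lower central
series: the first of them to be applied may contribute the differential instead of a bracket. -/
theorem extRep_list_prod (L : List (Module.End k (g.carrier × k)))
    (hL : ∀ z ∈ L, ∃ a, z = g.extRep a) (hne : L ≠ []) (p : g.carrier × k) :
    (L.prod p).1 ∈ g.lcs (L.length - 1) ∧ (L.prod p).2 = 0 := by
  induction L with
  | nil => exact absurd rfl hne
  | cons z L ih =>
    obtain ⟨a, rfl⟩ := hL z (by simp)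
    rw [List.prod_cons, Module.End.mul_apply, extRep_apply]
    refine ⟨?_, rfl⟩
    cases L with
    | nil => exact Submodule.mem_top
    | cons w L =>
      obtain ⟨h1, h2⟩ := ih (fun c hc => hL c (by simp [hc])) (by simp)
      rw [h2, zero_smul, sub_zero]
      exact Submodule.apply_mem_map₂ _ Submodule.mem_top h1

theorem wordsVanish_extRep {n : ℕ} (hn : g.lcs n = ⊥) (a b : g.carrier) :
    WordsVanish (g.extRep a) (g.extRep b) (n + 1) := by
  intro L hL hlen
  refine LinearMap.ext fun p => ?_
  have hne : L ≠ [] := by rintro rfl; simp at hlen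
  obtain ⟨h1, h2⟩ := extRep_list_prod L (fun z hz => by
    rcases hL z hz with rfl | rfl
    exacts [⟨a, rfl⟩, ⟨b, rfl⟩]) hne p
  rw [lcs_eq_bot_of_le hn (by omega : n ≤ L.length - 1), Submodule.mem_bot] at h1
  exact Prod.ext h1 h2

theorem isNilpotent_extRep (hg : g.IsNilpotent) (a : g.carrier) :
    _root_.IsNilpotent (g.extRep a) := by
  obtain ⟨n, hn⟩ := hg
  exact ⟨n + 1, (wordsVanish_extRep hn a a).pow_left⟩

theorem nestedBracket_mem_zero (l : List g.carrier) (hl : ∀ a ∈ l, a ∈ g.deg 0) :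
    g.nestedBracket l ∈ g.deg 0 := by
  induction l with
  | nil => exact zero_mem _
  | cons a l ih =>
    cases l with
    | nil => exact hl a (by simp)
    | cons b l =>
      exact bracket_mem_zero (hl a (by simp)) (ih fun c hc => hl c (by simp [hc]))

theorem extRep_nestedBracket (l : List g.carrier) (hl : ∀ a ∈ l, a ∈ g.deg 0) :
    g.extRep (g.nestedBracket l) = nestedComm (l.map g.extRep) := by
  induction l with
  | nil => exact map_zero _
  | cons a l ih =>
    cases l with
    | nil => rfl
    | cons b l =>
      have h1 := fun c hc => hl c (List.mem_cons_of_mem a hc)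
      rw [nestedBracket, extRep_bracket (hl a (by simp)) (nestedBracket_mem_zero _ h1), ih h1]
      rfl

theorem bch_eq_sum {n N : ℕ} (hn : g.lcs n = ⊥) (hN : n ≤ N) (x y : g.carrier) :
    g.bch x y = ∑ l ∈ bchIndex N, bchCoeff k l • g.nestedBracket (bchWord x y l) := by
  rw [bch]
  refine (finsum_set_coe_eq_finsum_mem {l : List (ℕ × ℕ) | l ≠ [] ∧ (0, 0) ∉ l}
    (f := fun l => bchCoeff k l • g.nestedBracket (bchWord x y l))).trans ?_
  refine finsum_mem_eq_sum_of_inter_support_eq _ ?_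
  ext l
  simp only [Set.mem_inter_iff, Set.mem_ofPred_eq, Function.mem_support, mem_coe, mem_bchIndex]
  constructor
  · rintro ⟨⟨h1, h2⟩, h3⟩
    refine ⟨⟨h1, h2, ?_⟩, h3⟩
    by_contra hlt
    have h4 := nestedBracket_mem g (bchWord x y l)
    rw [length_bchWord, lcs_eq_bot_of_le hn (by simp only [bchDeg] at hlt; omega),
      Submodule.mem_bot] at h4
    exact h3 (by rw [h4, smul_zero])
  · rintro ⟨⟨h1, h2, _⟩, h3⟩
    exact ⟨⟨h1, h2⟩, h3⟩

theorem bch_mem (hg : g.IsNilpotent) {a b : g.carrier} (ha : a ∈ g.deg 0) (hb : b ∈ g.deg 0) :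
    g.bch a b ∈ g.deg 0 := by
  obtain ⟨n, hn⟩ := hg
  rw [bch_eq_sum hn le_rfl]
  refine sum_mem fun l _ => Submodule.smul_mem _ _ (nestedBracket_mem_zero _ fun c hc => ?_)
  rcases mem_bchWord hc with rfl | rfl
  exacts [ha, hb]

theorem bch_zero_zero : g.bch 0 0 = 0 := by
  refine finsum_eq_zero_of_forall_eq_zero fun l => ?_
  have key : ∀ l : List g.carrier, (∀ a ∈ l, a = 0) → g.nestedBracket l = 0 := by
    rintro (_ | ⟨a, _ | ⟨b, l⟩⟩) h
    · rfl
    · exact h a (by simp)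
    · rw [nestedBracket, h a (by simp), map_zero, LinearMap.zero_apply]
  rw [key _ fun a ha => by simpa using mem_bchWord ha, smul_zero]

theorem extRep_pow_succ (a : g.carrier) (p : g.carrier × k) (j : ℕ) :
    (g.extRep a ^ (j + 1)) p =
      (((g.bracket a : Module.End k g.carrier) ^ (j + 1)) p.1 -
        p.2 • ((g.bracket a : Module.End k g.carrier) ^ j) (g.d a), 0) := by
  induction j with
  | zero => simp [extRep_apply]
  | succ j ih =>
    rw [pow_succ', Module.End.mul_apply, ih, extRep_apply, zero_smul, sub_zero, map_sub, map_smul,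
      pow_succ' _ (j + 1), pow_succ' _ j, Module.End.mul_apply, Module.End.mul_apply]
    rfl

theorem extRep_mem {a : g.carrier} (ha : a ∈ g.deg 0) (p : g.carrier × k)
    (hp : p ∈ (g.deg 1).prod (⊤ : Submodule k k)) :
    g.extRep a p ∈ (g.deg 1).prod (⊤ : Submodule k k) := by
  rw [extRep_apply]
  exact ⟨sub_mem (bracket_mem_zero ha hp.1) (Submodule.smul_mem _ _ (d_mem_one ha)), trivial⟩

/-- For `w = (x, e)`, read as `x + e d`, the operator `(y, c) ↦ [x + e d, y + c d]`, with
`[d, d] = 0`. -/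
def extOp (g : DGLieAlgebra k) (w : g.carrier × k) : Module.End k (g.carrier × k) :=
  (LinearMap.inl k g.carrier k).comp ((w.2 • g.d + g.bracket w.1).comp
    (LinearMap.fst k g.carrier k) +
    (LinearMap.toSpanSingleton k g.carrier (g.d w.1)).comp (LinearMap.snd k g.carrier k))

theorem extOp_apply (w p : g.carrier × k) :
    g.extOp w p = (w.2 • g.d p.1 + g.bracket w.1 p.1 + p.2 • g.d w.1, 0) := by
  refine Prod.ext ?_ ?_ <;> simp [extOp]

theorem extOp_add (v w : g.carrier × k) : g.extOp (v + w) = g.extOp v + g.extOp w := by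
  refine LinearMap.ext fun p => Prod.ext ?_ ?_
  · simp only [extOp_apply, LinearMap.add_apply, Prod.fst_add, Prod.snd_add, map_add, add_smul,
      smul_add]
    abel
  · simp [extOp_apply]

theorem extOp_smul (c : k) (w : g.carrier × k) : g.extOp (c • w) = c • g.extOp w := by
  refine LinearMap.ext fun p => Prod.ext ?_ ?_
  · simp [extOp_apply, smul_smul, mul_comm]
  · simp [extOp_apply]

/-- The Jacobi identity `[a, [w, ·]] - [w, [a, ·]] = [[a, w], ·]` for `w = x + e d`. -/
theorem adL_extRep_extOp {a : g.carrier} (ha : a ∈ g.deg 0) {w : g.carrier × k}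
    (hw : w ∈ (g.deg 1).prod (⊤ : Submodule k k)) :
    adL k (g.extRep a) (g.extOp w) = g.extOp (g.extRep a w) := by
  rw [adL_apply]
  have e : g.bracket w.1 (g.d a) = g.bracket (g.d a) w.1 := by
    simpa using g.bracket_skew hw.1 (d_mem_one ha)
  refine LinearMap.ext fun p => Prod.ext ?_ ?_
  · simp only [LinearMap.sub_apply, Module.End.mul_apply, extRep_apply, extOp_apply,
      Prod.fst_sub, zero_smul, sub_zero, map_sub, map_smul, map_add, LinearMap.sub_apply,
      LinearMap.smul_apply, g.d_d, smul_zero, zero_add, add_zero, e]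
    rw [jacobi_zero ha hw.1, d_bracket_zero ha, d_bracket_zero ha, smul_add, smul_add]
    abel
  · simp [extRep_apply, extOp_apply]

section CharZero

variable [CharZero k]

/-- The Baker-Campbell-Hausdorff theorem in the representation `extRep`. -/
theorem nexp_extRep_bch (hg : g.IsNilpotent) {a b : g.carrier} (ha : a ∈ g.deg 0)
    (hb : b ∈ g.deg 0) :
    nexp k (g.extRep (g.bch a b)) = nexp k (g.extRep a) * nexp k (g.extRep b) := by
  obtain ⟨n, hn⟩ := hg
  rw [← (nexp_dynkin k (wordsVanish_extRep hn a b)).2,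
    bch_eq_sum hn (by omega : n ≤ 2 * n + 1), map_sum]
  congr 1
  refine sum_congr rfl fun l _ => ?_
  rw [map_smul, extRep_nestedBracket _ fun c hc => ?_, map_bchWord]
  rcases mem_bchWord hc with rfl | rfl
  exacts [ha, hb]

/-- The gauge action is the exponential of `extRep`. -/
theorem nexp_extRep (hg : g.IsNilpotent) (a x : g.carrier) :
    nexp k (g.extRep a) (x, 1) = (g.gauge a x, 1) := by
  obtain ⟨n, hn⟩ := hg
  have h0 : ∀ (y : g.carrier) (j : ℕ), n ≤ j →
      ((g.bracket a : Module.End k g.carrier) ^ j) y = 0 := fun y j hj => by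
    have := pow_bracket_mem g a y j
    rwa [lcs_eq_bot_of_le hn hj, Submodule.mem_bot] at this
  have h1 : (∑ᶠ j : ℕ, (j.factorial : k)⁻¹ • ((g.bracket a : Module.End k g.carrier) ^ j) x) =
      ∑ j ∈ range (n + 1),
        (j.factorial : k)⁻¹ • ((g.bracket a : Module.End k g.carrier) ^ j) x := by
    refine finsum_eq_sum_of_support_subset _ fun j hj => ?_
    rw [mem_coe, mem_range]
    by_contra hlt
    exact hj (by simp only [h0 x j (by omega), smul_zero])
  have h2 : (∑ᶠ j : ℕ, ((j + 1).factorial : k)⁻¹ •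
      ((g.bracket a : Module.End k g.carrier) ^ j) (g.d a)) = ∑ j ∈ range n,
        ((j + 1).factorial : k)⁻¹ • ((g.bracket a : Module.End k g.carrier) ^ j) (g.d a) := by
    refine finsum_eq_sum_of_support_subset _ fun j hj => ?_
    rw [mem_coe, mem_range]
    by_contra hlt
    exact hj (by simp only [h0 _ j (by omega), smul_zero])
  rw [nexp_eq_sum k (wordsVanish_extRep hn a a).pow_left, gauge, h1, h2, sum_range_succ',
    sum_range_succ']
  simp only [LinearMap.add_apply, LinearMap.sum_apply, LinearMap.smul_apply, extRep_pow_succ,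
    one_smul]
  refine Prod.ext ?_ ?_
  · simp only [Prod.fst_add, Prod.fst_sum, Prod.smul_fst, smul_sub, sum_sub_distrib]
    simp
    abel
  · simp [Prod.snd_sum]

/-- The gauge action is an action for the Baker-Campbell-Hausdorff product. -/
theorem gauge_bch (hg : g.IsNilpotent) {a b : g.carrier} (ha : a ∈ g.deg 0) (hb : b ∈ g.deg 0)
    (x : g.carrier) : g.gauge (g.bch a b) x = g.gauge a (g.gauge b x) := by
  have h1 := nexp_extRep hg (g.bch a b) x
  rw [nexp_extRep_bch hg ha hb, Module.End.mul_apply, nexp_extRep hg, nexp_extRep hg] at h1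
  exact (congrArg Prod.fst h1).symm

theorem gauge_zero (hg : g.IsNilpotent) (x : g.carrier) : g.gauge 0 x = x := by
  have h1 := nexp_extRep hg 0 x
  rw [map_zero, nexp_zero, Module.End.one_apply] at h1
  exact (congrArg Prod.fst h1).symm

theorem nexp_apply_mem {V : Type*} [AddCommGroup V] [Module k V] (S : Submodule k V)
    {T : Module.End k V} (hT : ∀ v ∈ S, T v ∈ S) {v : V} (hv : v ∈ S) : nexp k T v ∈ S := by
  have : ∀ j, (T ^ j) v ∈ S := fun j => by
    induction j with
    | zero => exact hv
    | succ j ih => rw [pow_succ', Module.End.mul_apply]; exact hT _ ih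
  rw [nexp, nilEval, LinearMap.sum_apply]
  exact sum_mem fun j _ => Submodule.smul_mem _ _ (this j)

theorem gauge_mem (hg : g.IsNilpotent) {a x : g.carrier} (ha : a ∈ g.deg 0) (hx : x ∈ g.deg 1) :
    g.gauge a x ∈ g.deg 1 := by
  have := nexp_apply_mem _ (extRep_mem ha) (v := (x, (1 : k))) ⟨hx, trivial⟩
  rw [nexp_extRep hg] at this
  exact this.1

theorem nexp_adL_extOp (hg : g.IsNilpotent) {a : g.carrier} (ha : a ∈ g.deg 0)
    {w : g.carrier × k} (hw : w ∈ (g.deg 1).prod (⊤ : Submodule k k)) :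
    nexp k (adL k (g.extRep a)) (g.extOp w) = g.extOp (nexp k (g.extRep a) w) := by
  obtain ⟨N, hN⟩ := isNilpotent_extRep hg a
  obtain ⟨M, hM⟩ := isNilpotent_adL k (isNilpotent_extRep hg a)
  have hpow : ∀ j, (g.extRep a ^ j) w ∈ (g.deg 1).prod (⊤ : Submodule k k) ∧
      (adL k (g.extRep a) ^ j) (g.extOp w) = g.extOp ((g.extRep a ^ j) w) := by
    intro j
    induction j with
    | zero => exact ⟨hw, rfl⟩
    | succ j ih =>
      rw [pow_succ', pow_succ', Module.End.mul_apply, Module.End.mul_apply, ih.2]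
      exact ⟨extRep_mem ha _ ih.1, adL_extRep_extOp ha ih.1⟩
  rw [nexp_eq_sum k (pow_eq_zero_of_le (Nat.le_add_right M N) hM),
    nexp_eq_sum k (pow_eq_zero_of_le (Nat.le_add_left N M) hN)]
  let Φ : g.carrier × k →ₗ[k] Module.End k (g.carrier × k) :=
    { toFun := g.extOp, map_add' := extOp_add, map_smul' := extOp_smul }
  change _ = Φ _
  simp only [LinearMap.sum_apply, LinearMap.smul_apply, map_sum, map_smul]
  exact sum_congr rfl fun j _ => by rw [(hpow j).2]; rfl

/-- The gauge action preserves the Maurer-Cartan equation: `extOp (x, 1) (x, 1)`, that is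
`[x + d, x + d]`, is twice the curvature of `x`, and it is transported by `exp (ad a)`. -/
theorem gauge_curvature (hg : g.IsNilpotent) {a x : g.carrier} (ha : a ∈ g.deg 0)
    (hx : x ∈ g.deg 1) (h : g.d x + (2 : k)⁻¹ • g.bracket x x = 0) :
    g.d (g.gauge a x) + (2 : k)⁻¹ • g.bracket (g.gauge a x) (g.gauge a x) = 0 := by
  have hcurv : ∀ y : g.carrier, (g.extOp (y, 1) (y, 1)).1 =
      (2 : k) • (g.d y + (2 : k)⁻¹ • g.bracket y y) := by
    intro y
    rw [extOp_apply, smul_add, smul_smul, mul_inv_cancel₀ two_ne_zero, two_smul]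
    simp only [one_smul]
    abel
  have h0 : g.extOp (x, 1) (x, 1) = 0 := by
    refine Prod.ext ?_ ?_
    · rw [hcurv, h, smul_zero]
      rfl
    · rw [extOp_apply]
      rfl
  have hA := isNilpotent_extRep hg a
  have h1 := nexp_adL_extOp hg ha (w := (x, (1 : k))) ⟨hx, trivial⟩
  rw [nexp_adL k hA, nexp_extRep hg] at h1
  have h2 := congrArg (fun f : Module.End k (g.carrier × k) => f (g.gauge a x, 1)) h1
  simp only [Module.End.mul_apply] at h2
  rw [← nexp_extRep hg, ← Module.End.mul_apply (nexp k (-g.extRep a)), nexp_neg_mul_nexp k hA,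
    Module.End.one_apply, h0, map_zero, nexp_extRep hg] at h2
  have h3 := hcurv (g.gauge a x)
  rw [← h2] at h3
  exact ((smul_eq_zero.1 h3.symm).resolve_left two_ne_zero)

end CharZero

end DGLieAlgebra

/-! ### Operators on the tensor product induced by operators on forms -/

namespace DGLieAlgebra

variable {k : Type u} [Field k]

section Tensor

variable (A : CommDGAlgebra k) (g : DGLieAlgebra k)

/-- The pure tensors, as a bilinear map into the dg Lie algebra `A ⊗ g`. -/
def pure : A.carrier →ₗ[k] g.carrier →ₗ[k] (tensor A g).carrier :=
  TensorProduct.mk k A.carrier g.carrier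

variable {A g}

theorem pure_induction {P : (tensor A g).carrier → Prop} (h : ∀ a x, P (pure A g a x))
    (hadd : ∀ z w, P z → P w → P (z + w)) (z : (tensor A g).carrier) : P z :=
  TensorProduct.induction_on (motive := P) z
    ((congrArg P ((pure A g 0).map_zero)).mp (h 0 0)) h hadd

theorem homogeneous_induction {P : (tensor A g).carrier → Prop}
    (h : ∀ (p i : ℤ) (a : A.carrier) (x : g.carrier), a ∈ A.deg p → x ∈ g.deg i →
      P (pure A g a x))
    (hadd : ∀ z w, P z → P w → P (z + w)) (z : (tensor A g).carrier) : P z :=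
  TensorDGLie.induction (P := P) h hadd z

theorem deg_induction {m : ℤ} {P : (tensor A g).carrier → Prop}
    (h : ∀ (p i : ℤ) (a : A.carrier) (x : g.carrier), a ∈ A.deg p → x ∈ g.deg i → p + i = m →
      P (pure A g a x))
    (hadd : ∀ z w, P z → P w → P (z + w)) (hsmul : ∀ (c : k) z, P z → P (c • z))
    {z : (tensor A g).carrier} (hz : z ∈ (tensor A g).deg m) : P z :=
  TensorDGLie.deg_induction (P := P) h hadd hsmul hz

theorem pure_mem {p i m : ℤ} {a : A.carrier} {x : g.carrier} (ha : a ∈ A.deg p)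
    (hx : x ∈ g.deg i) (h : p + i = m) : pure A g a x ∈ (tensor A g).deg m :=
  TensorDGLie.tmul_mem' ha hx h

theorem d_pure {p : ℤ} {a : A.carrier} (x : g.carrier) (ha : a ∈ A.deg p) :
    (tensor A g).d (pure A g a x) = pure A g (A.d a) x + p.negOnePow • pure A g a (g.d x) :=
  TensorDGLie.d_tmul x ha

theorem bracket_pure (a : A.carrier) {i p : ℤ} {x : g.carrier} {b : A.carrier} (y : g.carrier)
    (hx : x ∈ g.deg i) (hb : b ∈ A.deg p) :
    (tensor A g).bracket (pure A g a x) (pure A g b y) =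
      (i * p).negOnePow • pure A g (a * b) (g.bracket x y) :=
  TensorDGLie.bracket_tmul a y hx hb

theorem tensorMap_pure {B : CommDGAlgebra k} {h : DGLieAlgebra k} (f : A ⟶ B) (φ : g ⟶ h)
    (a : A.carrier) (x : g.carrier) :
    (tensorMap f φ).toLinearMap (pure A g a x) = pure B h (f.toAlgHom a) (φ.toLinearMap x) := rfl

theorem const_apply (x : g.carrier) : (const A g).toLinearMap x = pure A g 1 x := rfl

/-- The linear map out of `A ⊗ g` determined by a bilinear map. -/
def lift {M : Type u} [AddCommGroup M] [Module k M] (B : A.carrier →ₗ[k] g.carrier →ₗ[k] M) :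
    (tensor A g).carrier →ₗ[k] M := TensorProduct.lift B

theorem lift_pure {M : Type u} [AddCommGroup M] [Module k M]
    (B : A.carrier →ₗ[k] g.carrier →ₗ[k] M) (a : A.carrier) (x : g.carrier) :
    lift B (pure A g a x) = B a x := TensorProduct.lift.tmul a x

variable (g) in
/-- The operator `a ⊗ x ↦ η a ⊗ x`. -/
def formOp (η : A.carrier →ₗ[k] A.carrier) : (tensor A g).carrier →ₗ[k] (tensor A g).carrier :=
  lift ((pure A g).comp η)

theorem formOp_pure (η : A.carrier →ₗ[k] A.carrier) (a : A.carrier) (x : g.carrier) :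
    formOp g η (pure A g a x) = pure A g (η a) x := lift_pure _ a x

theorem formOp_mem {η : A.carrier →ₗ[k] A.carrier} {e : ℤ}
    (hη : ∀ {p : ℤ} {a : A.carrier}, a ∈ A.deg p → η a ∈ A.deg (p + e)) {m : ℤ}
    {z : (tensor A g).carrier} (hz : z ∈ (tensor A g).deg m) :
    formOp g η z ∈ (tensor A g).deg (m + e) := by
  refine deg_induction (P := fun z => formOp g η z ∈ (tensor A g).deg (m + e)) ?_ ?_ ?_ hz
  · rintro p i a x ha hx rfl
    rw [formOp_pure]
    exact pure_mem (hη ha) hx (by ring)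
  · intro z w h1 h2
    rw [map_add]; exact add_mem h1 h2
  · intro c z h1
    rw [map_smul]; exact Submodule.smul_mem _ _ h1

theorem formOp_tensorMap {B : CommDGAlgebra k} {h : DGLieAlgebra k} (f : A ⟶ B) (φ : g ⟶ h)
    {η : A.carrier →ₗ[k] A.carrier} {θ : B.carrier →ₗ[k] B.carrier}
    (e : ∀ a, f.toAlgHom (η a) = θ (f.toAlgHom a)) (z : (tensor A g).carrier) :
    (tensorMap f φ).toLinearMap (formOp g η z) = formOp h θ ((tensorMap f φ).toLinearMap z) := by
  refine pure_induction (P := fun z => (tensorMap f φ).toLinearMap (formOp g η z) =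
    formOp h θ ((tensorMap f φ).toLinearMap z)) ?_ ?_ z
  · intro a x
    rw [formOp_pure, tensorMap_pure, tensorMap_pure, formOp_pure, e]
  · intro z w h1 h2
    simp only [map_add, h1, h2]

end Tensor

/-! ### Contractions of commutative dg algebras -/

/-- A contraction of `A` onto `k`: an augmentation `ε` and a homotopy `η` from the identity to `ε`
satisfying the side conditions `η η = 0`, `ε η = 0` and `η 1 = 0`. -/
structure Contraction (A : CommDGAlgebra k) where
  ε : A.carrier →ₐ[k] k
  η : A.carrier →ₗ[k] A.carrier
  ε_of_mem : ∀ {p : ℤ} {a : A.carrier}, p ≠ 0 → a ∈ A.deg p → ε a = 0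
  ε_d : ∀ a, ε (A.d a) = 0
  η_mem : ∀ {p : ℤ} {a : A.carrier}, a ∈ A.deg p → η a ∈ A.deg (p - 1)
  η_η : ∀ a, η (η a) = 0
  ε_η : ∀ a, ε (η a) = 0
  η_one : η 1 = 0
  d_η : ∀ a, A.d (η a) + η (A.d a) = a - ε a • (1 : A.carrier)

namespace Contraction

variable {A B : CommDGAlgebra k} (C : Contraction A) (g : DGLieAlgebra k)

/-- The augmentation `ε ⊗ id : A ⊗ g ⟶ g`. -/
def eval : tensor A g ⟶ g where
  toLinearMap := lift (LinearMap.lsmul k g.carrier ∘ₗ C.ε.toLinearMap)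
  map_mem {m z} hz := by
    refine deg_induction (P := fun z =>
      lift (LinearMap.lsmul k g.carrier ∘ₗ C.ε.toLinearMap) z ∈ g.deg m) ?_ ?_ ?_ hz
    · rintro p i a x ha hx rfl
      rw [lift_pure]
      change C.ε a • x ∈ g.deg (p + i)
      by_cases hp : p = 0
      · rw [hp, zero_add]
        exact Submodule.smul_mem _ _ hx
      · rw [C.ε_of_mem hp ha, zero_smul]
        exact zero_mem _
    · intro z w h1 h2
      rw [map_add]; exact add_mem h1 h2
    · intro c z h1
      rw [map_smul]; exact Submodule.smul_mem _ _ h1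
  map_d z := by
    refine homogeneous_induction (P := fun z =>
      lift (LinearMap.lsmul k g.carrier ∘ₗ C.ε.toLinearMap) ((tensor A g).d z) =
      g.d (lift (LinearMap.lsmul k g.carrier ∘ₗ C.ε.toLinearMap) z)) ?_ ?_ z
    · intro p i a x ha hx
      rw [d_pure x ha, map_add, TensorDGLie.map_units_smul, lift_pure, lift_pure, lift_pure]
      change C.ε (A.d a) • x + _ • (C.ε a • g.d x) = g.d (C.ε a • x)
      rw [C.ε_d, zero_smul, zero_add, map_smul]
      by_cases hp : p = 0
      · simp [hp]
      · rw [C.ε_of_mem hp ha, zero_smul, smul_zero]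
    · intro z w h1 h2
      simp only [map_add, h1, h2]
  map_bracket z w := by
    refine homogeneous_induction (P := fun z =>
      lift (LinearMap.lsmul k g.carrier ∘ₗ C.ε.toLinearMap) ((tensor A g).bracket z w) =
      g.bracket (lift (LinearMap.lsmul k g.carrier ∘ₗ C.ε.toLinearMap) z)
        (lift (LinearMap.lsmul k g.carrier ∘ₗ C.ε.toLinearMap) w)) ?_ ?_ z
    · intro p i a x ha hx
      refine homogeneous_induction (P := fun w =>
        lift (LinearMap.lsmul k g.carrier ∘ₗ C.ε.toLinearMap)
          ((tensor A g).bracket (pure A g a x) w) =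
        g.bracket (lift (LinearMap.lsmul k g.carrier ∘ₗ C.ε.toLinearMap) (pure A g a x))
          (lift (LinearMap.lsmul k g.carrier ∘ₗ C.ε.toLinearMap) w)) ?_ ?_ w
      · intro q j b y hb hy
        rw [bracket_pure a y hx hb, TensorDGLie.map_units_smul, lift_pure, lift_pure, lift_pure]
        change _ • (C.ε (a * b) • g.bracket x y) = g.bracket (C.ε a • x) (C.ε b • y)
        rw [map_mul, map_smul, map_smul, LinearMap.smul_apply, smul_smul,
          mul_comm (C.ε b)]
        by_cases hq : q = 0
        · simp [hq]
        · rw [C.ε_of_mem hq hb, mul_zero, zero_smul, smul_zero]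
      · intro z w h1 h2
        simp only [map_add, h1, h2]
    · intro z w h1 h2
      simp only [map_add, LinearMap.add_apply, h1, h2]

theorem eval_pure (a : A.carrier) (x : g.carrier) :
    (C.eval g).toLinearMap (pure A g a x) = C.ε a • x :=
  lift_pure (LinearMap.lsmul k g.carrier ∘ₗ C.ε.toLinearMap) a x

theorem eval_const (x : g.carrier) :
    (C.eval g).toLinearMap ((const A g).toLinearMap x) = x := by
  rw [const_apply, eval_pure, map_one, one_smul]

theorem formOp_η_const (x : g.carrier) : formOp g C.η ((const A g).toLinearMap x) = 0 := by
  rw [const_apply, formOp_pure, C.η_one, map_zero, LinearMap.zero_apply]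

variable {g}

theorem formOp_η_mem (m : ℤ) {z : (tensor A g).carrier} (hz : z ∈ (tensor A g).deg (m + 1)) :
    formOp g C.η z ∈ (tensor A g).deg m := by
  have h := formOp_mem (e := -1) (fun ha => C.η_mem ha) hz
  rwa [add_neg_cancel_right] at h

theorem formOp_η_formOp_η (z : (tensor A g).carrier) : formOp g C.η (formOp g C.η z) = 0 := by
  refine pure_induction (P := fun z => formOp g C.η (formOp g C.η z) = 0) ?_ ?_ z
  · intro a x
    rw [formOp_pure, formOp_pure, C.η_η, map_zero, LinearMap.zero_apply]
  · intro z w h1 h2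
    rw [map_add, map_add, h1, h2, add_zero]

theorem eval_formOp_η (z : (tensor A g).carrier) :
    (C.eval g).toLinearMap (formOp g C.η z) = 0 := by
  refine pure_induction (P := fun z => (C.eval g).toLinearMap (formOp g C.η z) = 0) ?_ ?_ z
  · intro a x
    rw [formOp_pure, eval_pure, C.ε_η, zero_smul]
  · intro z w h1 h2
    rw [map_add, map_add, h1, h2, add_zero]

/-- The homotopy formula `d η + η d = 1 - ε` on `A ⊗ g`. -/
theorem d_formOp_η (z : (tensor A g).carrier) :
    (tensor A g).d (formOp g C.η z) + formOp g C.η ((tensor A g).d z) =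
      z - (const A g).toLinearMap ((C.eval g).toLinearMap z) := by
  refine homogeneous_induction (P := fun z =>
    (tensor A g).d (formOp g C.η z) + formOp g C.η ((tensor A g).d z) =
      z - (const A g).toLinearMap ((C.eval g).toLinearMap z)) ?_ ?_ z
  · intro p i a x ha hx
    rw [formOp_pure, d_pure x (C.η_mem ha), d_pure x ha, map_add, TensorDGLie.map_units_smul,
      formOp_pure, formOp_pure, eval_pure, const_apply, Int.negOnePow_sub, Int.negOnePow_one]
    have h := congrArg (fun b => pure A g b x) (C.d_η a)
    simp only [map_add, map_sub, map_smul, LinearMap.add_apply, LinearMap.sub_apply,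
      LinearMap.smul_apply] at h
    rw [map_smul, ← h]
    simp only [mul_neg, mul_one, Units.neg_smul]
    abel
  · intro z w h1 h2
    simp only [map_add]
    rw [add_sub_add_comm, ← h1, ← h2]
    abel

theorem eval_tensorMap {D : Contraction B} {h : DGLieAlgebra k} (f : A ⟶ B) (φ : g ⟶ h)
    (e : ∀ a, D.ε (f.toAlgHom a) = C.ε a) (z : (tensor A g).carrier) :
    (D.eval h).toLinearMap ((tensorMap f φ).toLinearMap z) =
      φ.toLinearMap ((C.eval g).toLinearMap z) := by
  refine pure_induction (P := fun z => (D.eval h).toLinearMap ((tensorMap f φ).toLinearMap z) =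
      φ.toLinearMap ((C.eval g).toLinearMap z)) ?_ ?_ z
  · intro a x
    rw [tensorMap_pure, eval_pure, eval_pure, map_smul, e]
  · intro z w h1 h2
    simp only [map_add, h1, h2]

end Contraction

/-- The contraction of `Ω_n` induced by the contraction of the simplex onto its vertex `v`. -/
def vertexContraction [CharZero k] {n : ℕ} (v : Fin (n + 1)) :
    Contraction (PolyForms.cdga k n) where
  ε := PolyForms.evalVertex v
  η := PolyForms.homotopy v
  ε_of_mem hp h := PolyForms.evalVertex_of_mem v hp h
  ε_d := PolyForms.evalVertex_d v
  η_mem h := PolyForms.homotopy_mem v h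
  η_η := PolyForms.homotopy_homotopy v
  ε_η := PolyForms.evalVertex_homotopy v
  η_one := PolyForms.homotopy_one v
  d_η := fun a : PolyForms.Alg k n => (PolyForms.d_homotopy v a).trans
    (congrArg (fun b => a - b) (Algebra.algebraMap_eq_smul_one _))

/-! ### The group laws for the Baker-Campbell-Hausdorff product -/

/-- The graded Lie algebra underlying `g`, with zero differential. It has the same
Baker-Campbell-Hausdorff product, and its paths have a derivative which sees only the path. -/
def flat (g : DGLieAlgebra k) : DGLieAlgebra k where
  carrier := g.carrier
  deg := g.deg
  isInternal := g.isInternal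
  d := 0
  d_mem _ := zero_mem _
  d_d _ := rfl
  bracket := g.bracket
  bracket_mem := g.bracket_mem
  bracket_skew := g.bracket_skew
  jacobi := g.jacobi
  d_bracket _ _ := by simp

theorem lcs_flat (g : DGLieAlgebra k) (n : ℕ) : (flat g).lcs n = g.lcs n := by
  induction n with
  | zero => rfl
  | succ n ih => exact congrArg (Submodule.map₂ g.bracket ⊤) ih

theorem IsNilpotent.flat {g : DGLieAlgebra k} (hg : g.IsNilpotent) : (flat g).IsNilpotent := by
  obtain ⟨n, hn⟩ := hg
  exact ⟨n, (lcs_flat g n).trans hn⟩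

theorem nestedBracket_flat (g : DGLieAlgebra k) (l : List g.carrier) :
    (flat g).nestedBracket l = g.nestedBracket l := by
  induction l with
  | nil => rfl
  | cons a l ih =>
    cases l with
    | nil => rfl
    | cons b l => exact congrArg (g.bracket a) ih

theorem bch_flat (g : DGLieAlgebra k) (x y : g.carrier) : (flat g).bch x y = g.bch x y :=
  finsum_congr fun l => congrArg (bchCoeff k l.1 • ·) (nestedBracket_flat g _)

section Path

variable {g : DGLieAlgebra k}

/-- The path `t₁ ⊗ a` from `0` to `a`. -/
def path (g : DGLieAlgebra k) : g.carrier →ₗ[k] (tensor (PolyForms.cdga k 1) g).carrier :=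
  pure (PolyForms.cdga k 1) g (PolyForms.t 1)

theorem path_mem {a : g.carrier} (ha : a ∈ g.deg 0) :
    path g a ∈ (tensor (PolyForms.cdga k 1) g).deg 0 :=
  pure_mem (A := PolyForms.cdga k 1) (PolyForms.t_mem 1) ha (zero_add 0)

variable [CharZero k]

variable (k) in
/-- The contraction of `Ω_1` onto a vertex of the interval. -/
abbrev endPt (v : Fin 2) : Contraction (PolyForms.cdga k 1) := vertexContraction v

theorem eval_zero_path (a : g.carrier) :
    ((endPt k 0).eval g).toLinearMap (path g a) = 0 := by
  refine ((endPt k 0).eval_pure g _ a).trans ?_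
  have h : (endPt k 0).ε (PolyForms.t 1 : PolyForms.Alg k 1) = 0 :=
    (PolyForms.evalVertex_t 0 1).trans (if_neg (by decide))
  rw [h, zero_smul]

theorem eval_one_path (a : g.carrier) :
    ((endPt k 1).eval g).toLinearMap (path g a) = a := by
  refine ((endPt k 1).eval_pure g _ a).trans ?_
  have h : (endPt k 1).ε (PolyForms.t 1 : PolyForms.Alg k 1) = 1 :=
    (PolyForms.evalVertex_t 1 1).trans (if_pos rfl)
  rw [h, one_smul]

/-- Two paths in a Lie algebra with zero differential which have the same starting point and the
same exponential in `extRep` have the same end point: `extRep` determines the differential of a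
path. -/
theorem eval_one_eq (hg : g.IsNilpotent) (hd : ∀ x, g.d x = 0)
    {z w : (tensor (PolyForms.cdga k 1) g).carrier}
    (h : nexp k (extRep _ z) = nexp k (extRep _ w))
    (h0 : ((endPt k 0).eval g).toLinearMap z = ((endPt k 0).eval g).toLinearMap w) :
    ((endPt k 1).eval g).toLinearMap z = ((endPt k 1).eval g).toLinearMap w := by
  have hN := hg.tensor (PolyForms.cdga k 1)
  have h1 := nexp_injective k (isNilpotent_extRep hN z) (isNilpotent_extRep hN w) h
  have h2 := congrArg (fun f : Module.End k _ => (f (0, 1)).1) h1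
  simp only [extRep_apply, map_zero, one_smul, zero_sub, neg_inj] at h2
  have h3 := congrArg ((endPt k 1).eval g).toLinearMap ((endPt k 0).d_formOp_η (z - w))
  rw [map_sub (tensor (PolyForms.cdga k 1) g).d, h2, sub_self, map_zero, add_zero,
    ((endPt k 1).eval g).map_d, hd, map_sub, Contraction.eval_const, map_sub, map_sub, h0,
    sub_self, sub_zero] at h3
  exact (sub_eq_zero.1 h3.symm)

theorem bch_assoc_of_d_eq_zero (hg : g.IsNilpotent) (hd : ∀ x, g.d x = 0) {a b c : g.carrier}
    (ha : a ∈ g.deg 0) (hb : b ∈ g.deg 0) (hc : c ∈ g.deg 0) :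
    g.bch (g.bch a b) c = g.bch a (g.bch b c) := by
  have hN := hg.tensor (PolyForms.cdga k 1)
  have h := eval_one_eq hg hd (z := bch _ (bch _ (path g a) (path g b)) (path g c))
    (w := bch _ (path g a) (bch _ (path g b) (path g c))) ?_ ?_
  · simpa only [map_bch _ hN, eval_one_path] using h
  · rw [nexp_extRep_bch hN (bch_mem hN (path_mem ha) (path_mem hb)) (path_mem hc),
      nexp_extRep_bch hN (path_mem ha) (path_mem hb),
      nexp_extRep_bch hN (path_mem ha) (bch_mem hN (path_mem hb) (path_mem hc)),
      nexp_extRep_bch hN (path_mem hb) (path_mem hc), mul_assoc]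
  · simp only [map_bch _ hN, eval_zero_path, bch_zero_zero]

theorem bch_zero_left_of_d_eq_zero (hg : g.IsNilpotent) (hd : ∀ x, g.d x = 0) {a : g.carrier}
    (ha : a ∈ g.deg 0) : g.bch 0 a = a := by
  have hN := hg.tensor (PolyForms.cdga k 1)
  have h := eval_one_eq hg hd (z := bch _ (path g 0) (path g a)) (w := path g a) ?_ ?_
  · simpa only [map_bch _ hN, eval_one_path] using h
  · rw [nexp_extRep_bch hN (path_mem (zero_mem _)) (path_mem ha), map_zero, map_zero, nexp_zero,
      one_mul]
  · simp only [map_bch _ hN, eval_zero_path, bch_zero_zero]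

theorem bch_zero_right_of_d_eq_zero (hg : g.IsNilpotent) (hd : ∀ x, g.d x = 0) {a : g.carrier}
    (ha : a ∈ g.deg 0) : g.bch a 0 = a := by
  have hN := hg.tensor (PolyForms.cdga k 1)
  have h := eval_one_eq hg hd (z := bch _ (path g a) (path g 0)) (w := path g a) ?_ ?_
  · simpa only [map_bch _ hN, eval_one_path] using h
  · rw [nexp_extRep_bch hN (path_mem ha) (path_mem (zero_mem _)), map_zero, map_zero, nexp_zero,
      mul_one]
  · simp only [map_bch _ hN, eval_zero_path, bch_zero_zero]

theorem bch_neg_left_of_d_eq_zero (hg : g.IsNilpotent) (hd : ∀ x, g.d x = 0) {a : g.carrier}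
    (ha : a ∈ g.deg 0) : g.bch (-a) a = 0 := by
  have hN := hg.tensor (PolyForms.cdga k 1)
  have h := eval_one_eq hg hd (z := bch _ (path g (-a)) (path g a)) (w := path g 0) ?_ ?_
  · simpa only [map_bch _ hN, eval_one_path] using h
  · rw [nexp_extRep_bch hN (path_mem (neg_mem ha)) (path_mem ha), map_neg, map_neg,
      nexp_neg_mul_nexp k (isNilpotent_extRep hN _), map_zero, map_zero, nexp_zero]
  · simp only [map_bch _ hN, eval_zero_path, bch_zero_zero]

theorem bch_assoc (hg : g.IsNilpotent) {a b c : g.carrier} (ha : a ∈ g.deg 0) (hb : b ∈ g.deg 0)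
    (hc : c ∈ g.deg 0) : g.bch (g.bch a b) c = g.bch a (g.bch b c) := by
  have h := bch_assoc_of_d_eq_zero hg.flat (fun _ => rfl) ha hb hc
  simp only [bch_flat] at h
  exact h

theorem bch_zero_left (hg : g.IsNilpotent) {a : g.carrier} (ha : a ∈ g.deg 0) : g.bch 0 a = a :=
  (bch_flat g 0 a).symm.trans (bch_zero_left_of_d_eq_zero hg.flat (fun _ => rfl) ha)

theorem bch_zero_right (hg : g.IsNilpotent) {a : g.carrier} (ha : a ∈ g.deg 0) : g.bch a 0 = a :=
  (bch_flat g a 0).symm.trans (bch_zero_right_of_d_eq_zero hg.flat (fun _ => rfl) ha)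

theorem bch_neg_left (hg : g.IsNilpotent) {a : g.carrier} (ha : a ∈ g.deg 0) :
    g.bch (-a) a = 0 :=
  (bch_flat g (-a) a).symm.trans (bch_neg_left_of_d_eq_zero hg.flat (fun _ => rfl) ha)

end Path

end DGLieAlgebra

open DGLieAlgebra

/-- The group `exp g⁰` of a nilpotent dg Lie algebra, with underlying set `g⁰`. -/
def ExpGroup {k : Type u} [Field k] (g : NilpotentDGLie k) : Type u :=
  {a : g.obj.carrier // a ∈ g.obj.deg 0}

namespace ExpGroup

variable {k : Type u} [Field k] [CharZero k] {g h : NilpotentDGLie k}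

instance : Group (ExpGroup g) where
  mul a b := ⟨g.obj.bch a.1 b.1, bch_mem g.property a.2 b.2⟩
  one := ⟨0, zero_mem _⟩
  inv a := ⟨-a.1, neg_mem a.2⟩
  mul_assoc a b c := Subtype.ext (bch_assoc g.property a.2 b.2 c.2)
  one_mul a := Subtype.ext (bch_zero_left g.property a.2)
  mul_one a := Subtype.ext (bch_zero_right g.property a.2)
  inv_mul_cancel a := Subtype.ext (bch_neg_left g.property a.2)

/-- The gauge action on Maurer-Cartan elements. -/
instance : MulAction (ExpGroup g) g.obj.MC where
  smul a x := ⟨g.obj.gauge a.1 x.1, gauge_mem g.property a.2 x.2.1,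
    gauge_curvature g.property a.2 x.2.1 x.2.2⟩
  one_smul x := Subtype.ext (gauge_zero g.property x.1)
  mul_smul a b x := Subtype.ext (gauge_bch g.property a.2 b.2 x.1)

/-- Functoriality of the group `exp g⁰`. -/
def map (f : g ⟶ h) : ExpGroup g →* ExpGroup h where
  toFun a := ⟨f.hom.toLinearMap a.1, f.hom.map_mem a.2⟩
  map_one' := Subtype.ext (map_zero _)
  map_mul' a b := Subtype.ext (map_bch f.hom g.property a.1 b.1)

theorem map_smul (f : g ⟶ h) (a : ExpGroup g) (x : g.obj.MC) :
    MC.map f.hom (a • x) = map f a • MC.map f.hom x :=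
  Subtype.ext (map_gauge f.hom g.property a.1 x.1)

end ExpGroup

/-! ### Contractive maps for the lower central filtration -/

/-- A map which is contractive for a finite filtration has a unique fixed point. -/
theorem exists_unique_fixedPoint {k V : Type*} [Field k] [AddCommGroup V] [Module k V]
    (S : Submodule k V) (F : ℕ → Submodule k V) (h0 : F 0 = ⊤) {N : ℕ} (hN : F N = ⊥) {T : V → V}
    (hT : ∀ v ∈ S, T v ∈ S)
    (hF : ∀ m, ∀ v ∈ S, ∀ w ∈ S, v - w ∈ F m → T v - T w ∈ F (m + 1)) :
    ∃ v, (v ∈ S ∧ T v = v) ∧ ∀ w, w ∈ S ∧ T w = w → w = v := by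
  have hmem : ∀ m, ∀ v ∈ S, T^[m] v ∈ S := by
    intro m
    induction m with
    | zero => exact fun v hv => hv
    | succ m ih => exact fun v hv => ih _ (hT v hv)
  have key : ∀ m, ∀ v ∈ S, ∀ w ∈ S, T^[m] v - T^[m] w ∈ F m := by
    intro m
    induction m with
    | zero => intro v _ w _; rw [h0]; trivial
    | succ m ih =>
      intro v hv w hw
      rw [Function.iterate_succ_apply', Function.iterate_succ_apply']
      exact hF m _ (hmem m v hv) _ (hmem m w hw) (ih v hv w hw)
  have const : ∀ v ∈ S, ∀ w ∈ S, T^[N] v = T^[N] w := fun v hv w hw => by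
    have h := key N v hv w hw
    rw [hN, Submodule.mem_bot] at h
    exact sub_eq_zero.1 h
  have h0S := S.zero_mem
  refine ⟨T^[N] 0, ⟨hmem N 0 h0S, ?_⟩, ?_⟩
  · rw [← Function.iterate_succ_apply' T, Function.iterate_succ_apply]
    exact const _ (hT 0 h0S) _ h0S
  · rintro w ⟨hw, hTw⟩
    rw [const 0 h0S w hw, Function.iterate_fixed hTw]

namespace DGLieAlgebra

variable {k : Type u} [Field k]

section Filtration

variable {A : CommDGAlgebra k} {g : DGLieAlgebra k}

theorem d_lcs_mem (m : ℕ) {x : g.carrier} (hx : x ∈ g.lcs m) : g.d x ∈ g.lcs m := by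
  induction m generalizing x with
  | zero => exact Submodule.mem_top
  | succ m ih =>
    have h : g.lcs (m + 1) ≤ (g.lcs (m + 1)).comap g.d := by
      refine Submodule.map₂_le.2 fun a _ y hy => ?_
      refine graded_induction g.isInternal
        (p := fun a => g.bracket a y ∈ (g.lcs (m + 1)).comap g.d) ?_ ?_ a
      · intro i a ha
        rw [Submodule.mem_comap, g.d_bracket y ha, Units.smul_def]
        exact add_mem (Submodule.apply_mem_map₂ _ Submodule.mem_top hy)
          (zsmul_mem (Submodule.apply_mem_map₂ _ Submodule.mem_top (ih hy)) _)
      · intro a b h1 h2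
        rw [map_add, LinearMap.add_apply]
        exact add_mem h1 h2
    exact h hx

variable (A g) in
/-- The filtration of `A ⊗ g` by the lower central series of `g`. -/
def fil (m : ℕ) : Submodule k (tensor A g).carrier := Submodule.map₂ (pure A g) ⊤ (g.lcs m)

theorem pure_mem_fil {m : ℕ} (a : A.carrier) {x : g.carrier} (hx : x ∈ g.lcs m) :
    pure A g a x ∈ fil A g m := Submodule.apply_mem_map₂ _ Submodule.mem_top hx

theorem fil_zero : fil A g 0 = ⊤ := TensorProduct.map₂_mk_top_top_eq_top ..

theorem fil_eq_bot {n : ℕ} (h : g.lcs n = ⊥) : fil A g n = ⊥ := by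
  rw [fil, h, Submodule.map₂_bot_right]

theorem lcs_succ_le (m : ℕ) : g.lcs (m + 1) ≤ g.lcs m := by
  induction m with
  | zero => exact le_top
  | succ m ih => exact Submodule.map₂_le_map₂_right ih

theorem fil_succ_le (m : ℕ) : fil A g (m + 1) ≤ fil A g m :=
  Submodule.map₂_le_map₂_right (lcs_succ_le m)

theorem formOp_mem_fil (η : A.carrier →ₗ[k] A.carrier) {m : ℕ} {z : (tensor A g).carrier}
    (hz : z ∈ fil A g m) : formOp g η z ∈ fil A g m := by
  have h : fil A g m ≤ (fil A g m).comap (formOp g η) := by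
    refine Submodule.map₂_le.2 fun a _ x hx => ?_
    rw [Submodule.mem_comap, formOp_pure]
    exact pure_mem_fil _ hx
  exact h hz

theorem d_mem_fil {m : ℕ} {z : (tensor A g).carrier} (hz : z ∈ fil A g m) :
    (tensor A g).d z ∈ fil A g m := by
  have h : fil A g m ≤ (fil A g m).comap (tensor A g).d := by
    refine Submodule.map₂_le.2 fun a _ x hx => ?_
    refine graded_induction A.isInternal
      (p := fun a => pure A g a x ∈ (fil A g m).comap (tensor A g).d) ?_ ?_ a
    · intro p a ha
      rw [Submodule.mem_comap, d_pure x ha, Units.smul_def]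
      exact add_mem (pure_mem_fil _ hx) (zsmul_mem (pure_mem_fil _ (d_lcs_mem m hx)) _)
    · intro a b h1 h2
      rw [map_add, LinearMap.add_apply]
      exact add_mem h1 h2
  exact h hz

theorem bracket_mem_fil {m : ℕ} (w : (tensor A g).carrier) {z : (tensor A g).carrier}
    (hz : z ∈ fil A g m) : (tensor A g).bracket w z ∈ fil A g (m + 1) := by
  refine homogeneous_induction (P := fun w => (tensor A g).bracket w z ∈ fil A g (m + 1)) ?_ ?_ w
  · intro p i a x ha hx
    have h : fil A g m ≤ (fil A g (m + 1)).comap ((tensor A g).bracket (pure A g a x)) := by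
      refine Submodule.map₂_le.2 fun b _ y hy => ?_
      refine graded_induction A.isInternal (p := fun b => pure A g b y ∈
        (fil A g (m + 1)).comap ((tensor A g).bracket (pure A g a x))) ?_ ?_ b
      · intro q b hb
        rw [Submodule.mem_comap, bracket_pure a y hx hb, Units.smul_def]
        exact zsmul_mem (pure_mem_fil _ (Submodule.apply_mem_map₂ _ Submodule.mem_top hy)) _
      · intro b b' h1 h2
        rw [map_add, LinearMap.add_apply]
        exact add_mem h1 h2
    exact h hz
  · intro z w h1 h2
    rw [map_add, LinearMap.add_apply]
    exact add_mem h1 h2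

end Filtration

/-! ### Estimates for the Baker-Campbell-Hausdorff product and the gauge action -/

section Estimate

variable {g : DGLieAlgebra k} {F F' : Submodule k g.carrier}

/-- If `[g, F] ⊆ F'`, then also `[z, g] ⊆ F'` for homogeneous `z` in `F`, by skew symmetry. The
submodule `F` itself need not be graded. -/
theorem bracket_mem_left (hF : ∀ w, ∀ z ∈ F, g.bracket w z ∈ F') {i : ℤ} {z : g.carrier}
    (hz : z ∈ F) (hi : z ∈ g.deg i) (w : g.carrier) : g.bracket z w ∈ F' := by
  refine graded_induction g.isInternal (p := fun w => g.bracket z w ∈ F') ?_ ?_ w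
  · intro j w hw
    rw [g.bracket_skew hi hw, Units.smul_def]
    exact neg_mem (zsmul_mem (hF w z hz) _)
  · intro a b h1 h2
    rw [map_add]
    exact add_mem h1 h2

theorem bracket_sub_mem (hF : ∀ w, ∀ z ∈ F, g.bracket w z ∈ F') {i : ℤ} {a b z w : g.carrier}
    (ha : a ∈ g.deg i) (hb : b ∈ g.deg i) (hab : a - b ∈ F) (hzw : z - w ∈ F) :
    g.bracket a z - g.bracket b w ∈ F' := by
  have e : g.bracket a z - g.bracket b w = g.bracket (a - b) z + g.bracket b (z - w) := by
    rw [map_sub, map_sub, LinearMap.sub_apply]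
    abel
  rw [e]
  exact add_mem (bracket_mem_left hF hab (sub_mem ha hb) z) (hF b _ hzw)

theorem pow_bracket_sub_mem (hF : ∀ w, ∀ z ∈ F, g.bracket w z ∈ F') (hle : F' ≤ F)
    {a b z w : g.carrier} (ha : a ∈ g.deg 0) (hb : b ∈ g.deg 0) (hab : a - b ∈ F)
    (hzw : z - w ∈ F) (j : ℕ) :
    ((g.bracket a : Module.End k g.carrier) ^ (j + 1)) z -
      ((g.bracket b : Module.End k g.carrier) ^ (j + 1)) w ∈ F' := by
  induction j with
  | zero => simpa using bracket_sub_mem hF ha hb hab hzw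
  | succ j ih =>
    rw [pow_succ', pow_succ' _ (j + 1), Module.End.mul_apply, Module.End.mul_apply]
    exact bracket_sub_mem hF ha hb hab (hle ih)

theorem nestedBracket_sub_mem (hF : ∀ w, ∀ z ∈ F, g.bracket w z ∈ F') (hle : F' ≤ F)
    (L : List (g.carrier × g.carrier))
    (hL : ∀ p ∈ L, p.1 ∈ g.deg 0 ∧ p.2 ∈ g.deg 0 ∧ p.1 - p.2 ∈ F) :
    g.nestedBracket (L.map Prod.fst) - g.nestedBracket (L.map Prod.snd) ∈ F ∧
      (L.length ≠ 1 →
        g.nestedBracket (L.map Prod.fst) - g.nestedBracket (L.map Prod.snd) ∈ F') := by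
  induction L with
  | nil => simp [nestedBracket]
  | cons p L ih =>
    cases L with
    | nil => simpa [nestedBracket] using (hL p (by simp)).2.2
    | cons q L =>
      obtain ⟨h1, h2, h3⟩ := hL p (by simp)
      have := bracket_sub_mem hF h1 h2 h3 (ih fun r hr => hL r (List.mem_cons_of_mem _ hr)).1
      exact ⟨hle this, fun _ => this⟩

/-- The Baker-Campbell-Hausdorff product is the second argument, up to terms which are constant
or of higher order in it. -/
theorem bch_sub_bch_mem [CharZero k] (hg : g.IsNilpotent) (hF : ∀ w, ∀ z ∈ F, g.bracket w z ∈ F')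
    (hle : F' ≤ F) {x y y' : g.carrier} (hx : x ∈ g.deg 0) (hy : y ∈ g.deg 0)
    (hy' : y' ∈ g.deg 0) (h : y - y' ∈ F) : g.bch x y - g.bch x y' - (y - y') ∈ F' := by
  obtain ⟨n, hn⟩ := hg
  have hmem : [(0, 1)] ∈ bchIndex (n + 1) := by
    rw [mem_bchIndex]
    simp
  have hc : bchCoeff k [(0, 1)] = 1 := by simp [bchCoeff]
  have hw : ∀ z : g.carrier, g.nestedBracket (bchWord x z [(0, 1)]) = z := fun z => by
    simp [bchWord, nestedBracket]
  rw [bch_eq_sum hn (Nat.le_succ n), bch_eq_sum hn (Nat.le_succ n), ← Finset.sum_sub_distrib,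
    ← Finset.add_sum_erase _ _ hmem, hc, hw, hw, one_smul, one_smul, add_sub_cancel_left]
  refine sum_mem fun l hl => ?_
  rw [← smul_sub]
  refine Submodule.smul_mem _ _ ?_
  obtain ⟨hne, hl⟩ := Finset.mem_erase.1 hl
  rw [mem_bchIndex] at hl
  have key := nestedBracket_sub_mem hF hle (bchWord (x, x) (y, y') l) ?_
  · rw [map_bchWord, map_bchWord] at key
    by_cases h1 : (bchWord (x, x) (y, y') l).length = 1
    · -- the only remaining word of length one is `x`
      have h2 : l = [(1, 0)] := by
        rw [length_bchWord] at h1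
        have h2 := length_le_bchDeg hl.2.1
        rw [bchDeg, h1] at h2
        match l, h1, h2, hl.1, hne with
        | [(r, s)], h1, _, _, hne =>
          simp only [List.map_cons, List.map_nil, List.sum_cons, List.sum_nil] at h1
          have : r = 1 ∧ s = 0 ∨ r = 0 ∧ s = 1 := by omega
          rcases this with ⟨rfl, rfl⟩ | ⟨rfl, rfl⟩
          · rfl
          · exact absurd rfl hne
        | _ :: _ :: _, _, h2, _, _ => simp at h2
      simp [h2, bchWord, nestedBracket]
    · exact key.2 h1
  · intro p hp
    rcases mem_bchWord hp with rfl | rfl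
    · exact ⟨hx, hx, by simp⟩
    · exact ⟨hy, hy', h⟩

theorem finsum_pow_bracket_sub_mem (hg : g.IsNilpotent) (hF : ∀ w, ∀ z ∈ F, g.bracket w z ∈ F')
    (hle : F' ≤ F) (c : ℕ → k) {a b z w : g.carrier} (ha : a ∈ g.deg 0) (hb : b ∈ g.deg 0)
    (hab : a - b ∈ F) (hzw : z - w ∈ F) :
    (∑ᶠ j, c j • ((g.bracket a : Module.End k g.carrier) ^ j) z) -
      (∑ᶠ j, c j • ((g.bracket b : Module.End k g.carrier) ^ j) w) - c 0 • (z - w) ∈ F' := by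
  obtain ⟨n, hn⟩ := hg
  have hs : ∀ a z : g.carrier, ∑ᶠ j, c j • ((g.bracket a : Module.End k g.carrier) ^ j) z =
      ∑ j ∈ Finset.range (n + 1), c j • ((g.bracket a : Module.End k g.carrier) ^ j) z := by
    intro a z
    refine finsum_eq_sum_of_support_subset _ fun j hj => ?_
    rw [Finset.coe_range, Set.mem_Iio]
    by_contra hlt
    have h := pow_bracket_mem g a z j
    rw [lcs_eq_bot_of_le hn (by omega), Submodule.mem_bot] at h
    exact hj (by simp only [h, smul_zero])
  rw [hs, hs, ← Finset.sum_sub_distrib, Finset.sum_range_succ']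
  simp only [pow_zero, Module.End.one_apply, ← smul_sub, add_sub_cancel_right]
  exact sum_mem fun j _ => Submodule.smul_mem _ _ (pow_bracket_sub_mem hF hle ha hb hab hzw j)

/-- The gauge action of `exp a` on `x` is `x - da`, up to terms which are constant or of higher order
in `a`. -/
theorem gauge_sub_gauge_mem (hg : g.IsNilpotent) (hF : ∀ w, ∀ z ∈ F, g.bracket w z ∈ F')
    (hle : F' ≤ F) (hd : ∀ z ∈ F, g.d z ∈ F) {a b : g.carrier} (ha : a ∈ g.deg 0)
    (hb : b ∈ g.deg 0) (hab : a - b ∈ F) (x : g.carrier) :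
    g.gauge a x + g.d a - (g.gauge b x + g.d b) ∈ F' := by
  have h1 := finsum_pow_bracket_sub_mem hg hF hle (fun j => (j.factorial : k)⁻¹) ha hb hab
    (z := x) (w := x) (by simp)
  have h2 := finsum_pow_bracket_sub_mem hg hF hle (fun j => ((j + 1).factorial : k)⁻¹) ha hb hab
    (z := g.d a) (w := g.d b) (by rw [← map_sub]; exact hd _ hab)
  refine (congrArg (· ∈ F') ?_).mp (sub_mem h1 h2)
  simp only [gauge, sub_self, smul_zero, sub_zero, zero_add, Nat.factorial_one, Nat.cast_one,
    inv_one, one_smul]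
  abel

end Estimate

/-! ### Gauge transformations to constant Maurer-Cartan elements -/

namespace Contraction

variable {A B : CommDGAlgebra k} (C : Contraction A) {g h : DGLieAlgebra k}

/-- A Maurer-Cartan element `y` killed by the homotopy `η` is constant: by the homotopy formula both
`y` and its constant value `e` are fixed points of the contractive map `z ↦ e - η [z, z] / 2`. -/
theorem eq_const_of_formOp_η_eq_zero (hg : g.IsNilpotent) {y : (tensor A g).carrier}
    (h1 : y ∈ (tensor A g).deg 1)
    (h2 : (tensor A g).d y + (2 : k)⁻¹ • (tensor A g).bracket y y = 0)
    (h3 : formOp g C.η y = 0) :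
    y = (const A g).toLinearMap ((C.eval g).toLinearMap y) := by
  obtain ⟨n, hn⟩ := id hg
  set e := (const A g).toLinearMap ((C.eval g).toLinearMap y) with he
  have he1 : e ∈ (tensor A g).deg 1 := (const A g).map_mem ((C.eval g).map_mem h1)
  obtain ⟨v, -, hv⟩ := exists_unique_fixedPoint ((tensor A g).deg 1) (fil A g)
    (T := fun z => e - (2 : k)⁻¹ • formOp g C.η ((tensor A g).bracket z z))
    fil_zero (fil_eq_bot hn)
    (fun z hz => sub_mem he1 (Submodule.smul_mem _ _
      (C.formOp_η_mem 1 ((tensor A g).bracket_mem hz hz))))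
    (fun m z hz w hw h => by
      rw [sub_sub_sub_cancel_left, ← smul_sub, ← map_sub]
      refine Submodule.smul_mem _ _ (formOp_mem_fil _ (bracket_sub_mem
        (fun w z => bracket_mem_fil w) hw hz ?_ ?_)) <;>
      exact sub_mem_comm_iff.1 h)
  rw [hv y ⟨h1, ?_⟩, hv e ⟨he1, ?_⟩]
  · rw [he, ← (const A g).map_bracket, formOp_η_const, smul_zero, sub_zero]
  · have h4 := C.d_formOp_η y
    rw [h3, map_zero, zero_add, ← he] at h4
    have h5 := congrArg (formOp g C.η) h2
    rw [map_add, map_smul, map_zero, h4] at h5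
    rw [eq_comm, eq_sub_iff_add_eq, ← sub_eq_zero, ← h5]
    abel

variable [CharZero k]

/-- The map `c ↦ η (exp c • x + dc)` is contractive, since the terms of `exp c • x + dc` which involve
`c` are brackets. -/
theorem exists_unique_gaugeFix (hg : g.IsNilpotent) {x : (tensor A g).carrier}
    (hx : x ∈ (tensor A g).deg 1) :
    ∃ c, (c ∈ (tensor A g).deg 0 ∧ formOp g C.η ((tensor A g).gauge c x + (tensor A g).d c) = c) ∧
      ∀ c', c' ∈ (tensor A g).deg 0 ∧
        formOp g C.η ((tensor A g).gauge c' x + (tensor A g).d c') = c' → c' = c := by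
  obtain ⟨n, hn⟩ := id hg
  refine exists_unique_fixedPoint ((tensor A g).deg 0) (fil A g)
    (T := fun c => formOp g C.η ((tensor A g).gauge c x + (tensor A g).d c))
    fil_zero (fil_eq_bot hn) ?_ ?_
  · intro c hc
    exact C.formOp_η_mem 0 (add_mem (gauge_mem (hg.tensor A) hc hx) (d_mem_one hc))
  · intro m c hc c' hc' h
    rw [← map_sub]
    exact formOp_mem_fil _ (gauge_sub_gauge_mem (hg.tensor A) (fun w z => bracket_mem_fil w)
      (fil_succ_le m) (fun z => d_mem_fil) hc hc' h x)

/-- The unique `c` of degree `0` with `η (exp c • x + dc) = c`. By the side conditions on `η`,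
it satisfies `η c = 0`, `ε c = 0` and `η (exp c • x) = 0`. -/
def gaugeFix (hg : g.IsNilpotent) {x : (tensor A g).carrier} (hx : x ∈ (tensor A g).deg 1) :
    (tensor A g).carrier := (C.exists_unique_gaugeFix hg hx).choose

variable (hg : g.IsNilpotent) {x : (tensor A g).carrier} (hx : x ∈ (tensor A g).deg 1)

theorem gaugeFix_mem : C.gaugeFix hg hx ∈ (tensor A g).deg 0 :=
  (C.exists_unique_gaugeFix hg hx).choose_spec.1.1

theorem gaugeFix_eq : formOp g C.η ((tensor A g).gauge (C.gaugeFix hg hx) x +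
    (tensor A g).d (C.gaugeFix hg hx)) = C.gaugeFix hg hx :=
  (C.exists_unique_gaugeFix hg hx).choose_spec.1.2

theorem eq_gaugeFix {c : (tensor A g).carrier} (hc : c ∈ (tensor A g).deg 0)
    (h : formOp g C.η ((tensor A g).gauge c x + (tensor A g).d c) = c) :
    c = C.gaugeFix hg hx :=
  (C.exists_unique_gaugeFix hg hx).choose_spec.2 c ⟨hc, h⟩

theorem formOp_η_gaugeFix : formOp g C.η (C.gaugeFix hg hx) = 0 := by
  rw [← gaugeFix_eq, formOp_η_formOp_η]

theorem eval_gaugeFix : (C.eval g).toLinearMap (C.gaugeFix hg hx) = 0 := by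
  rw [← gaugeFix_eq, eval_formOp_η]

/-- As `η c = 0` and `ε c = 0`, the homotopy formula gives `η (dc) = c`. -/
theorem formOp_η_gauge :
    formOp g C.η ((tensor A g).gauge (C.gaugeFix hg hx) x) = 0 := by
  have h1 := C.gaugeFix_eq hg hx
  have h2 := C.d_formOp_η (C.gaugeFix hg hx)
  rw [formOp_η_gaugeFix, map_zero, zero_add, eval_gaugeFix, map_zero, sub_zero] at h2
  rw [map_add, h2] at h1
  simpa using h1

theorem tensorMap_gaugeFix {D : Contraction B} (f : A ⟶ B) (φ : g ⟶ h)
    (e : ∀ a, f.toAlgHom (C.η a) = D.η (f.toAlgHom a)) (hh : h.IsNilpotent)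
    (hx' : (tensorMap f φ).toLinearMap x ∈ (tensor B h).deg 1) :
    (tensorMap f φ).toLinearMap (C.gaugeFix hg hx) = D.gaugeFix hh hx' := by
  refine D.eq_gaugeFix hh hx' ((tensorMap f φ).map_mem (C.gaugeFix_mem hg hx)) ?_
  rw [← map_gauge _ (hg.tensor A), ← (tensorMap f φ).map_d, ← map_add,
    ← formOp_tensorMap f φ e, gaugeFix_eq]

/-- A Maurer-Cartan element of `A ⊗ g` is gauge equivalent to its constant value under the
augmentation. -/
theorem gauge_gaugeFix
    (h : (tensor A g).d x + (2 : k)⁻¹ • (tensor A g).bracket x x = 0) :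
    (tensor A g).gauge (C.gaugeFix hg hx) x =
      (const A g).toLinearMap ((C.eval g).toLinearMap x) := by
  have hN := hg.tensor A
  have h1 := C.eq_const_of_formOp_η_eq_zero hg (gauge_mem hN (C.gaugeFix_mem hg hx) hx)
    (gauge_curvature hN (C.gaugeFix_mem hg hx) hx h) (C.formOp_η_gauge hg hx)
  rwa [map_gauge _ hN, eval_gaugeFix, gauge_zero hg] at h1

theorem gaugeFix_const {y : g.carrier} (hy : (const A g).toLinearMap y ∈ (tensor A g).deg 1) :
    C.gaugeFix hg hy = 0 := by
  refine (C.eq_gaugeFix hg hy (zero_mem _) ?_).symm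
  rw [gauge_zero (hg.tensor A), map_zero, add_zero, formOp_η_const]

end Contraction

end DGLieAlgebra

/-! ### Barycentres in the exponential group -/

namespace DGLieAlgebra

variable {k : Type u} [Field k]

theorem formOp_mulLeft_sum {A : CommDGAlgebra k} {g : DGLieAlgebra k} {ι : Type*} (s : Finset ι)
    (f : ι → A.carrier) (z : (tensor A g).carrier) :
    ∑ i ∈ s, formOp g (LinearMap.mulLeft k (f i)) z =
      formOp g (LinearMap.mulLeft k (∑ i ∈ s, f i)) z := by
  refine pure_induction (P := fun z => ∑ i ∈ s, formOp g (LinearMap.mulLeft k (f i)) z =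
      formOp g (LinearMap.mulLeft k (∑ i ∈ s, f i)) z) ?_ ?_ z
  · intro a x
    simp only [formOp_pure, LinearMap.mulLeft_apply, Finset.sum_mul, map_sum,
      LinearMap.coe_sum, Finset.sum_apply]
  · intro z w h1 h2
    simp only [map_add, Finset.sum_add_distrib, h1, h2]

theorem formOp_mulLeft_one {A : CommDGAlgebra k} {g : DGLieAlgebra k}
    (z : (tensor A g).carrier) : formOp g (LinearMap.mulLeft k (1 : A.carrier)) z = z := by
  refine pure_induction (P := fun z => formOp g (LinearMap.mulLeft k (1 : A.carrier)) z = z)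
    ?_ ?_ z
  · intro a x
    rw [formOp_pure, LinearMap.mulLeft_apply, one_mul]
  · intro z w h1 h2
    rw [map_add, h1, h2]

theorem formOp_mulLeft_mem {A : CommDGAlgebra k} {g : DGLieAlgebra k} {f : A.carrier}
    (hf : f ∈ A.deg 0) {m : ℤ} {z : (tensor A g).carrier} (hz : z ∈ (tensor A g).deg m) :
    formOp g (LinearMap.mulLeft k f) z ∈ (tensor A g).deg m := by
  have h := formOp_mem (η := LinearMap.mulLeft k f) (e := 0) (fun {p a} ha => by
    rw [LinearMap.mulLeft_apply, add_comm p]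
    exact A.mul_mem hf ha) hz
  rwa [add_zero] at h

end DGLieAlgebra

/-- The nilpotent dg Lie algebra `A ⊗ g`. -/
def tensorObj {k : Type u} [Field k] (A : CommDGAlgebra k) (g : NilpotentDGLie k) :
    NilpotentDGLie k := ⟨tensor A g.obj, g.property.tensor A⟩

/-- The morphism `f ⊗ φ : A ⊗ g ⟶ B ⊗ h` of nilpotent dg Lie algebras. -/
def tensorHom {k : Type u} [Field k] {A B : CommDGAlgebra k}
    {g h : NilpotentDGLie k} (f : A ⟶ B) (φ : g ⟶ h) : tensorObj A g ⟶ tensorObj B h :=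
  ObjectProperty.homMk (tensorMap f φ.hom)

/-- A family of elements of degree `0` of a commutative dg algebra with sum `1`, to be used as the
weights of a barycentre. -/
structure WeightSystem {k : Type u} [Field k] (A : CommDGAlgebra k) (ι : Type*)
    [Fintype ι] where
  toFun : ι → A.carrier
  mem : ∀ i, toFun i ∈ A.deg 0
  sum_eq : ∑ i, toFun i = 1

namespace WeightSystem

variable {k : Type u} [Field k] {A B : CommDGAlgebra k} {g h : NilpotentDGLie k}
  {ι κ : Type*} [Fintype ι] [Fintype κ]

/-- The weighted sum `∑ fᵢ aᵢ` in `A ⊗ g`. -/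
def weightedSum (P : WeightSystem A ι) (a : ι → (tensor A g.obj).carrier) :
    (tensor A g.obj).carrier :=
  ∑ i, formOp g.obj (LinearMap.mulLeft k (P.toFun i)) (a i)

theorem weightedSum_const (P : WeightSystem A ι) (a : (tensor A g.obj).carrier) :
    P.weightedSum (fun _ => a) = a := by
  rw [weightedSum, formOp_mulLeft_sum, P.sum_eq, formOp_mulLeft_one]

theorem map_weightedSum [DecidableEq ι] (P : WeightSystem A ι) (Q : WeightSystem B κ)
    (f : A ⟶ B) (φ : g ⟶ h) (θ : κ → ι)
    (e : ∀ i, f.toAlgHom (P.toFun i) = ∑ j with θ j = i, Q.toFun j)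
    (a : ι → (tensor A g.obj).carrier) :
    (tensorMap f φ.hom).toLinearMap (P.weightedSum a) =
      Q.weightedSum fun j => (tensorMap f φ.hom).toLinearMap (a (θ j)) := by
  rw [weightedSum, map_sum, weightedSum, ← Finset.sum_fiberwise _ θ]
  refine Finset.sum_congr rfl fun i _ => ?_
  rw [formOp_tensorMap f φ.hom (θ := LinearMap.mulLeft k (f.toAlgHom (P.toFun i)))
    (fun b => by simp), e, ← formOp_mulLeft_sum]
  refine Finset.sum_congr rfl fun j hj => ?_
  rw [(Finset.mem_filter.1 hj).2]

variable [CharZero k]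

/-- The barycentric equation `∑ fᵢ (aᵢ b⁻¹) = 0` has a unique solution `b`: modulo terms of higher
order its left hand side is `∑ fᵢ aᵢ - b`. -/
theorem exists_unique_barycentre (P : WeightSystem A ι) (a : ι → ExpGroup (tensorObj A g)) :
    ∃ b, P.weightedSum (fun i => (a i * b⁻¹).1) = 0 ∧
      ∀ b', P.weightedSum (fun i => (a i * b'⁻¹).1) = 0 → b' = b := by
  obtain ⟨n, hn⟩ := id g.property
  let L := tensor A g.obj
  have hL : L.IsNilpotent := g.property.tensor A
  let S : L.carrier → L.carrier := fun b =>
    ∑ i, formOp g.obj (LinearMap.mulLeft k (P.toFun i)) (L.bch (a i).1 (-b))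
  obtain ⟨b, ⟨hb, hb'⟩, huniq⟩ := exists_unique_fixedPoint (L.deg 0) (fil A g.obj)
    (T := fun b => b + S b) fil_zero (fil_eq_bot hn)
    (fun b hb => add_mem hb (sum_mem fun i _ => formOp_mulLeft_mem (P.mem i)
      (bch_mem hL (a i).2 (neg_mem hb)))) (fun m b hb c hc hbc => by
      have key : ∀ z : L.carrier,
          z = ∑ i, formOp g.obj (LinearMap.mulLeft k (P.toFun i)) z := fun z => by
        rw [formOp_mulLeft_sum, P.sum_eq, formOp_mulLeft_one]
      have e : b + S b - (c + S c) = ∑ i, formOp g.obj (LinearMap.mulLeft k (P.toFun i))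
          (L.bch (a i).1 (-b) - L.bch (a i).1 (-c) - (-b - -c)) := by
        simp only [map_sub, Finset.sum_sub_distrib, ← key]
        simp only [S]
        abel
      rw [e]
      refine sum_mem fun i _ => formOp_mem_fil _ (bch_sub_bch_mem hL
        (fun w z => bracket_mem_fil w) (fil_succ_le m) (a i).2 (neg_mem hb) (neg_mem hc) ?_)
      rw [← neg_sub']
      exact neg_mem hbc)
  refine ⟨⟨b, hb⟩, ?_, fun b' hb' => ?_⟩
  · exact left_eq_add.1 hb'.symm
  · exact Subtype.ext (huniq b'.1 ⟨b'.2, (congrArg (fun z => b'.1 + z) hb').trans (add_zero _)⟩)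

/-- The barycentre of the `aᵢ` with weights `fᵢ`: the unique `b` with `∑ fᵢ (aᵢ b⁻¹) = 0`. -/
def barycentre (P : WeightSystem A ι) (a : ι → ExpGroup (tensorObj A g)) :
    ExpGroup (tensorObj A g) := (P.exists_unique_barycentre a).choose

theorem weightedSum_barycentre (P : WeightSystem A ι) (a : ι → ExpGroup (tensorObj A g)) :
    P.weightedSum (fun i => (a i * (P.barycentre a)⁻¹).1) = 0 :=
  (P.exists_unique_barycentre a).choose_spec.1

theorem eq_barycentre (P : WeightSystem A ι) {a : ι → ExpGroup (tensorObj A g)}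
    {b : ExpGroup (tensorObj A g)} (h : P.weightedSum (fun i => (a i * b⁻¹).1) = 0) :
    b = P.barycentre a :=
  (P.exists_unique_barycentre a).choose_spec.2 b h

theorem barycentre_const (P : WeightSystem A ι) (a : ExpGroup (tensorObj A g)) :
    P.barycentre (fun _ : ι => a) = a := by
  refine (P.eq_barycentre ?_).symm
  exact (P.weightedSum_const _).trans (congrArg Subtype.val (mul_inv_cancel a))

/-- Right translations preserve barycentres. -/
theorem barycentre_mul (P : WeightSystem A ι) (a : ι → ExpGroup (tensorObj A g))
    (c : ExpGroup (tensorObj A g)) :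
    P.barycentre (fun i => a i * c) = P.barycentre a * c := by
  refine (P.eq_barycentre ?_).symm
  have e : ∀ i, a i * c * (P.barycentre a * c)⁻¹ = a i * (P.barycentre a)⁻¹ := fun i => by group
  simp only [e]
  exact P.weightedSum_barycentre a

theorem map_barycentre [DecidableEq ι] (P : WeightSystem A ι) (Q : WeightSystem B κ)
    (f : A ⟶ B) (φ : g ⟶ h) (θ : κ → ι)
    (e : ∀ i, f.toAlgHom (P.toFun i) = ∑ j with θ j = i, Q.toFun j)
    (a : ι → ExpGroup (tensorObj A g)) :
    ExpGroup.map (tensorHom f φ) (P.barycentre a) =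
      Q.barycentre fun j => ExpGroup.map (tensorHom f φ) (a (θ j)) := by
  refine Q.eq_barycentre ?_
  simp only [← map_inv, ← map_mul]
  refine (P.map_weightedSum Q f φ θ e fun i => (a i * (P.barycentre a)⁻¹).1).symm.trans ?_
  rw [weightedSum_barycentre, map_zero]

end WeightSystem

variable (k : Type u) [Field k] in
/-- The barycentric coordinates `t₀, …, tₙ` in `Ω_n`. -/
def barycentricCoordinates (n : ℕ) : WeightSystem (PolyForms.cdga k n) (Fin (n + 1)) where
  toFun := fun i => (PolyForms.t i : PolyForms.Alg k n)
  mem := PolyForms.t_mem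
  sum_eq := PolyForms.sum_t n

/-! ### Chains in the Deligne groupoid -/

/-- An `n`-simplex of the nerve of the Deligne groupoid of `A ⊗ g`, whose objects are the
Maurer-Cartan elements of `A ⊗ g` and whose morphisms are the gauge transformations. All the
morphisms between the vertices are recorded, not only those in the direction of the order. -/
structure GaugeChain {k : Type u} [Field k] [CharZero k] (A : CommDGAlgebra k)
    (g : NilpotentDGLie k) (n : ℕ) : Type u where
  obj : Fin (n + 1) → (tensorObj A g).obj.MC
  hom : Fin (n + 1) → Fin (n + 1) → ExpGroup (tensorObj A g)
  hom_smul : ∀ i j, hom i j • obj i = obj j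
  hom_mul : ∀ i j l, hom j l * hom i j = hom i l

namespace GaugeChain

variable {k : Type u} [Field k] [CharZero k] {A B C : CommDGAlgebra k}
  {g h l : NilpotentDGLie k} {n m p : ℕ}

theorem eq_of {s s' : GaugeChain A g n} (h : ∀ i, s.obj i = s'.obj i)
    (h' : ∀ i j, s.hom i j = s'.hom i j) : s = s' := by
  cases s
  cases s'
  obtain rfl := funext h
  obtain rfl : _ = _ := funext fun i => funext fun j => h' i j
  rfl

theorem hom_self (s : GaugeChain A g n) (i : Fin (n + 1)) : s.hom i i = 1 :=
  mul_eq_left.1 (s.hom_mul i i i)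

theorem hom_inv (s : GaugeChain A g n) (i j : Fin (n + 1)) : (s.hom i j)⁻¹ = s.hom j i :=
  inv_eq_of_mul_eq_one_left ((s.hom_mul i j i).trans (s.hom_self i))

/-- Functoriality of chains in `A`, `g` and the set of vertices. -/
def map (f : A ⟶ B) (φ : g ⟶ h) (θ : Fin (m + 1) → Fin (n + 1)) (s : GaugeChain A g n) :
    GaugeChain B h m where
  obj i := MC.map (tensorHom f φ).hom (s.obj (θ i))
  hom i j := ExpGroup.map (tensorHom f φ) (s.hom (θ i) (θ j))
  hom_smul i j := by rw [← ExpGroup.map_smul, s.hom_smul]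
  hom_mul i j l := by rw [← map_mul, s.hom_mul]

theorem map_id (s : GaugeChain A g n) : s.map (𝟙 A) (𝟙 g) id = s := by
  refine eq_of (fun i => Subtype.ext ?_) (fun i j => Subtype.ext ?_)
  · exact LinearMap.congr_fun (congrArg Hom.toLinearMap (tensorMap_id A g.obj)) _
  · exact LinearMap.congr_fun (congrArg Hom.toLinearMap (tensorMap_id A g.obj)) _

theorem map_map (f : A ⟶ B) (f' : B ⟶ C) (φ : g ⟶ h) (φ' : h ⟶ l)
    (θ : Fin (m + 1) → Fin (n + 1)) (θ' : Fin (p + 1) → Fin (m + 1)) (s : GaugeChain A g n) :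
    (s.map f φ θ).map f' φ' θ' = s.map (f ≫ f') (φ ≫ φ') (θ ∘ θ') := by
  have e := congrArg Hom.toLinearMap (DGLieAlgebra.tensorMap_comp f f' φ.hom φ'.hom)
  refine eq_of (fun i => Subtype.ext ?_) (fun i j => Subtype.ext ?_)
  · exact (LinearMap.congr_fun e _).symm
  · exact (LinearMap.congr_fun e _).symm

/-- The chain obtained by applying a gauge transformation at each vertex. -/
def twist (s : GaugeChain A g n) (u : Fin (n + 1) → ExpGroup (tensorObj A g)) :
    GaugeChain A g n where
  obj i := u i • s.obj i
  hom i j := u j * s.hom i j * (u i)⁻¹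
  hom_smul i j := by rw [mul_smul, inv_smul_smul, mul_smul, s.hom_smul]
  hom_mul i j l := by rw [← s.hom_mul i j l]; group

theorem twist_one (s : GaugeChain A g n) : s.twist (fun _ => 1) = s :=
  eq_of (fun i => one_smul _ _) (fun i j => by simp [twist])

theorem map_twist (f : A ⟶ B) (φ : g ⟶ h) (θ : Fin (m + 1) → Fin (n + 1))
    (s : GaugeChain A g n) (u : Fin (n + 1) → ExpGroup (tensorObj A g)) :
    (s.twist u).map f φ θ =
      (s.map f φ θ).twist fun i => ExpGroup.map (tensorHom f φ) (u (θ i)) :=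
  eq_of (fun i => ExpGroup.map_smul _ _ _) (fun i j => by simp [twist, map])

/-- The chain of identities at a Maurer-Cartan element. -/
def const (A : CommDGAlgebra k) (g : NilpotentDGLie k) (n : ℕ) (x : (tensorObj A g).obj.MC) :
    GaugeChain A g n where
  obj _ := x
  hom _ _ := 1
  hom_smul _ _ := one_smul _ _
  hom_mul _ _ _ := one_mul _

theorem map_const (f : A ⟶ B) (φ : g ⟶ h) (θ : Fin (m + 1) → Fin (n + 1))
    (x : (tensorObj A g).obj.MC) :
    (const A g n x).map f φ θ = const B h m (MC.map (tensorHom f φ).hom x) :=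
  eq_of (fun _ => rfl) (fun _ _ => map_one _)

/-- The barycentre of a chain, as a gauge transformation based at the vertex `i`. -/
def centre (P : WeightSystem A (Fin (n + 1))) (s : GaugeChain A g n) (i : Fin (n + 1)) :
    ExpGroup (tensorObj A g) := P.barycentre fun j => s.hom i j

theorem centre_mul_hom (P : WeightSystem A (Fin (n + 1))) (s : GaugeChain A g n)
    (i j : Fin (n + 1)) : centre P s j * s.hom i j = centre P s i := by
  rw [centre, ← P.barycentre_mul, centre]
  simp only [s.hom_mul]

theorem centre_smul (P : WeightSystem A (Fin (n + 1))) (s : GaugeChain A g n)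
    (i j : Fin (n + 1)) : centre P s i • s.obj i = centre P s j • s.obj j := by
  rw [← centre_mul_hom P s i j, mul_smul, s.hom_smul]

/-- The Maurer-Cartan element at the barycentre of a chain. -/
def centrePoint (P : WeightSystem A (Fin (n + 1))) (s : GaugeChain A g n) :
    (tensorObj A g).obj.MC := centre P s 0 • s.obj 0

theorem twist_centre (P : WeightSystem A (Fin (n + 1))) (s : GaugeChain A g n) :
    s.twist (centre P s) = const A g n (centrePoint P s) :=
  eq_of (fun i => centre_smul P s i 0) (fun i j => by
    change centre P s j * s.hom i j * (centre P s i)⁻¹ = 1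
    rw [centre_mul_hom, mul_inv_cancel])

theorem centre_const (P : WeightSystem A (Fin (n + 1))) (x : (tensorObj A g).obj.MC)
    (i : Fin (n + 1)) : centre P (const A g n x) i = 1 := P.barycentre_const 1

theorem centrePoint_const (P : WeightSystem A (Fin (n + 1))) (x : (tensorObj A g).obj.MC) :
    centrePoint P (const A g n x) = x := by
  rw [centrePoint, centre_const, one_smul]
  rfl

theorem map_centre (P : WeightSystem A (Fin (n + 1))) (Q : WeightSystem B (Fin (m + 1)))
    (f : A ⟶ B) (φ : g ⟶ h) (θ : Fin (m + 1) → Fin (n + 1))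
    (e : ∀ i, f.toAlgHom (P.toFun i) = ∑ j with θ j = i, Q.toFun j) (s : GaugeChain A g n)
    (i : Fin (m + 1)) :
    ExpGroup.map (tensorHom f φ) (centre P s (θ i)) = centre Q (s.map f φ θ) i :=
  P.map_barycentre Q f φ θ e _

theorem map_centrePoint (P : WeightSystem A (Fin (n + 1))) (Q : WeightSystem B (Fin (m + 1)))
    (f : A ⟶ B) (φ : g ⟶ h) (θ : Fin (m + 1) → Fin (n + 1))
    (e : ∀ i, f.toAlgHom (P.toFun i) = ∑ j with θ j = i, Q.toFun j) (s : GaugeChain A g n) :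
    MC.map (tensorHom f φ).hom (centrePoint P s) = centrePoint Q (s.map f φ θ) := by
  rw [centrePoint, centre_smul P s 0 (θ 0), ExpGroup.map_smul, map_centre P Q f φ θ e]
  rfl

end GaugeChain

/-! ### Comparison with the nerve of the simplicial Deligne groupoid -/

/-- The constant Maurer-Cartan element `1 ⊗ x` of `A ⊗ g`. -/
def constMC {k : Type u} [Field k] (A : CommDGAlgebra k) (g : NilpotentDGLie k) (x : g.obj.MC) :
    (tensorObj A g).obj.MC := MC.map (DGLieAlgebra.const A g.obj) x

theorem map_constMC {k : Type u} [Field k] {A B : CommDGAlgebra k} {g h : NilpotentDGLie k}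
    (f : A ⟶ B) (φ : g ⟶ h) (x : g.obj.MC) :
    MC.map (tensorHom f φ).hom (constMC A g x) = constMC B h (MC.map φ.hom x) :=
  Subtype.ext (LinearMap.congr_fun
    (congrArg Hom.toLinearMap (const_tensorMap f φ.hom)) x.1)

namespace GaugeChain

variable {k : Type u} [Field k] [CharZero k] {A B : CommDGAlgebra k}
  {g h : NilpotentDGLie k} {n m : ℕ}

/-- The morphisms of a simplex of the nerve of the simplicial Deligne groupoid, as elements of
`exp (A ⊗ g)⁰`. -/
def deligneHom (s : DeligneNerveSimplex A g.obj n) (i j : Fin (n + 1)) (hij : i ≤ j) :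
    ExpGroup (tensorObj A g) := ⟨s.hom i j hij, (s.isMorphism i j hij).1⟩

theorem deligneHom_mul (s : DeligneNerveSimplex A g.obj n) {i j l : Fin (n + 1)} (hij : i ≤ j)
    (hjl : j ≤ l) : deligneHom s j l hjl * deligneHom s i j hij =
      deligneHom s i l (hij.trans hjl) :=
  Subtype.ext (s.hom_comp i j l hij hjl).symm

theorem deligneHom_smul (s : DeligneNerveSimplex A g.obj n) {i j : Fin (n + 1)} (hij : i ≤ j) :
    deligneHom s i j hij • constMC A g (s.obj i) = constMC A g (s.obj j) :=
  Subtype.ext (s.isMorphism i j hij).2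

/-- A simplex of the nerve of the simplicial Deligne groupoid as a chain with constant objects. -/
def ofDeligne (s : DeligneNerveSimplex A g.obj n) : GaugeChain A g n where
  obj i := constMC A g (s.obj i)
  hom i j := deligneHom s 0 j (Fin.zero_le j) * (deligneHom s 0 i (Fin.zero_le i))⁻¹
  hom_smul i j := by
    rw [mul_smul, ← deligneHom_smul s (Fin.zero_le i), inv_smul_smul, deligneHom_smul]
  hom_mul i j l := by group

theorem ofDeligne_hom (s : DeligneNerveSimplex A g.obj n) {i j : Fin (n + 1)} (hij : i ≤ j) :
    (ofDeligne s).hom i j = deligneHom s i j hij :=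
  mul_inv_eq_iff_eq_mul.2 (deligneHom_mul s (Fin.zero_le i) hij).symm

theorem map_ofDeligne (f : A ⟶ B) (φ : g ⟶ h) (θ : Fin (m + 1) →o Fin (n + 1))
    (s : DeligneNerveSimplex A g.obj n) :
    (ofDeligne s).map f φ θ = ofDeligne (s.map g.property f φ.hom θ) := by
  have e : ∀ i j (hij : i ≤ j), ExpGroup.map (tensorHom f φ) ((ofDeligne s).hom (θ i) (θ j)) =
      (ofDeligne (s.map g.property f φ.hom θ)).hom i j := fun i j hij => by
    rw [ofDeligne_hom _ hij, ofDeligne_hom _ (θ.monotone hij)]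
    rfl
  refine eq_of (fun i => map_constMC f φ _) (fun i j => ?_)
  rcases le_total i j with hij | hij
  · exact e i j hij
  · rw [← hom_inv, ← hom_inv (ofDeligne _)]
    exact congrArg (·⁻¹) (e j i hij)

section Straighten

variable (C : Fin (n + 1) → Contraction A)

/-- The gauge transformations which make the objects of a chain constant, by means of a
contraction of `A` for each vertex. -/
def straighten (s : GaugeChain A g n) (i : Fin (n + 1)) : ExpGroup (tensorObj A g) :=
  ⟨(C i).gaugeFix g.property (s.obj i).2.1, (C i).gaugeFix_mem g.property (s.obj i).2.1⟩

/-- The value of the `i`-th object under the augmentation of the `i`-th contraction. -/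
def vertexValue (s : GaugeChain A g n) (i : Fin (n + 1)) : g.obj.MC :=
  MC.map ((C i).eval g.obj) (s.obj i)

theorem straighten_smul (s : GaugeChain A g n) (i : Fin (n + 1)) :
    straighten C s i • s.obj i = constMC A g (vertexValue C s i) :=
  Subtype.ext ((C i).gauge_gaugeFix g.property (s.obj i).2.1 (s.obj i).2.2)

theorem twist_straighten_obj (s : GaugeChain A g n) (i : Fin (n + 1)) :
    (s.twist (straighten C s)).obj i = constMC A g (vertexValue C s i) := straighten_smul C s i

/-- The simplex of the nerve of the simplicial Deligne groupoid obtained by straightening. -/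
def toDeligne (s : GaugeChain A g n) : DeligneNerveSimplex A g.obj n where
  obj := vertexValue C s
  hom i j _ := ((s.twist (straighten C s)).hom i j).1
  isMorphism i j _ := by
    refine ⟨((s.twist (straighten C s)).hom i j).2, ?_⟩
    have e := (s.twist (straighten C s)).hom_smul i j
    rw [twist_straighten_obj, twist_straighten_obj] at e
    exact congrArg Subtype.val e
  hom_id i := congrArg Subtype.val ((s.twist (straighten C s)).hom_self i)
  hom_comp i j l _ _ := congrArg Subtype.val ((s.twist (straighten C s)).hom_mul i j l).symm

theorem ofDeligne_toDeligne (s : GaugeChain A g n) :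
    ofDeligne (toDeligne C s) = s.twist (straighten C s) := by
  refine eq_of (fun i => (straighten_smul C s i).symm) (fun i j => ?_)
  change (s.twist (straighten C s)).hom 0 j * ((s.twist (straighten C s)).hom 0 i)⁻¹ = _
  rw [hom_inv, hom_mul]

theorem vertexValue_ofDeligne (s : DeligneNerveSimplex A g.obj n) (i : Fin (n + 1)) :
    vertexValue C (ofDeligne s) i = s.obj i :=
  Subtype.ext ((C i).eval_const g.obj _)

theorem straighten_ofDeligne (s : DeligneNerveSimplex A g.obj n) :
    straighten C (ofDeligne s) = fun _ => 1 :=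
  funext fun i => Subtype.ext ((C i).gaugeFix_const g.property (constMC A g (s.obj i)).2.1)

theorem toDeligne_ofDeligne (s : DeligneNerveSimplex A g.obj n) :
    toDeligne C (ofDeligne s) = s := by
  refine DeligneNerveSimplex.eq_of (funext fun i => vertexValue_ofDeligne C s i)
    fun i j hij => ?_
  change (((ofDeligne s).twist (straighten C (ofDeligne s))).hom i j).1 = _
  rw [straighten_ofDeligne, twist_one, ofDeligne_hom s hij]
  rfl

variable {C} {D : Fin (m + 1) → Contraction B} (f : A ⟶ B) (φ : g ⟶ h)
  (θ : Fin (m + 1) → Fin (n + 1))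

theorem map_straighten (e : ∀ i a, f.toAlgHom ((C (θ i)).η a) = (D i).η (f.toAlgHom a))
    (s : GaugeChain A g n) (i : Fin (m + 1)) :
    ExpGroup.map (tensorHom f φ) (straighten C s (θ i)) = straighten D (s.map f φ θ) i :=
  Subtype.ext ((C (θ i)).tensorMap_gaugeFix g.property (s.obj (θ i)).2.1 f φ.hom (e i)
    h.property ((s.map f φ θ).obj i).2.1)

theorem map_vertexValue (e : ∀ i a, (D i).ε (f.toAlgHom a) = (C (θ i)).ε a)
    (s : GaugeChain A g n) (i : Fin (m + 1)) :
    MC.map φ.hom (vertexValue C s (θ i)) = vertexValue D (s.map f φ θ) i :=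
  Subtype.ext ((C (θ i)).eval_tensorMap f φ.hom (e i) _).symm

end Straighten

end GaugeChain

/-! ### The simplicial set of chains of gauge transformations -/

section Nerve

variable (k : Type u) [Field k] [CharZero k]

/-- The functor sending `g` to the diagonal of the nerves of the Deligne groupoids of the
`Ω_n ⊗ g`. -/
def gaugeNerve : NilpotentDGLie k ⥤ SSet.{u} where
  obj g :=
    { obj := fun n => GaugeChain ((PolyForms.omega k).obj n) g n.unop.len
      map := fun φ => ↾(GaugeChain.map ((PolyForms.omega k).map φ) (𝟙 g) φ.unop.toOrderHom)
      map_id := fun n => by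
        ext s
        change GaugeChain.map ((PolyForms.omega k).map (𝟙 n)) (𝟙 g) id s = s
        rw [CategoryTheory.Functor.map_id, GaugeChain.map_id]
      map_comp := fun {a b c} φ ψ => by
        ext s
        change GaugeChain.map ((PolyForms.omega k).map (φ ≫ ψ)) (𝟙 g) _ s =
          GaugeChain.map _ _ _ (GaugeChain.map _ _ _ s)
        rw [GaugeChain.map_map, CategoryTheory.Functor.map_comp, Category.comp_id]
        rfl }
  map {g h} f :=
    { app := fun n => ↾(GaugeChain.map (𝟙 ((PolyForms.omega k).obj n)) f id)
      naturality := fun m n φ => by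
        ext s
        change GaugeChain.map _ _ _ (GaugeChain.map _ _ _ s) =
          GaugeChain.map _ _ _ (GaugeChain.map _ _ _ s)
        rw [GaugeChain.map_map, GaugeChain.map_map, Category.comp_id, Category.comp_id,
          Category.id_comp, Category.id_comp]
        rfl }
  map_id g := by
    ext n s
    exact GaugeChain.map_id s
  map_comp {g h l} f f' := by
    ext n s
    change GaugeChain.map _ _ _ s = GaugeChain.map _ _ _ (GaugeChain.map _ _ _ s)
    rw [GaugeChain.map_map, Category.comp_id]
    rfl

variable {k}

/-- A simplicial family of gauge transformations at the vertices of the simplices of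
`gaugeNerve`. -/
structure GaugeFamily (g : NilpotentDGLie k) where
  toFun : ∀ {n : SimplexCategoryᵒᵖ}, ((gaugeNerve k).obj g).obj n → Fin (n.unop.len + 1) →
    ExpGroup (tensorObj ((PolyForms.omega k).obj n) g)
  map_toFun : ∀ {n m : SimplexCategoryᵒᵖ} (φ : n ⟶ m) (s : ((gaugeNerve k).obj g).obj n)
    (i : Fin (m.unop.len + 1)),
    ExpGroup.map (tensorHom ((PolyForms.omega k).map φ) (𝟙 g))
      (toFun s (φ.unop.toOrderHom i)) = toFun (((gaugeNerve k).obj g).map φ s) i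

namespace GaugeFamily

variable {g : NilpotentDGLie k} (w : GaugeFamily g)

open MonoidalCategory Simplicial

/-- The endomorphism of `gaugeNerve` which applies the gauge transformations of the family. -/
def twist : (gaugeNerve k).obj g ⟶ (gaugeNerve k).obj g where
  app n := ↾(fun s => GaugeChain.twist s (w.toFun s))
  naturality n m φ := by
    ext s
    refine Eq.trans ?_ (GaugeChain.map_twist _ (𝟙 g) φ.unop.toOrderHom s (w.toFun s)).symm
    exact congrArg (GaugeChain.twist _) (funext fun i => (w.map_toFun φ s i).symm)

/-- The homotopy which applies the gauge transformations of the family at the vertices lying over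
the vertex `0` of the interval, and the identity at the others. -/
def cylinder : (gaugeNerve k).obj g ⊗ Δ[1] ⟶ (gaugeNerve k).obj g where
  app n := ↾(fun p => GaugeChain.twist p.1 fun i =>
    if (SSet.stdSimplex.objEquiv p.2).toOrderHom i = 0 then w.toFun p.1 i else 1)
  naturality n m φ := by
    ext p
    refine Eq.trans ?_ (GaugeChain.map_twist _ (𝟙 g) φ.unop.toOrderHom p.1 _).symm
    refine congrArg (GaugeChain.twist _) (funext fun i => ?_)
    exact ((apply_ite (ExpGroup.map _) _ _ _).trans
      (if_congr Iff.rfl (w.map_toFun φ p.1 i) (map_one _))).symm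

/-- Applying a simplicial family of gauge transformations is homotopic to the identity. -/
def homotopy : SSet.Homotopy w.twist (𝟙 ((gaugeNerve k).obj g)) where
  h := w.cylinder
  h₀ := by
    ext n s
    exact congrArg (GaugeChain.twist s) (funext fun i => if_pos rfl)
  h₁ := by
    ext n s
    exact (congrArg (GaugeChain.twist s) (funext fun i => if_neg one_ne_zero)).trans
      (GaugeChain.twist_one s)
  rel := by
    ext n ⟨x, t⟩
    exact x.2.elim

/-- The inclusion of a retract of `gaugeNerve` is a homotopy equivalence if the corresponding
idempotent is given by a simplicial family of gauge transformations. -/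
theorem isSimplicialHomotopyEquivalence {X : SSet.{u}} (f : X ⟶ (gaugeNerve k).obj g)
    (r : (gaugeNerve k).obj g ⟶ X) (h : f ≫ r = 𝟙 X) (h' : r ≫ f = w.twist) :
    IsSimplicialHomotopyEquivalence f :=
  ⟨r, ⟨SSet.RelativeMorphism.Homotopy.ofEq (by rw [h])⟩, ⟨h' ▸ w.homotopy⟩⟩

end GaugeFamily

/-! ### The two homotopy equivalences -/

variable (k) in
/-- The inclusion of `Σ(g)` as the constant chains. -/
def constChain : hinichNerve k ⟶ gaugeNerve k where
  app g :=
    { app := fun n => ↾(GaugeChain.const ((PolyForms.omega k).obj n) g n.unop.len)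
      naturality := fun n m φ => by
        ext x
        exact (GaugeChain.map_const _ _ _ x).symm }
  naturality g h f := by
    ext n x
    exact (GaugeChain.map_const _ _ _ x).symm

/-- The gauge transformations from the vertices of a chain to its barycentre. -/
def centreFamily (g : NilpotentDGLie k) : GaugeFamily g where
  toFun {n} s := GaugeChain.centre (barycentricCoordinates k n.unop.len) s
  map_toFun {n m} φ s i := GaugeChain.map_centre (barycentricCoordinates k n.unop.len)
    (barycentricCoordinates k m.unop.len) _ (𝟙 g) _
    (PolyForms.pullback_t φ.unop.toOrderHom) s i

/-- The retraction of a chain to the Maurer-Cartan element at its barycentre. -/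
def centreRetraction (g : NilpotentDGLie k) : (gaugeNerve k).obj g ⟶ (hinichNerve k).obj g where
  app n := ↾(fun s => GaugeChain.centrePoint (barycentricCoordinates k n.unop.len) s)
  naturality n m φ := by
    ext s
    exact (GaugeChain.map_centrePoint (barycentricCoordinates k n.unop.len)
      (barycentricCoordinates k m.unop.len) ((PolyForms.omega k).map φ) (𝟙 g) _
      (PolyForms.pullback_t φ.unop.toOrderHom) s).symm

theorem constChain_isSimplicialHomotopyEquivalence (g : NilpotentDGLie k) :
    IsSimplicialHomotopyEquivalence ((constChain k).app g) := by
  refine (centreFamily g).isSimplicialHomotopyEquivalence _ (centreRetraction g) ?_ ?_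
  · ext n x
    exact GaugeChain.centrePoint_const (barycentricCoordinates k n.unop.len) x
  · ext n s
    exact (GaugeChain.twist_centre (barycentricCoordinates k n.unop.len) s).symm

variable (k) in
/-- The inclusion of the nerve of the simplicial Deligne groupoid as the chains with constant
objects. -/
def deligneChain : deligneNerve k ⟶ gaugeNerve k where
  app g :=
    { app := fun n => ↾(fun s => GaugeChain.ofDeligne s)
      naturality := fun n m φ => by
        ext s
        exact (GaugeChain.map_ofDeligne _ (𝟙 g) _ s).symm }
  naturality g h f := by
    ext n s
    exact (GaugeChain.map_ofDeligne _ f OrderHom.id s).symm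

/-- The gauge transformations from the objects of a chain to constant Maurer-Cartan elements. -/
def straightenFamily (g : NilpotentDGLie k) : GaugeFamily g where
  toFun {n} s := GaugeChain.straighten
    (fun i => vertexContraction (k := k) (n := n.unop.len) i) s
  map_toFun φ s i := GaugeChain.map_straighten _ (𝟙 g) φ.unop.toOrderHom
    (fun i a => PolyForms.pullback_homotopy φ.unop.toOrderHom i a) s i

/-- The retraction onto the nerve of the simplicial Deligne groupoid by straightening. -/
def straightenRetraction (g : NilpotentDGLie k) :
    (gaugeNerve k).obj g ⟶ (deligneNerve k).obj g where
  app n := ↾(fun s => GaugeChain.toDeligne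
    (fun i => vertexContraction (k := k) (n := n.unop.len) i) s)
  naturality n m φ := by
    ext s
    refine DeligneNerveSimplex.eq_of (funext fun i => ?_) fun i j hij => ?_
    · exact (GaugeChain.map_vertexValue _ (𝟙 g) φ.unop.toOrderHom
        (fun i a => PolyForms.evalVertex_pullback φ.unop.toOrderHom i a) s i).symm
    · have e := (straightenFamily g).twist.naturality φ
      have e' := congrArg (fun F : GaugeChain _ g _ => F.hom i j) (ConcreteCategory.congr_hom e s)
      exact congrArg Subtype.val e'

theorem deligneChain_isSimplicialHomotopyEquivalence (g : NilpotentDGLie k) :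
    IsSimplicialHomotopyEquivalence ((deligneChain k).app g) := by
  refine (straightenFamily g).isSimplicialHomotopyEquivalence _ (straightenRetraction g) ?_ ?_
  · ext n s
    exact GaugeChain.toDeligne_ofDeligne _ s
  · ext n s
    exact GaugeChain.ofDeligne_toDeligne _ s

end Nerve

end

theorem mainTheorem2 (k : Type u) [Field k] [CharZero k] :
    NaturallyHomotopyEquivalent (hinichNerve k) (deligneNerve k) :=
  (Relation.EqvGen.rel _ _
    ⟨constChain k, constChain_isSimplicialHomotopyEquivalence⟩).trans _ _ _
  (Relation.EqvGen.rel _ _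
    ⟨deligneChain k, deligneChain_isSimplicialHomotopyEquivalence⟩).symm
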